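/- Let $M$ be an $m$-dimensional compact $C^\infty$ Riemannian manifold with distance $d$, and let $f\in \mathrm{Diff}^n(M)$, $1\le n\le\infty$, be partially hyperbolic: there are an invariant splitting $T_xM=E^s_x\oplus E^c_x\oplus E^u_x$ ($x\in M$) and numbers $C>0$, $0<\lambda<1<\mu$, $\lambda<\lambda'\le\mu'<\mu$ such that for all $j\ge 0$ $$\|d_xf^jv\|\le C\lambda^j\|v\|\ (v\in E^s_x),\quad C^{-1}(\lambda')^j\|v\|\le\|d_xf^jv\|\le C(\mu')^j\|v\|\ (v\in E^c_x),\quad C^{-1}\mu^j\|v\|\le\|d_xf^jv\|\ (v\in E^u_x).$$ Assume that there is a $C^1$ foliation $\mathcal W^c$ of $M$ (given by $C^1$ foliation charts) whose leaves are tangent to $E^c$. For $x\in M$ and $\rho>0$ put $B(x,\rho)=\{y: d(x,y)<\rho\}$ and $\Sigma_\rho(x)=\exp_x\{v\in E^s_x\oplus E^u_x:\|v\|<\rho\}$. Then for every sufficiently small $\rho>0$ the following holds. For every $x\in M$ the map $\exp_x$ is injective on $\{v\in T_xM:\|v\|<\rho\}$; let $\exp_x^{-1}$ denote the inverse of this restriction.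 There are $r\in(0,\rho)$, $K>1$ and $C^1$ maps $\tau^{(2)}_x:B(x,r)\to M$ ($x\in M$) such that for each $y\in B(x,r)$ the point $\tau_x^{(2)}(y)$ is the unique point of $\Sigma_\rho(x)$ that can be joined to $y$ by a path in $B(x,\rho)$ along the leaf $\mathcal W^c(y)$ (a path that is continuous for the leaf topology), and $d(\tau^{(2)}_x(y),x)\le K\,d(y,x)$. Moreover, there is $\varepsilon_0\in(0,\rho)$ such that for every $\varepsilon\in(0,\varepsilon_0)$ there is $\delta>0$ such that for every homeomorphism $g$ of $M$ with $\sup_{x} d(f(x),g(x))<\delta$ there is a surjective continuous map $\pi:M\to M$ with $f(\pi(x))\in B(g(x),r)$ and $$\pi\circ g(x)=\tau^{(2)}_{g(x)}\circ f\circ\pi(x)\quad\text{for all }x\in M,$$ which satisfies $$\sup_{x}d(\pi(x),x)<\varepsilon,\qquad \exp_x^{-1}(\pi(x))\in E^s_x\oplus E^u_x\quad\text{for all }x\in M,$$ and $\pi$ is the only continuous map $M\to M$ with these properties. -/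

import Mathlib

open Set Filter Topology Manifold Bundle
open scoped ENNReal ContDiff

noncomputable section

section Riemannian

variable {m : ℕ} {M : Type*} [EMetricSpace M] [ChartedSpace (EuclideanSpace ℝ (Fin m)) M]
  [RiemannianBundle (fun x : M => TangentSpace (𝓡 m) x)]

/-- The open ball of radius `ρ` around `x`. -/
def rBall (x : M) (ρ : ℝ) : Set M := {y | edist y x < ENNReal.ofReal ρ}

/-- The uniform distance `sup_x d(f x, g x)` of two maps. -/
def unifDist (f g : M → M) : ℝ≥0∞ := ⨆ x, edist (f x) (g x)

/-- The Riemannian metric read in the chart at `x₀`: the inner product, at the point with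
coordinates `p`, of the tangent vectors with coordinates `v` and `w`. -/
def chartMetric (x₀ : M) (p v w : EuclideanSpace ℝ (Fin m)) : ℝ :=
  inner ℝ
    (mfderiv 𝓘(ℝ, EuclideanSpace ℝ (Fin m)) (𝓡 m) (extChartAt (𝓡 m) x₀).symm p v :
      TangentSpace (𝓡 m) ((extChartAt (𝓡 m) x₀).symm p))
    (mfderiv 𝓘(ℝ, EuclideanSpace ℝ (Fin m)) (𝓡 m) (extChartAt (𝓡 m) x₀).symm p w :
      TangentSpace (𝓡 m) ((extChartAt (𝓡 m) x₀).symm p))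

/-- `γ` is a geodesic on the open set `s` of times: in every chart it is twice differentiable,
with velocity `c'` and acceleration `a`, and satisfies the geodesic equation
`a ^ k + Γ ^ k _ {ij} c' ^ i c' ^ j = 0`.  The index `k` is lowered here: with `G` the metric in the
chart, the equation paired with an arbitrary vector `w` is
`G(a, w) + (D_{c'} G)(c', w) - (1/2) (D_w G)(c', c') = 0`. -/
def IsGeodesicOn (γ : ℝ → M) (s : Set ℝ) : Prop :=
  ContinuousOn γ s ∧
  ∀ (x₀ : M), ∀ t ∈ s, γ t ∈ (chartAt (EuclideanSpace ℝ (Fin m)) x₀).source →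
    ∃ (c' : ℝ → EuclideanSpace ℝ (Fin m)) (a : EuclideanSpace ℝ (Fin m)),
      (∀ᶠ u in 𝓝 t, HasDerivAt (fun u => extChartAt (𝓡 m) x₀ (γ u)) (c' u) u) ∧
      HasDerivAt c' a t ∧
      ∀ w : EuclideanSpace ℝ (Fin m),
        chartMetric x₀ (extChartAt (𝓡 m) x₀ (γ t)) a w
          + fderiv ℝ (fun p => chartMetric x₀ p (c' t) w) (extChartAt (𝓡 m) x₀ (γ t)) (c' t)
          - (1 / 2) * fderiv ℝ (fun p => chartMetric x₀ p (c' t) (c' t))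
              (extChartAt (𝓡 m) x₀ (γ t)) w = 0

/-- `y = exp_x v`: a geodesic that starts at `x` with velocity `v` is at `y` at time `1`. -/
def IsExp (x : M) (v : TangentSpace (𝓡 m) x) (y : M) : Prop :=
  ∃ (γ : ℝ → M) (η : ℝ), 0 < η ∧ IsGeodesicOn (m := m) γ (Ioo (-η) (1 + η)) ∧
    (⟨γ 0, mfderiv 𝓘(ℝ, ℝ) (𝓡 m) γ 0 (1 : ℝ)⟩ : TangentBundle (𝓡 m) M) = ⟨x, v⟩ ∧ γ 1 = y

open Classical in
/-- The Riemannian exponential map (with the value `x` where it is undefined). -/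
def expMap (x : M) (v : TangentSpace (𝓡 m) x) : M :=
  if h : ∃ y, IsExp x v y then h.choose else x

variable (m M) in
/-- On the ball of radius `ρ` in every tangent space, the exponential map is well defined and
injective, so that it has an inverse `exp_x⁻¹` with values in that ball. -/
def IsExpRadius (ρ : ℝ) : Prop :=
  ∀ x : M, (∀ v : TangentSpace (𝓡 m) x, ‖v‖ < ρ → ∃! y, IsExp x v y) ∧
    InjOn (expMap x) {v : TangentSpace (𝓡 m) x | ‖v‖ < ρ}

/-- The disk `Σ_ρ(x) = exp_x {v ∈ E^s_x ⊕ E^u_x : ‖v‖ < ρ}`. -/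
def suDisk (Es Eu : ∀ x : M, Submodule ℝ (TangentSpace (𝓡 m) x)) (x : M) (ρ : ℝ) : Set M :=
  expMap x '' {v : TangentSpace (𝓡 m) x | v ∈ Es x ⊔ Eu x ∧ ‖v‖ < ρ}

/-- `f` is (uniformly) partially hyperbolic with the splitting `TM = E^s ⊕ E^c ⊕ E^u`. -/
structure IsPartiallyHyperbolic (f : M → M)
    (Es Ec Eu : ∀ x : M, Submodule ℝ (TangentSpace (𝓡 m) x)) : Prop where
  disjoint_su : ∀ x, Disjoint (Es x) (Eu x)
  isCompl : ∀ x, IsCompl (Ec x) (Es x ⊔ Eu x)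
  map_s : ∀ x, (Es x).map (mfderiv (𝓡 m) (𝓡 m) f x).toLinearMap = Es (f x)
  map_c : ∀ x, (Ec x).map (mfderiv (𝓡 m) (𝓡 m) f x).toLinearMap = Ec (f x)
  map_u : ∀ x, (Eu x).map (mfderiv (𝓡 m) (𝓡 m) f x).toLinearMap = Eu (f x)
  bounds : ∃ l l' μ' μ C : ℝ, 0 < l ∧ l < 1 ∧ 1 < μ ∧ l < l' ∧ l' ≤ μ' ∧ μ' < μ ∧ 0 < C ∧
    ∀ (n : ℕ) (x : M),
      (∀ v ∈ Es x, ‖mfderiv (𝓡 m) (𝓡 m) f^[n] x v‖ ≤ C * l ^ n * ‖v‖) ∧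
      (∀ v ∈ Ec x, C⁻¹ * l' ^ n * ‖v‖ ≤ ‖mfderiv (𝓡 m) (𝓡 m) f^[n] x v‖ ∧
        ‖mfderiv (𝓡 m) (𝓡 m) f^[n] x v‖ ≤ C * μ' ^ n * ‖v‖) ∧
      (∀ v ∈ Eu x, C⁻¹ * μ ^ n * ‖v‖ ≤ ‖mfderiv (𝓡 m) (𝓡 m) f^[n] x v‖)

end Riemannian

section Foliation

/-- A `C^1` foliation with `k`-dimensional leaves and codimension `q`, given by an atlas of
`C^1` foliation charts `φ : U → ℝ^k × ℝ^q`; the transition maps are locally of the form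
`(a, b) ↦ (h₁(a, b), h(b))`. -/
structure C1Foliation (m k q : ℕ) (M : Type*) [TopologicalSpace M]
    [ChartedSpace (EuclideanSpace ℝ (Fin m)) M] where
  charts : Set (OpenPartialHomeomorph M (EuclideanSpace ℝ (Fin k) × EuclideanSpace ℝ (Fin q)))
  covers : ∀ x : M, ∃ φ ∈ charts, x ∈ φ.source
  contMDiffOn : ∀ φ ∈ charts, ContMDiffOn (𝓡 m)
    𝓘(ℝ, EuclideanSpace ℝ (Fin k) × EuclideanSpace ℝ (Fin q)) 1 φ φ.source
  contMDiffOn_symm : ∀ φ ∈ charts, ContMDiffOn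
    𝓘(ℝ, EuclideanSpace ℝ (Fin k) × EuclideanSpace ℝ (Fin q)) (𝓡 m) 1 φ.symm φ.target
  compatible : ∀ φ ∈ charts, ∀ ψ ∈ charts, ∀ x ∈ φ.source ∩ ψ.source,
    ∃ h : EuclideanSpace ℝ (Fin q) → EuclideanSpace ℝ (Fin q),
      ∀ᶠ y in 𝓝 x, (ψ y).2 = h (φ y).2

variable {m k q : ℕ} {M : Type*} [TopologicalSpace M]
  [ChartedSpace (EuclideanSpace ℝ (Fin m)) M]

/-- The leaf through `y` of the foliation restricted to `U`: the points that are joined to `y` by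
a continuous path in `U` along which the transverse coordinates in foliation charts are locally
constant. -/
def C1Foliation.leafIn (W : C1Foliation m k q M) (U : Set M) (y : M) : Set M :=
  {z | ∃ γ : Path y z, ∀ t, γ t ∈ U ∧
    ∃ φ ∈ W.charts, γ t ∈ φ.source ∧ ∀ᶠ s in 𝓝 t, (φ (γ s)).2 = (φ (γ t)).2}

/-- The (global) leaf through `y`. -/
def C1Foliation.leaf (W : C1Foliation m k q M) (y : M) : Set M := W.leafIn univ y

/-- The leaves are tangent to the subspaces `E`. -/
def C1Foliation.IsTangentTo (W : C1Foliation m k q M)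
    (E : ∀ x : M, Submodule ℝ (TangentSpace (𝓡 m) x)) : Prop :=
  ∀ φ ∈ W.charts, ∀ x ∈ φ.source, ∀ v : TangentSpace (𝓡 m) x,
    v ∈ E x ↔ (mfderiv (𝓡 m) 𝓘(ℝ, EuclideanSpace ℝ (Fin k) × EuclideanSpace ℝ (Fin q)) φ x v :
      EuclideanSpace ℝ (Fin k) × EuclideanSpace ℝ (Fin q)).2 = 0

end Foliation

section Slide

variable {m k q : ℕ} {M : Type*} [EMetricSpace M] [ChartedSpace (EuclideanSpace ℝ (Fin m)) M]
  [RiemannianBundle (fun x : M => TangentSpace (𝓡 m) x)]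

/-- `τ` is the family of slides along the leaves of `W` onto the transversal disks: for `y` within
distance `r` of `x`, `τ x y` is the unique point of `Σ_ρ(x)` on the local leaf of `y` in the ball
of radius `ρ` around `x`.  It lies on the global leaf, depends in a `C^1` way on `y`, and its
distance to `x` is at most `K` times that of `y`. -/
structure IsCenterSlide (W : C1Foliation m k q M)
    (Es Eu : ∀ x : M, Submodule ℝ (TangentSpace (𝓡 m) x)) (ρ r K : ℝ) (τ : M → M → M) : Prop where
  inter_eq : ∀ x, ∀ y ∈ rBall x r, suDisk Es Eu x ρ ∩ W.leafIn (rBall x ρ) y = {τ x y}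
  mem_leaf : ∀ x, ∀ y ∈ rBall x r, τ x y ∈ W.leaf y
  contMDiffOn : ∀ x, ContMDiffOn (𝓡 m) (𝓡 m) 1 (τ x) (rBall x r)
  edist_le : ∀ x, ∀ y ∈ rBall x r, edist (τ x y) x ≤ ENNReal.ofReal K * edist y x

/-- `p` is `ε`-close to the identity, with `exp_x⁻¹ (p x) ∈ E^s_x ⊕ E^u_x` for all `x` (where
`exp_x⁻¹` takes values in the ball of radius `ρ`), and `p (g x) = τ_{g x} (f (p x))` for all `x`,
the point `f (p x)` being in the domain of `τ_{g x}`, which is the ball of radius `r`. -/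
structure IsQuasiConj (Es Eu : ∀ x : M, Submodule ℝ (TangentSpace (𝓡 m) x)) (ρ r : ℝ)
    (τ : M → M → M) (f g : M → M) (ε : ℝ) (p : M → M) : Prop where
  close : unifDist p id < ENNReal.ofReal ε
  mem_disk : ∀ x, p x ∈ suDisk Es Eu x ρ
  mem_dom : ∀ x, f (p x) ∈ rBall (g x) r
  conj : ∀ x, p (g x) = τ (g x) (f (p x))

end Slide

end

/-!
A tangent vector at a point of `M` is treated as an element of a fixed Euclidean space `V`, by means
of an immersion `e : M → V`; linear maps on different tangent spaces can then be compared, and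
sections of `E^s ⊕ E^u` are functions `M → V`.  Three facts carry the proof.

*The splitting.*  A vector is stable if and only if its forward iterates are bounded by a constant
times `λ ^ n`; the constant can be chosen uniformly, so the stable vectors form a closed set, and so
do the unstable vectors (`IsDominatedPair.isClosed_embSub`).  The center subspaces form a closed set
because they are tangent to a `C^1` foliation (`isClosed_center`).  By compactness a closed
splitting is continuous (`exists_continuous_projections`), and the derivative of `f` acts on `E^s ⊕ E^u` as a
continuous hyperbolic cocycle with adapted norms (`IsDominatedPair.exists_isHyperbolicCocycle`).

*The slides.*  The geodesic flow is `C^1`, and the exponential map has the derivative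
`(p, v) ↦ p + v` at the zero vectors in charts (`exists_second_order_flow`, `exists_chart_exp`).
Hence a `C^1` function composed with `exp_x` is close to its derivative at `x`, with a Lipschitz
error that is uniform in `x` (`IsC1Immersion.exists_norm_comp_expV_sub_le`).  Applied to the
transverse coordinates of a foliation chart, whose derivative is invertible on `E^s ⊕ E^u`, this
shows that the plaque of a point near `x` meets the disk `Σ_ρ(x)` in exactly one point
(`IsTransversal.exists_slide`, `IsTransversal.exists_eq_of_mem_leafIn`), and that `f` followed by
the slide onto the disk at a point near `f x` is, uniformly in `x`, close to the projection of the
derivative of `f` to `E^s ⊕ E^u` (`IsTransversal.exists_norm_sub_sub_le`).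

*Shadowing.*  A map `π` with `exp_x⁻¹ (π x) ∈ E^s ⊕ E^u` is a section `v` of `E^s ⊕ E^u`, and the
equation for `π` becomes `v (g x) = H_x (v x)`, where the fibre maps `H_x` are Lipschitz close to
the hyperbolic cocycle.  Solving it forwards in the stable and backwards in the unstable component
is a contraction of the small sections, so there is exactly one small solution, and it is continuous
(`IsHyperbolicCocycle.exists_orbit`, `IsHyperbolicCocycle.exists_isQuasiConj`).

Finally, `π` is surjective because every continuous self-map of a compact manifold that is close
enough to the identity is (`exists_pos_forall_surjective_of_near_id`); this rests on the theorem
that there is no `C^1` retraction of a ball onto its boundary (`not_exists_retraction_sphere`).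
-/

noncomputable section

set_option linter.unusedSectionVars false
set_option maxSynthPendingDepth 3

/-! ### Maps of a ball close to the identity -/

section Retraction

open MeasureTheory Polynomial

variable {E : Type*} [NormedAddCommGroup E] [InnerProductSpace ℝ E] [FiniteDimensional ℝ E]

/-- The function `t ↦ det (1 + t A)` is a polynomial of degree at most the dimension. -/
lemma exists_polynomial_det_one_add_smul (A : E →L[ℝ] E) :
    ∃ P : ℝ[X], P.degree < (Module.finrank ℝ E + 1 : ℕ) ∧
      ∀ t : ℝ, P.eval t = (1 + t • A : E →L[ℝ] E).det := by
  classical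
  set b := Module.finBasis ℝ E
  set N := LinearMap.toMatrix b b (A : E →ₗ[ℝ] E)
  refine ⟨Matrix.det ((X : ℝ[X]) • N.map C + (1 : Matrix _ _ ℝ).map C), ?_, fun t => ?_⟩
  · have h := Polynomial.natDegree_det_X_add_C_le N 1
    simp only [Fintype.card_fin] at h
    exact (Polynomial.degree_le_natDegree.trans_lt (by exact_mod_cast Nat.lt_succ_of_le h))
  · rw [← Polynomial.coe_evalRingHom, RingHom.map_det, ContinuousLinearMap.det,
      ← LinearMap.det_toMatrix b]
    congr 1
    have : ((1 + t • A : E →L[ℝ] E) : E →ₗ[ℝ] E)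
        = (LinearMap.id + t • (A : E →ₗ[ℝ] E)) := rfl
    rw [this, (LinearMap.toMatrix b b).map_add, (LinearMap.toMatrix b b).map_smul,
      LinearMap.toMatrix_id]
    ext i j
    by_cases hij : i = j <;> simp [N, hij, add_comm] <;> exact mul_comm _ _

set_option maxHeartbeats 1000000 in
/-- There is no `C^1` retraction of a ball onto its boundary sphere: the volume of the image of the
ball under `z ↦ z + t (r z - z)` is a polynomial in `t`, equal to the volume of the ball for small
`t` and to `0` for `t = 1`. -/
theorem not_exists_retraction_sphere {a : ℝ} (ha : 0 < a) {r : E → E} {U : Set E} (hU : IsOpen U)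
    (hDU : Metric.closedBall 0 a ⊆ U) (hr : ContDiffOn ℝ 1 r U)
    (hrs : ∀ z, ‖z‖ = a → r z = z) (hra : ∀ z ∈ Metric.closedBall (0 : E) a, ‖r z‖ = a) : False := by
  classical
  borelize E
  set D := Metric.closedBall (0 : E) a with hD
  have hDc : IsCompact D := isCompact_closedBall _ _
  set A : E → E →L[ℝ] E := fun z => fderiv ℝ r z - 1 with hA
  have hdiff : ∀ z ∈ D, HasFDerivAt r (fderiv ℝ r z) z := fun z hz =>
    ((hr.contDiffAt (hU.mem_nhds (hDU hz))).differentiableAt one_ne_zero).hasFDerivAt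
  have hAc : ContinuousOn A D :=
    ((hr.continuousOn_fderiv_of_isOpen hU le_rfl).mono hDU).sub continuousOn_const
  obtain ⟨L₀, hL₀⟩ := hDc.exists_bound_of_continuousOn hAc
  set L := max L₀ 1
  have hL : ∀ z ∈ D, ‖A z‖ ≤ L := fun z hz => (hL₀ z hz).trans (le_max_left _ _)
  have hLpos : 0 < L := lt_of_lt_of_le one_pos (le_max_right _ _)
  set g : E → E := fun z => if z ∈ D then r z - z else 0 with hg
  have hgD : ∀ z ∈ D, g z = r z - z := fun z hz => by simp [hg, hz]
  have hgD' : ∀ z, z ∉ D → g z = 0 := fun z hz => by simp [hg, hz]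
  have hLip1 : ∀ x ∈ D, ∀ y ∈ D, ‖g x - g y‖ ≤ L * ‖x - y‖ := by
    intro x hx y hy
    rw [hgD x hx, hgD y hy]
    exact (convex_closedBall (0 : E) a).norm_image_sub_le_of_norm_hasFDerivWithin_le
      (f := fun z => r z - z) (f' := A)
      (fun z hz => ((hdiff z hz).sub (hasFDerivAt_id z)).hasFDerivWithinAt) hL hy hx
  have hLip2 : ∀ x ∈ D, ∀ y, y ∉ D → ‖g x - g y‖ ≤ 2 * L * ‖x - y‖ := by
    intro x hx y hy
    have hya : a < ‖y‖ := by simpa [hD] using hy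
    have hxa : ‖x‖ ≤ a := by simpa [hD] using hx
    have hy0 : 0 < ‖y‖ := ha.trans hya
    set b := (a / ‖y‖) • y with hb
    have hbn : ‖b‖ = a := by
      rw [hb, norm_smul, norm_div, Real.norm_of_nonneg ha.le, norm_norm]; field_simp
    have hbD : b ∈ D := by simp [hD, hbn]
    have hgb : g b = 0 := by rw [hgD b hbD, hrs b hbn, sub_self]
    rw [hgD' y hy, ← hgb]
    refine (hLip1 x hx b hbD).trans ?_
    have hyb : ‖y - b‖ = ‖y‖ - a := by
      have : y - b = (1 - a / ‖y‖) • y := by rw [hb, sub_smul, one_smul]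
      rw [this, norm_smul, Real.norm_of_nonneg (by rw [sub_nonneg, div_le_one hy0]; exact hya.le)]
      field_simp
    have h1 : ‖y‖ - ‖x‖ ≤ ‖x - y‖ := by rw [norm_sub_rev]; exact norm_sub_norm_le y x
    have h2 : ‖x - b‖ ≤ ‖x - y‖ + ‖y - b‖ := norm_sub_le_norm_sub_add_norm_sub x y b
    nlinarith
  have hLip : ∀ x y, ‖g x - g y‖ ≤ 2 * L * ‖x - y‖ := by
    intro x y
    by_cases hx : x ∈ D <;> by_cases hy : y ∈ D
    · exact (hLip1 x hx y hy).trans (by nlinarith [norm_nonneg (x - y)])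
    · exact hLip2 x hx y hy
    · rw [norm_sub_rev, norm_sub_rev x]; exact hLip2 y hy x hx
    · rw [hgD' x hx, hgD' y hy]; simp; positivity
  obtain ⟨ε, hε, hdet⟩ : ∃ ε > 0, ∀ B : E →L[ℝ] E, ‖B‖ < ε → 0 < (1 + B : E →L[ℝ] E).det := by
    have hc : Continuous (fun B : E →L[ℝ] E => (1 + B : E →L[ℝ] E).det) :=
      ContinuousLinearMap.continuous_det.comp (continuous_const.add continuous_id)
    have h0 : (0 : ℝ) < (1 + (0 : E →L[ℝ] E) : E →L[ℝ] E).det := by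
      rw [add_zero]; simp [ContinuousLinearMap.det, ContinuousLinearMap.toLinearMap_one]
    obtain ⟨ε, hε, h⟩ := Metric.mem_nhds_iff.1 (hc.continuousAt.eventually (lt_mem_nhds h0))
    exact ⟨ε, hε, fun B hB => h (by simpa using hB)⟩
  obtain ⟨t₀, ht₀, ht₀1, ht₀2⟩ : ∃ t₀ > 0, t₀ * (2 * L) < 1 ∧ t₀ * L < ε := by
    refine ⟨min (1 / (4 * L)) (ε / (2 * L)), by positivity, ?_, ?_⟩
    · calc _ ≤ 1 / (4 * L) * (2 * L) := by gcongr; exact min_le_left _ _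
        _ < 1 := by field_simp; norm_num
    · calc _ ≤ ε / (2 * L) * L := by gcongr; exact min_le_right _ _
        _ < ε := by field_simp; norm_num
  -- for small `t` the map `z ↦ z + t (r z - z)` permutes the ball
  have hvol : ∀ t, 0 ≤ t → t ≤ t₀ →
      ∫ z in D, (1 + t • A z : E →L[ℝ] E).det = volume.real D := by
    intro t ht htt
    have htL : t * (2 * L) < 1 := (mul_le_mul_of_nonneg_right htt (by positivity)).trans_lt ht₀1
    set G : E → E := fun z => z + t • g z with hG
    have hinj : Function.Injective G := by
      intro x y hxy
      have h1 : x - y = t • (g y - g x) := by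
        simp only [hG] at hxy
        rw [smul_sub, sub_eq_sub_iff_add_eq_add, hxy, add_comm]
      have h2 : ‖x - y‖ ≤ t * (2 * L) * ‖x - y‖ := by
        conv_lhs => rw [h1, norm_smul, Real.norm_of_nonneg ht]
        rw [mul_assoc]
        gcongr
        rw [norm_sub_rev x]; exact hLip y x
      have h3 : ‖x - y‖ = 0 := by nlinarith [norm_nonneg (x - y)]
      exact sub_eq_zero.1 (norm_eq_zero.1 h3)
    have hsurj : Function.Surjective G := by
      intro y
      have hc : ContractingWith (Real.toNNReal (t * (2 * L))) (fun x => y - t • g x) := by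
        refine ⟨by rw [← NNReal.coe_lt_coe, Real.coe_toNNReal _ (by positivity)]; exact htL,
          LipschitzWith.of_dist_le_mul fun x x' => ?_⟩
        rw [Real.coe_toNNReal _ (by positivity), dist_eq_norm, dist_eq_norm]
        have : y - t • g x - (y - t • g x') = t • (g x' - g x) := by rw [smul_sub]; abel
        rw [this, norm_smul, Real.norm_of_nonneg ht, mul_assoc, norm_sub_rev x]
        gcongr
        exact hLip _ _
      have hfix := hc.fixedPoint_isFixedPt
      refine ⟨hc.fixedPoint, ?_⟩
      have h : y - t • g hc.fixedPoint = hc.fixedPoint := hfix.eq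
      simp only [hG]
      nth_rewrite 1 [← h]
      abel
    have himg : G '' D = D := by
      have hout : ∀ z, z ∉ D → G z = z := fun z hz => by simp [hG, hgD' z hz]
      ext z
      constructor
      · rintro ⟨x, hx, rfl⟩
        by_contra hGx
        exact hGx ((hinj (hout _ hGx)).symm ▸ hx)
      · intro hz
        obtain ⟨x, rfl⟩ := hsurj z
        by_cases hx : x ∈ D
        · exact ⟨x, hx, rfl⟩
        · rw [hout x hx] at hz; exact absurd hz hx
    have hder : ∀ z ∈ D, HasFDerivWithinAt G (1 + t • A z) D z := by
      intro z hz
      have h1 : HasFDerivWithinAt (fun z => z + t • (r z - z)) (1 + t • A z) D z :=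
        ((hasFDerivAt_id z).add
          (((hdiff z hz).sub (hasFDerivAt_id z)).const_smul t)).hasFDerivWithinAt
      exact h1.congr (fun x hx => by simp [hG, hgD x hx]) (by simp [hG, hgD z hz])
    have hcv := integral_image_eq_integral_abs_det_fderiv_smul volume hDc.measurableSet hder
      hinj.injOn (fun _ => (1 : ℝ))
    rw [himg] at hcv
    simp only [integral_const, smul_eq_mul, mul_one, measureReal_restrict_apply_univ] at hcv
    rw [hcv]
    refine setIntegral_congr_fun hDc.measurableSet fun z hz => ?_
    refine (abs_of_pos (hdet _ ?_)).symm
    rw [norm_smul, Real.norm_of_nonneg ht]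
    calc t * ‖A z‖ ≤ t₀ * L := by gcongr; exact hL z hz
      _ < ε := ht₀2
  -- interpolation at points of `[0, t₀]` gives the integral at `t = 1`
  set d := Module.finrank ℝ E
  set v : ℕ → ℝ := fun i => t₀ * (i / (d + 1)) with hv
  set s := Finset.range (d + 1)
  have hvs : InjOn v s := by
    intro i _ j _ hij
    have h1 : ((d : ℝ) + 1) ≠ 0 := by positivity
    simp only [hv] at hij
    have := mul_left_cancel₀ ht₀.ne' hij
    rw [div_left_inj' h1] at this
    exact_mod_cast this
  have hinterp : ∀ B : E →L[ℝ] E, (1 + (1 : ℝ) • B : E →L[ℝ] E).det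
      = ∑ i ∈ s, (1 + v i • B : E →L[ℝ] E).det * (Lagrange.basis s v i).eval 1 := by
    intro B
    obtain ⟨P, hP, hPt⟩ := exists_polynomial_det_one_add_smul B
    have h := Lagrange.eq_interpolate hvs (f := P) (by simpa [s] using hP)
    rw [← hPt, h, Lagrange.interpolate_apply, Polynomial.eval_finsetSum]
    simp only [Polynomial.eval_mul, Polynomial.eval_C, hPt]
  have hvi : ∀ i ∈ s, 0 ≤ v i ∧ v i ≤ t₀ := by
    intro i hi
    have hid : (i : ℝ) ≤ d + 1 := by exact_mod_cast (Finset.mem_range.1 hi).le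
    refine ⟨by positivity, mul_le_of_le_one_right ht₀.le ?_⟩
    rw [div_le_one (by positivity)]; exact hid
  have hint : ∀ t : ℝ, IntegrableOn (fun z => (1 + t • A z : E →L[ℝ] E).det) D volume := fun t =>
    ContinuousOn.integrableOn_compact hDc (ContinuousLinearMap.continuous_det.comp_continuousOn
      (f := fun z => (1 + t • A z : E →L[ℝ] E)) (continuousOn_const.add (hAc.const_smul t)))
  have h1 : ∫ z in D, (1 + (1 : ℝ) • A z : E →L[ℝ] E).det = volume.real D := by
    simp_rw [hinterp]
    rw [integral_finsetSum _ fun i _ => (hint (v i)).mul_const _]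
    simp_rw [integral_mul_const]
    rw [Finset.sum_congr rfl fun i hi => by rw [hvol (v i) (hvi i hi).1 (hvi i hi).2],
      ← Finset.mul_sum, ← Polynomial.eval_finsetSum,
      Lagrange.sum_basis hvs ⟨0, by simp [s]⟩]
    simp
  -- at `t = 1` the determinant vanishes
  have h2 : ∀ z ∈ D, (1 + (1 : ℝ) • A z : E →L[ℝ] E).det = 0 := by
    intro z hz
    by_contra hne
    have hAz : (1 + (1 : ℝ) • A z : E →L[ℝ] E) = fderiv ℝ r z := by simp [hA]
    rw [hAz] at hne
    have hbij : Function.Surjective (fderiv ℝ r z) := by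
      have hu : IsUnit (LinearMap.det (fderiv ℝ r z : E →ₗ[ℝ] E)) := isUnit_iff_ne_zero.2 hne
      exact ((Module.End.isUnit_iff _).1 ((LinearMap.isUnit_iff_isUnit_det _).2 hu)).2
    -- by continuity of the derivative it is enough to treat the interior of the ball
    have hperp : ∀ w ∈ Metric.ball (0 : E) a, ∀ u, inner ℝ (r w) (fderiv ℝ r w u) = (0 : ℝ) := by
      intro w hw u
      have hd := hdiff w (Metric.ball_subset_closedBall hw)
      have h3 : HasFDerivAt (fun x => ‖r x‖ ^ 2) _ w := hd.norm_sq
      have h4 : HasFDerivAt (fun x => ‖r x‖ ^ 2) (0 : E →L[ℝ] ℝ) w :=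
        (hasFDerivAt_const (a ^ 2) w).congr_of_eventuallyEq (by
          filter_upwards [Metric.isOpen_ball.mem_nhds hw] with x hx
          rw [hra x (Metric.ball_subset_closedBall hx)])
      have h5 := congrArg (fun T : E →L[ℝ] ℝ => T u) (h3.unique h4)
      simpa using h5
    obtain ⟨u, hu⟩ := hbij (r z)
    have hcl : z ∈ closure (Metric.ball (0 : E) a) := by rwa [closure_ball _ ha.ne']
    have hcont : ContinuousOn (fun w => (inner ℝ (r w) (fderiv ℝ r w u) : ℝ)) D :=
      (hr.continuousOn.mono hDU).inner
        (((hr.continuousOn_fderiv_of_isOpen hU le_rfl).mono hDU).clm_apply continuousOn_const)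
    have h6 : (inner ℝ (r z) (fderiv ℝ r z u) : ℝ) = 0 := by
      have hmem : (inner ℝ (r z) (fderiv ℝ r z u) : ℝ) ∈ closure ({0} : Set ℝ) :=
        ((hcont z hz).mono Metric.ball_subset_closedBall).mem_closure hcl
          (fun w hw => hperp w hw u)
      simpa using hmem
    rw [hu, real_inner_self_eq_norm_sq, hra z hz] at h6
    exact absurd h6 (by positivity)
  rw [setIntegral_congr_fun hDc.measurableSet h2] at h1
  simp only [integral_zero] at h1
  have : 0 < volume.real D := by
    rw [measureReal_def]
    exact ENNReal.toReal_pos (Metric.measure_closedBall_pos volume _ ha).ne' hDc.measure_lt_top.ne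
  linarith

/-- A continuous map of a ball that moves points by at most a quarter of the radius takes the
centre as a value.  Otherwise its radial projection to the sphere, smoothed, would give a `C^1`
retraction of the ball onto its boundary. -/
theorem exists_eq_zero_of_near_id {a : ℝ} (ha : 0 < a) {p : E → E}
    (hp : ContinuousOn p (Metric.closedBall 0 a))
    (hpz : ∀ z ∈ Metric.closedBall (0 : E) a, ‖p z - z‖ ≤ a / 4) :
    ∃ z ∈ Metric.closedBall (0 : E) a, p z = 0 := by
  by_contra! hne
  set D := Metric.closedBall (0 : E) a with hD
  have hDc : IsCompact D := isCompact_closedBall _ _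
  have h0D : (0 : E) ∈ D := Metric.mem_closedBall_self ha.le
  obtain ⟨z₀, hz₀, hmin⟩ := hDc.exists_isMinOn ⟨0, h0D⟩ hp.norm
  set c := ‖p z₀‖
  have hc : 0 < c := norm_pos_iff.2 (hne z₀ hz₀)
  have hcD : ∀ z ∈ D, c ≤ ‖p z‖ := fun z hz => hmin hz
  -- extension of `p` to the whole space by the radial retraction
  set R : E → E := fun z => (a / max a ‖z‖) • z with hR
  have hRc : Continuous R := by
    refine (continuous_const.div (continuous_const.max continuous_norm) fun z => ?_).smul
      continuous_id
    exact (lt_max_of_lt_left ha).ne'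
  have hRD : ∀ z, R z ∈ D := by
    intro z
    have : 0 < max a ‖z‖ := lt_max_of_lt_left ha
    rw [hD, mem_closedBall_zero_iff, hR, norm_smul, norm_div, Real.norm_of_nonneg ha.le,
      Real.norm_of_nonneg this.le, div_mul_eq_mul_div, div_le_iff₀ this]
    gcongr
    exact le_max_right _ _
  have hRid : ∀ z ∈ D, R z = z := by
    intro z hz
    have : ‖z‖ ≤ a := by simpa [hD] using hz
    simp [hR, max_eq_left this, div_self ha.ne']
  have hpR : Continuous (p ∘ R) := hp.comp_continuous hRc hRD
  obtain ⟨q, hq, hqp, -⟩ := hpR.exists_contDiff_approx 1 (ε := fun _ => min (a / 8) (c / 2))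
    continuous_const (fun _ => by positivity)
  have hqD : ∀ z ∈ D, ‖q z - p z‖ < min (a / 8) (c / 2) := by
    intro z hz
    have := hqp z
    rwa [dist_eq_norm, Function.comp_apply, hRid z hz] at this
  let χ : ContDiffBump (0 : E) := ⟨a / 2, a, by positivity, by linarith⟩
  set F : E → E := fun z => z + χ z • (q z - z) with hF
  have hFC : ContDiff ℝ 1 F := by
    have h1 : ContDiff ℝ 1 q := hq
    exact contDiff_id.add (χ.contDiff.smul (h1.sub contDiff_id))
  have hF0 : ∀ z ∈ D, F z ≠ 0 := by
    intro z hz hFz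
    by_cases hza : ‖z‖ ≤ a / 2
    · have hχ : χ z = 1 := χ.one_of_mem_closedBall (by simpa using hza)
      have hq0 : q z = 0 := by simpa [hF, hχ] using hFz
      have h1 := (hqD z hz).trans_le (min_le_right _ _)
      rw [hq0, zero_sub, norm_neg] at h1
      linarith [hcD z hz]
    · have h1 := (hqD z hz).trans_le (min_le_left _ _)
      have h2 : ‖q z - z‖ ≤ ‖q z - p z‖ + ‖p z - z‖ := norm_sub_le_norm_sub_add_norm_sub _ _ _
      have h3 : ‖z‖ = ‖χ z • (q z - z)‖ := by
        have : z = -(χ z • (q z - z)) := eq_neg_of_add_eq_zero_left hFz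
        conv_lhs => rw [this, norm_neg]
      rw [norm_smul, Real.norm_of_nonneg χ.nonneg] at h3
      have h4 : χ z * ‖q z - z‖ ≤ 1 * ‖q z - z‖ := by gcongr; exact χ.le_one
      have := hpz z hz
      push Not at hza
      linarith
  refine not_exists_retraction_sphere ha (r := fun z => (a / ‖F z‖) • F z) (U := {z | F z ≠ 0})
    (isOpen_ne_fun hFC.continuous continuous_const) hF0 ?_ ?_ ?_
  · intro z hz
    have hz' : F z ≠ 0 := hz
    have hFz : ContDiffAt ℝ 1 F z := hFC.contDiffAt
    exact ((contDiffAt_const.div (hFz.norm ℝ hz') (norm_ne_zero_iff.2 hz')).smul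
      hFz).contDiffWithinAt
  · intro z hz
    have hχ : χ z = 0 := χ.zero_of_le_dist (by simp [hz, χ])
    simp [hF, hχ, hz, div_self ha.ne']
  · intro z hz
    rw [norm_smul, norm_div, norm_norm, Real.norm_of_nonneg ha.le,
      div_mul_cancel₀ _ (norm_ne_zero_iff.2 (hF0 z hz))]

end Retraction

/-! ### Uniformity on compact spaces -/

section UniformOnCompact

/-- A property of a scale `ρ` and a point that is inherited by smaller scales and holds locally on
a compact space holds at some common scale. -/
lemma exists_pos_forall_of_locally {M : Type*} [TopologicalSpace M] [CompactSpace M]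
    {P : ℝ → M → Prop} (hmono : ∀ x ρ ρ', 0 < ρ' → ρ' ≤ ρ → P ρ x → P ρ' x)
    (hloc : ∀ x₀, ∃ ρ > 0, ∀ᶠ x in 𝓝 x₀, P ρ x) : ∃ ρ > 0, ∀ x, P ρ x := by
  have h := isCompact_univ.induction_on (p := fun s : Set M => ∃ ρ > 0, ∀ x ∈ s, P ρ x)
    ⟨1, one_pos, by simp⟩
    (fun s t hst ⟨ρ, hρ, h⟩ => ⟨ρ, hρ, fun x hx => h x (hst hx)⟩)
    (fun s t ⟨ρ, hρ, h⟩ ⟨ρ', hρ', h'⟩ => ⟨min ρ ρ', lt_min hρ hρ', fun x hx => by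
      rcases hx with hx | hx
      · exact hmono x ρ _ (lt_min hρ hρ') (min_le_left _ _) (h x hx)
      · exact hmono x ρ' _ (lt_min hρ hρ') (min_le_right _ _) (h' x hx)⟩)
    (fun x _ => by
      obtain ⟨ρ, hρ, h⟩ := hloc x
      exact ⟨{y | P ρ y}, mem_nhdsWithin_of_mem_nhds h, ρ, hρ, fun y hy => hy⟩)
  simpa using h

/-- Points uniformly close to a compact subset of an open set stay in the open set, and a
continuous function varies little there. -/
lemma exists_pos_forall_edist_lt {M : Type*} [PseudoEMetricSpace M] {F : Type*}
    [PseudoMetricSpace F] {K U : Set M} (hK : IsCompact K) (hU : IsOpen U) (hKU : K ⊆ U) {κ : M → F}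
    (hκ : ContinuousOn κ U) {η : ℝ} (hη : 0 < η) :
    ∃ ε : ℝ, 0 < ε ∧ ∀ x ∈ K, ∀ y, edist y x < ENNReal.ofReal ε → y ∈ U ∧ dist (κ y) (κ x) < η := by
  have h1 : {z : M × M | z.1 ∈ K → (κ z.1, κ z.2) ∈ {w : F × F | dist w.1 w.2 < η}} ∈ uniformity M :=
    hK.uniformContinuousAt_of_continuousAt κ
      (fun x hx => hκ.continuousAt (hU.mem_nhds (hKU hx))) (Metric.dist_mem_uniformity hη)
  obtain ⟨V, hV, hVU⟩ := lebesgue_number_of_compact_open hK hU hKU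
  obtain ⟨ε, hε, h⟩ := mem_uniformity_edist.1 (inter_mem h1 hV)
  obtain ⟨ε', hε', hlt⟩ : ∃ ε' : ℝ, 0 < ε' ∧ ENNReal.ofReal ε' ≤ ε := by
    rcases eq_or_ne ε ⊤ with rfl | hne
    · exact ⟨1, one_pos, le_top⟩
    · exact ⟨ε.toReal, ENNReal.toReal_pos hε.ne' hne, ENNReal.ofReal_toReal_le⟩
  refine ⟨ε', hε', fun x hx y hxy => ?_⟩
  have hmem := h (a := x) (b := y) (by rw [edist_comm]; exact hxy.trans_le hlt)
  refine ⟨hVU.2 x hx hmem.2, ?_⟩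
  rw [dist_comm]
  exact hmem.1 hx

end UniformOnCompact

/-! ### Maps of a manifold close to the identity -/

section NearIdentity

/-- A continuous self-map of a compact manifold that is uniformly close to the identity is
surjective: in a chart, `exists_eq_zero_of_near_id` applies to balls of a fixed radius around
each point. -/
theorem exists_pos_forall_surjective_of_near_id (m : ℕ) (M : Type*) [PseudoEMetricSpace M]
    [CompactSpace M] [ChartedSpace (EuclideanSpace ℝ (Fin m)) M] :
    ∃ ε : ℝ, 0 < ε ∧ ∀ p : M → M, Continuous p → (∀ x, edist (p x) x < ENNReal.ofReal ε) →
      Function.Surjective p := by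
  set P : ℝ → M → Prop := fun ε y => ∀ p : M → M, Continuous p →
    (∀ x, edist (p x) x < ENNReal.ofReal ε) → y ∈ range p with hP
  suffices hloc : ∀ x₀, ∃ ε > 0, ∀ᶠ y in 𝓝 x₀, P ε y by
    obtain ⟨ε, hε, h⟩ := exists_pos_forall_of_locally (P := P)
      (fun x ρ ρ' _ hle h p hp hpx =>
        h p hp fun x => (hpx x).trans_le (ENNReal.ofReal_le_ofReal hle)) hloc
    exact ⟨ε, hε, fun p hp hpx y => h y p hp hpx⟩
  intro x₀
  set κ := chartAt (EuclideanSpace ℝ (Fin m)) x₀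
  obtain ⟨b, hb, hbt⟩ := Metric.mem_nhds_iff.1 (κ.open_target.mem_nhds (mem_chart_target _ x₀))
  set a := b / 3
  have ha : 0 < a := by positivity
  have hKt : Metric.closedBall (κ x₀) (2 * a) ⊆ κ.target :=
    (Metric.closedBall_subset_ball (by simp only [a]; linarith)).trans hbt
  have hK : IsCompact (κ.symm '' Metric.closedBall (κ x₀) (2 * a)) :=
    (isCompact_closedBall _ _).image_of_continuousOn (κ.continuousOn_symm.mono hKt)
  obtain ⟨ε, hε, hεK⟩ := exists_pos_forall_edist_lt hK κ.open_source
    (by rintro _ ⟨z, hz, rfl⟩; exact κ.map_target (hKt hz)) κ.continuousOn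
    (η := a / 4) (by positivity)
  refine ⟨ε, hε, ?_⟩
  have hnear : ∀ᶠ y in 𝓝 x₀, y ∈ κ.source ∧ dist (κ y) (κ x₀) < a :=
    Filter.Eventually.and (κ.open_source.mem_nhds (mem_chart_source _ x₀))
      ((κ.continuousAt (mem_chart_source _ x₀)).eventually (Metric.ball_mem_nhds _ ha))
  filter_upwards [hnear] with y hy p hp hpx
  have hmem : ∀ z ∈ Metric.closedBall (0 : EuclideanSpace ℝ (Fin m)) a,
      z + κ y ∈ Metric.closedBall (κ x₀) (2 * a) := by
    intro z hz
    have h1 : ‖z‖ ≤ a := by simpa using hz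
    have h2 := hy.2
    rw [dist_eq_norm] at h2
    rw [Metric.mem_closedBall, dist_eq_norm, add_sub_assoc]
    exact (norm_add_le _ _).trans (by linarith)
  have hclose : ∀ z ∈ Metric.closedBall (0 : EuclideanSpace ℝ (Fin m)) a,
      p (κ.symm (z + κ y)) ∈ κ.source ∧ dist (κ (p (κ.symm (z + κ y)))) (z + κ y) < a / 4 := by
    intro z hz
    have h := hεK _ (mem_image_of_mem _ (hmem z hz)) _ (hpx (κ.symm (z + κ y)))
    rwa [κ.right_inv (hKt (hmem z hz))] at h
  have hcont : ContinuousOn (fun z => κ (p (κ.symm (z + κ y))) - κ y) (Metric.closedBall 0 a) := by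
    refine ContinuousOn.sub ?_ continuousOn_const
    refine κ.continuousOn.comp (hp.comp_continuousOn (κ.continuousOn_symm.comp
      (continuous_id.add continuous_const).continuousOn ?_)) fun z hz => (hclose z hz).1
    exact fun z hz => hKt (hmem z hz)
  obtain ⟨z, hz, hz0⟩ := exists_eq_zero_of_near_id ha hcont fun z hz => by
    have h := (hclose z hz).2.le
    rwa [dist_eq_norm, sub_add_eq_sub_sub_swap] at h
  exact ⟨κ.symm (z + κ y), κ.injOn (hclose z hz).1 hy.1 (sub_eq_zero.1 hz0)⟩

end NearIdentity

/-! ### Second order equations near an equilibrium -/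

section Nemytskii

variable {K X Y Z : Type*} [TopologicalSpace K] [CompactSpace K] [NormedAddCommGroup X]
  [NormedSpace ℝ X] [NormedAddCommGroup Y] [NormedSpace ℝ Y] [NormedAddCommGroup Z]
  [NormedSpace ℝ Z]

/-- Pointwise application of a bilinear map to continuous functions. -/
def pointwiseBilin (B : Z →L[ℝ] X →L[ℝ] Y) : C(K, Z) →L[ℝ] C(K, X) →L[ℝ] C(K, Y) :=
  LinearMap.mkContinuous₂
    (LinearMap.mk₂ ℝ (fun (T : C(K, Z)) (β : C(K, X)) =>
        (⟨fun t => B (T t) (β t), (B.continuous.comp T.continuous).clm_apply β.continuous⟩ :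
          C(K, Y)))
      (fun _ _ _ => by ext; simp) (fun _ _ _ => by ext; simp) (fun _ _ _ => by ext; simp)
      (fun _ _ _ => by ext; simp))
    ‖B‖ (fun T β => by
      rw [ContinuousMap.norm_le _ (by positivity)]
      exact fun t => (B.le_opNorm₂ _ _).trans
        (by gcongr; exacts [T.norm_coe_le_norm t, β.norm_coe_le_norm t]))

/-- The derivative of the composition operator `α ↦ S ∘ α`.  The derivative of `S` is given in the
form `x ↦ B (S' x)` for a fixed bilinear map `B`. -/
lemma hasFDerivAt_postcomp {B : Z →L[ℝ] X →L[ℝ] Y} {S : C(X, Y)} {S' : C(X, Z)}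
    (hS : ∀ x, HasFDerivAt S (B (S' x)) x) (α : C(K, X)) :
    HasFDerivAt (fun α : C(K, X) => S.comp α) (pointwiseBilin B (S'.comp α)) α := by
  rw [hasFDerivAt_iff_isLittleO, Asymptotics.isLittleO_iff]
  intro c hc0
  set η := c / (‖B‖ + 1)
  have hη : 0 < η := by positivity
  have hηc : ‖B‖ * η ≤ c := by
    simp only [η]; rw [mul_div_assoc', div_le_iff₀ (by positivity)]
    nlinarith [norm_nonneg B]
  have hc : Continuous fun α : C(K, X) => S'.comp α := ContinuousMap.continuous_postcomp S'
  obtain ⟨δ, hδ, h⟩ := Metric.continuousAt_iff.1 hc.continuousAt (ε := η) hη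
  filter_upwards [Metric.ball_mem_nhds α hδ] with β hβ
  rw [ContinuousMap.norm_le _ (by positivity)]
  intro t
  have hseg : ∀ x ∈ segment ℝ (α t) (β t), ‖B (S' x) - B (S' (α t))‖ ≤ c := by
    rintro _ hx
    rw [segment_eq_image'] at hx
    obtain ⟨s, hs, rfl⟩ := hx
    have hγ : dist (α + s • (β - α)) α < δ := by
      rw [dist_eq_norm, add_sub_cancel_left, norm_smul, Real.norm_of_nonneg hs.1]
      have := mem_ball_iff_norm.1 hβ
      nlinarith [hs.2, norm_nonneg (β - α)]
    have h1 := (h hγ).le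
    rw [dist_eq_norm] at h1
    have h2 := ((S'.comp (α + s • (β - α)) - S'.comp α).norm_coe_le_norm t).trans h1
    rw [← map_sub]
    exact (B.le_opNorm _).trans ((by gcongr; exact h2 : _ ≤ ‖B‖ * η).trans hηc)
  have hmv := (convex_segment (α t) (β t)).norm_image_sub_le_of_norm_hasFDerivWithin_le'
    (f := S) (f' := fun x => B (S' x)) (φ := B (S' (α t))) (C := c)
    (fun x _ => (hS x).hasFDerivWithinAt) hseg
    (left_mem_segment ℝ _ _) (right_mem_segment ℝ _ _)
  exact hmv.trans (mul_le_mul_of_nonneg_left ((β - α).norm_coe_le_norm t) hc0.le)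

/-- Composition with a `C^1` function is a `C^1` operator on spaces of continuous functions. -/
lemma contDiff_postcomp {B : Z →L[ℝ] X →L[ℝ] Y} {S : C(X, Y)} {S' : C(X, Z)}
    (hS : ∀ x, HasFDerivAt S (B (S' x)) x) :
    ContDiff ℝ 1 (fun α : C(K, X) => S.comp α) := by
  rw [contDiff_one_iff_hasFDerivAt]
  exact ⟨_, (pointwiseBilin B).continuous.comp (ContinuousMap.continuous_postcomp S'),
    hasFDerivAt_postcomp hS⟩

end Nemytskii

section ImplicitSecondOrder

variable {E C : Type*} [NormedAddCommGroup E] [NormedSpace ℝ E] [CompleteSpace E]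
  [NormedAddCommGroup C] [NormedSpace ℝ C] [CompleteSpace C]

/-- The linear part of the system `u = c p + J ν`, `ν = c w + J N(u, ν)`. -/
def secondOrderLinear (c : E →L[ℝ] C) (J : C →L[ℝ] C) : (E × E) × (C × C) →L[ℝ] C × C :=
  let u := (ContinuousLinearMap.fst ℝ C C).comp (ContinuousLinearMap.snd ℝ (E × E) (C × C))
  let ν := (ContinuousLinearMap.snd ℝ C C).comp (ContinuousLinearMap.snd ℝ (E × E) (C × C))
  let p := (ContinuousLinearMap.fst ℝ E E).comp (ContinuousLinearMap.fst ℝ (E × E) (C × C))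
  let w := (ContinuousLinearMap.snd ℝ E E).comp (ContinuousLinearMap.fst ℝ (E × E) (C × C))
  (u - c.comp p - J.comp ν).prod (ν - c.comp w)

omit [CompleteSpace E] [CompleteSpace C] in
lemma secondOrderLinear_apply (c : E →L[ℝ] C) (J : C →L[ℝ] C) (z : E × E) (a : C × C) :
    secondOrderLinear c J (z, a) = (a.1 - c z.1 - J a.2, a.2 - c z.2) := rfl

/-- `C^1` solutions `(u, ν)` of the system `u = c p + J ν`, `ν = c w + J N(u, ν)` for initial data
`(p, w)` near `(p₀, 0)`, when `N` vanishes together with its derivative at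
`(c p₀, 0)`.  The case of interest is that `C` is a space of paths, `c` the inclusion of the
constant paths and `J` the integration operator; then the system is the integrated form of
`u' = ν`, `ν' = N(u, ν)`. -/
lemma exists_implicit_second_order (c : E →L[ℝ] C) (J : C →L[ℝ] C) {N : C × C → C}
    (hN : ContDiff ℝ 1 N) {p₀ : E} (hN0 : N (c p₀, 0) = 0)
    (hNd : HasFDerivAt N (0 : C × C →L[ℝ] C) (c p₀, 0)) :
    ∃ (ψ : E × E → C × C) (D : E × E →L[ℝ] C × C), ContDiffAt ℝ 1 ψ (p₀, 0) ∧
      ψ (p₀, 0) = (c p₀, 0) ∧ HasFDerivAt ψ D (p₀, 0) ∧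
      (∀ z, D z = (c z.1 + J (c z.2), c z.2)) ∧
      ∀ᶠ z in 𝓝 (p₀, 0), (ψ z).1 = c z.1 + J (ψ z).2 ∧ (ψ z).2 = c z.2 + J (N (ψ z)) := by
  set z₀ : E × E := (p₀, 0)
  set a₀ : C × C := (c p₀, 0)
  set Λ := secondOrderLinear c J with hΛ
  set f : (E × E) × (C × C) → C × C :=
    fun y => Λ y - ContinuousLinearMap.inr ℝ C C (J (N y.2)) with hf
  have hfC : ContDiff ℝ 1 f :=
    Λ.contDiff.sub ((ContinuousLinearMap.contDiff _).comp
      (J.contDiff.comp (hN.comp contDiff_snd)))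
  have hfd : HasFDerivAt f Λ (z₀, a₀) := by
    have h1 : HasFDerivAt (fun y : (E × E) × (C × C) => N y.2)
        ((0 : C × C →L[ℝ] C).comp (ContinuousLinearMap.snd ℝ (E × E) (C × C))) (z₀, a₀) :=
      HasFDerivAt.comp (z₀, a₀) (f := fun y : (E × E) × (C × C) => y.2) hNd hasFDerivAt_snd
    have h2 := Λ.hasFDerivAt.sub
      (((ContinuousLinearMap.inr ℝ C C).comp J).hasFDerivAt.comp (z₀, a₀) h1)
    exact h2.congr_fderiv (by simp)
  have hf0 : f (z₀, a₀) = 0 := by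
    simp only [hf, hN0, a₀, map_zero, sub_zero, hΛ, secondOrderLinear_apply]
    simp [z₀]
  have hinv : (fderiv ℝ f (z₀, a₀) ∘L .inr ℝ (E × E) _).IsInvertible := by
    rw [hfd.fderiv]
    refine ContinuousLinearMap.IsInvertible.of_inverse (g :=
      (ContinuousLinearMap.fst ℝ C C + J.comp (ContinuousLinearMap.snd ℝ C C)).prod
          (ContinuousLinearMap.snd ℝ C C)) ?_ ?_
    · refine ContinuousLinearMap.ext fun β => ?_
      simp [hΛ, secondOrderLinear_apply]
    · refine ContinuousLinearMap.ext fun β => ?_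
      simp [hΛ, secondOrderLinear_apply]
  have cdf : ContDiffAt ℝ 1 f (z₀, a₀) := hfC.contDiffAt
  set ψ := cdf.implicitFunction one_ne_zero hinv with hψ
  have hψC : ContDiffAt ℝ 1 ψ z₀ := cdf.contDiffAt_implicitFunction one_ne_zero hinv
  have hψ0 : ψ z₀ = a₀ := cdf.implicitFunction_apply_self one_ne_zero hinv
  have hψf : ∀ᶠ z in 𝓝 z₀, f (z, ψ z) = 0 := by
    have := cdf.eventually_apply_implicitFunction one_ne_zero hinv
    rwa [hf0] at this
  have hD : HasFDerivAt ψ (fderiv ℝ ψ z₀) z₀ := (hψC.differentiableAt one_ne_zero).hasFDerivAt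
  refine ⟨ψ, fderiv ℝ ψ z₀, hψC, hψ0, hD, fun ζ => ?_, ?_⟩
  · have h1 : HasFDerivAt (fun z => f (z, ψ z))
        (Λ.comp ((ContinuousLinearMap.id ℝ _).prod (fderiv ℝ ψ z₀))) z₀ := by
      have h0 : HasFDerivAt f Λ ((fun z => (z, ψ z)) z₀) := by
        simp only [hψ0]; exact hfd
      exact h0.comp z₀ ((hasFDerivAt_id z₀).prodMk hD)
    have h2 : HasFDerivAt (fun z => f (z, ψ z)) (0 : E × E →L[ℝ] C × C) z₀ :=
      (hasFDerivAt_const 0 z₀).congr_of_eventuallyEq hψf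
    have h3 : Λ (ζ, fderiv ℝ ψ z₀ ζ) = 0 :=
      congrArg (fun T : E × E →L[ℝ] C × C => T ζ) (h1.unique h2)
    rw [hΛ, secondOrderLinear_apply, Prod.mk_eq_zero, sub_sub, sub_eq_zero, sub_eq_zero] at h3
    exact Prod.ext (by rw [h3.1, h3.2]) h3.2
  · filter_upwards [hψf] with z hz
    simp only [hf, hΛ, secondOrderLinear_apply, ContinuousLinearMap.inr_apply, Prod.mk_sub_mk,
      sub_zero, Prod.mk_eq_zero] at hz
    rw [sub_sub, sub_eq_zero, sub_sub, sub_eq_zero] at hz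
    exact hz

end ImplicitSecondOrder

section SecondOrder

variable {E : Type*} [NormedAddCommGroup E] [NormedSpace ℝ E]

/-- A compact interval of times containing `0` and `1` in its interior. -/
abbrev TimeIcc : Type := Icc (-1 : ℝ) 2

lemma timeIcc_le : (-1 : ℝ) ≤ 2 := by norm_num

/-- Extension of a path by constants. -/
def extendPath (σ : C(TimeIcc, E)) : ℝ → E := IccExtend timeIcc_le σ

lemma continuous_extendPath (σ : C(TimeIcc, E)) : Continuous (extendPath σ) :=
  σ.continuous.Icc_extend'

lemma extendPath_of_mem (σ : C(TimeIcc, E)) {t : ℝ} (ht : t ∈ Icc (-1 : ℝ) 2) :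
    extendPath σ t = σ ⟨t, ht⟩ := IccExtend_of_mem _ _ ht

lemma norm_extendPath_le (σ : C(TimeIcc, E)) (t : ℝ) : ‖extendPath σ t‖ ≤ ‖σ‖ :=
  σ.norm_coe_le_norm _

variable [CompleteSpace E]

/-- The primitive vanishing at time `0`, as an operator on continuous paths. -/
def pathPrimitive : C(TimeIcc, E) →L[ℝ] C(TimeIcc, E) :=
  LinearMap.mkContinuous
    { toFun := fun σ => ⟨fun t => ∫ τ in (0 : ℝ)..t, extendPath σ τ,
        (intervalIntegral.continuous_primitive
          (fun a b => (continuous_extendPath σ).intervalIntegrable a b) 0).comp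
            continuous_subtype_val⟩
      map_add' := fun σ σ' => by
        ext t
        exact intervalIntegral.integral_add ((continuous_extendPath σ).intervalIntegrable _ _)
          ((continuous_extendPath σ').intervalIntegrable _ _)
      map_smul' := fun c σ => by
        ext t
        exact intervalIntegral.integral_smul c (extendPath σ) }
    2 (fun σ => by
      rw [ContinuousMap.norm_le _ (by positivity)]
      intro t
      refine (intervalIntegral.norm_integral_le_of_norm_le_const
        (fun τ _ => norm_extendPath_le σ τ)).trans ?_
      have : |(t : ℝ) - 0| ≤ 2 := by
        have := t.2
        rw [abs_le]; constructor <;> linarith [this.1, this.2]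
      rw [mul_comm]; gcongr)

lemma pathPrimitive_apply (σ : C(TimeIcc, E)) (t : TimeIcc) :
    pathPrimitive σ t = ∫ τ in (0 : ℝ)..t, extendPath σ τ := rfl

lemma hasDerivAt_extendPath_of_eq {u σ : C(TimeIcc, E)} {p : E}
    (h : u = ContinuousMap.const _ p + pathPrimitive σ) {t : ℝ} (ht : t ∈ Ioo (-1 : ℝ) 2) :
    HasDerivAt (extendPath u) (extendPath σ t) t := by
  have h1 : HasDerivAt (fun t : ℝ => p + ∫ τ in (0 : ℝ)..t, extendPath σ τ) (extendPath σ t) t :=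
    ((continuous_extendPath σ).integral_hasStrictDerivAt 0 t).hasDerivAt.const_add p
  refine h1.congr_of_eventuallyEq ?_
  filter_upwards [isOpen_Ioo.mem_nhds ht] with s hs
  rw [extendPath_of_mem _ (Ioo_subset_Icc_self hs), h]
  rfl

lemma extendPath_zero_of_eq {u σ : C(TimeIcc, E)} {p : E}
    (h : u = ContinuousMap.const _ p + pathPrimitive σ) : extendPath u 0 = p := by
  rw [extendPath_of_mem _ (by norm_num : (0 : ℝ) ∈ Icc (-1 : ℝ) 2), h]
  simp [pathPrimitive_apply]

/-- The constant paths, as a linear map. -/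
def constPath : E →L[ℝ] C(TimeIcc, E) :=
  LinearMap.mkContinuous
    { toFun := fun p => ContinuousMap.const _ p
      map_add' := fun _ _ => rfl
      map_smul' := fun _ _ => rfl }
    1 (fun p => by
      rw [one_mul, ContinuousMap.norm_le _ (norm_nonneg _)]
      exact fun t => le_rfl)

/-- Pairing of paths. -/
def pairPath : C(TimeIcc, E) × C(TimeIcc, E) →L[ℝ] C(TimeIcc, E × E) :=
  (ContinuousLinearMap.compLeftContinuous ℝ TimeIcc (.inl ℝ E E)).coprod
    (ContinuousLinearMap.compLeftContinuous ℝ TimeIcc (.inr ℝ E E))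

lemma pairPath_apply (a : C(TimeIcc, E) × C(TimeIcc, E)) (t : TimeIcc) :
    pairPath a t = (a.1 t, a.2 t) := by
  simp [pairPath]

/-- Flow of a second order equation `u'' = S(u, u')` near an equilibrium with vanishing
linearization: the position at time `1` is a `C^1` function of the initial data, with derivative
`(p, w) ↦ p + w`. -/
theorem exists_second_order_flow_of_contDiff {S : E × E → E} {p₀ : E} (hS : ContDiff ℝ 1 S)
    (hS0 : S (p₀, 0) = 0) (hS' : fderiv ℝ S (p₀, 0) = 0) {O : Set (E × E)} (hO : O ∈ 𝓝 (p₀, 0)) :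
    ∃ u ν : E × E → ℝ → E, ContDiffAt ℝ 1 (fun z => u z 1) (p₀, 0) ∧
      HasFDerivAt (fun z => u z 1) (.fst ℝ E E + .snd ℝ E E) (p₀, 0) ∧ u (p₀, 0) 1 = p₀ ∧
      ∀ᶠ z in 𝓝 (p₀, 0), u z 0 = z.1 ∧ ν z 0 = z.2 ∧ ∀ t ∈ Ioo (-1 : ℝ) 2,
        HasDerivAt (u z) (ν z t) t ∧ HasDerivAt (ν z) (S (u z t, ν z t)) t ∧
        (u z t, ν z t) ∈ O := by
  set DS : C(E × E, E × E →L[ℝ] E) := ⟨fderiv ℝ S, hS.continuous_fderiv one_ne_zero⟩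
  have hDS : ∀ x, HasFDerivAt (⟨S, hS.continuous⟩ : C(E × E, E))
      (ContinuousLinearMap.id ℝ (E × E →L[ℝ] E) (DS x)) x := fun x =>
    (hS.differentiable one_ne_zero x).hasFDerivAt
  set N : C(TimeIcc, E) × C(TimeIcc, E) → C(TimeIcc, E) :=
    fun a => (⟨S, hS.continuous⟩ : C(E × E, E)).comp (pairPath a)
  have hpC : ContDiff ℝ 1 (pairPath (E := E)) :=
    ContinuousLinearMap.contDiff (E := C(TimeIcc, E) × C(TimeIcc, E)) (F := C(TimeIcc, E × E))
      pairPath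
  have hpd : HasFDerivAt (pairPath (E := E)) (pairPath (E := E)) (constPath p₀, 0) :=
    ContinuousLinearMap.hasFDerivAt (E := C(TimeIcc, E) × C(TimeIcc, E)) (F := C(TimeIcc, E × E))
      pairPath
  have hNC : ContDiff ℝ 1 N := (contDiff_postcomp hDS).comp hpC
  have hpair : pairPath (constPath p₀, (0 : C(TimeIcc, E))) = ContinuousMap.const _ (p₀, 0) := by
    ext t : 1
    rw [pairPath_apply]; rfl
  have hN0 : N (constPath p₀, 0) = 0 := by
    ext t
    simp only [N, hpair]
    exact hS0
  have hNd : HasFDerivAt N (0 : C(TimeIcc, E) × C(TimeIcc, E) →L[ℝ] C(TimeIcc, E))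
      (constPath p₀, 0) := by
    have h1 := (hasFDerivAt_postcomp hDS (pairPath (constPath p₀, (0 : C(TimeIcc, E))))).comp
      _ hpd
    refine h1.congr_fderiv (ContinuousLinearMap.ext fun β => ContinuousMap.ext fun t => ?_)
    change DS (pairPath (constPath p₀, (0 : C(TimeIcc, E))) t) (pairPath β t) = 0
    rw [hpair]
    change fderiv ℝ S (p₀, 0) _ = 0
    rw [hS']; rfl
  obtain ⟨ψ, D, hψC, hψ0, hD, hDz, heqs⟩ :=
    exists_implicit_second_order (constPath (E := E)) pathPrimitive hNC hN0 hNd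
  have h1I : (1 : ℝ) ∈ Icc (-1 : ℝ) 2 := by norm_num
  set ev : C(TimeIcc, E) × C(TimeIcc, E) →L[ℝ] E :=
    (ContinuousMap.evalCLM ℝ (⟨1, h1I⟩ : TimeIcc)).comp (ContinuousLinearMap.fst ℝ _ _) with hev
  have hu1 : (fun z => extendPath (ψ z).1 1) = fun z => ev (ψ z) := by
    ext z; rw [extendPath_of_mem _ h1I]; rfl
  refine ⟨fun z => extendPath (ψ z).1, fun z => extendPath (ψ z).2, ?_, ?_, ?_, ?_⟩
  · rw [hu1]; exact ev.contDiff.contDiffAt.comp _ hψC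
  · rw [hu1]
    have hev' : ev.comp D = .fst ℝ E E + .snd ℝ E E := by
      refine ContinuousLinearMap.ext fun ζ => ?_
      have h4 : ∀ τ : ℝ, extendPath (constPath ζ.2) τ = ζ.2 := fun τ => rfl
      change (D ζ).1 ⟨1, h1I⟩ = ζ.1 + ζ.2
      rw [hDz, ContinuousMap.add_apply, pathPrimitive_apply]
      simp only [h4]
      rw [intervalIntegral.integral_const, sub_zero, one_smul]
      rfl
    rw [← hev']
    exact ev.hasFDerivAt.comp (p₀, 0) hD
  · change extendPath (ψ (p₀, 0)).1 1 = p₀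
    rw [hψ0]; rfl
  · obtain ⟨r, hr, hrO⟩ := Metric.mem_nhds_iff.1 hO
    have hclose : ∀ᶠ z in 𝓝 (p₀, 0), dist (ψ z) (constPath p₀, 0) < r := by
      have := hψC.continuousAt.eventually (Metric.ball_mem_nhds _ hr)
      rwa [hψ0] at this
    filter_upwards [heqs, hclose] with z hz hzr
    refine ⟨extendPath_zero_of_eq hz.1, extendPath_zero_of_eq hz.2, fun t ht => ?_⟩
    have htI := Ioo_subset_Icc_self ht
    refine ⟨hasDerivAt_extendPath_of_eq hz.1 ht, ?_, ?_⟩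
    · have h1 := hasDerivAt_extendPath_of_eq hz.2 ht
      rw [extendPath_of_mem (N _) htI] at h1
      rw [extendPath_of_mem _ htI, extendPath_of_mem (ψ z).2 htI]
      have h2 : N (ψ z) ⟨t, htI⟩ = S ((ψ z).1 ⟨t, htI⟩, (ψ z).2 ⟨t, htI⟩) := by
        rw [← pairPath_apply]; rfl
      rwa [h2] at h1
    · refine hrO ?_
      rw [extendPath_of_mem _ htI, extendPath_of_mem _ htI, Metric.mem_ball, Prod.dist_eq]
      rw [Prod.dist_eq] at hzr
      refine max_lt ?_ ?_
      · exact ((ContinuousMap.dist_apply_le_dist (f := (ψ z).1) (g := constPath p₀)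
          ⟨t, htI⟩).trans (le_max_left _ _)).trans_lt hzr
      · exact ((ContinuousMap.dist_apply_le_dist (f := (ψ z).2) (g := 0)
          ⟨t, htI⟩).trans (le_max_right _ _)).trans_lt hzr

/-- Local version of `exists_second_order_flow_of_contDiff`: the right-hand side is cut off outside
a ball on which it is `C^1`. -/
theorem exists_second_order_flow [FiniteDimensional ℝ E] {S : E × E → E} {p₀ : E}
    (hS : ContDiffAt ℝ 1 S (p₀, 0))
    (hS0 : S (p₀, 0) = 0) (hS' : fderiv ℝ S (p₀, 0) = 0) {O : Set (E × E)} (hO : O ∈ 𝓝 (p₀, 0)) :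
    ∃ u ν : E × E → ℝ → E, ContDiffAt ℝ 1 (fun z => u z 1) (p₀, 0) ∧
      HasFDerivAt (fun z => u z 1) (.fst ℝ E E + .snd ℝ E E) (p₀, 0) ∧ u (p₀, 0) 1 = p₀ ∧
      ∀ᶠ z in 𝓝 (p₀, 0), u z 0 = z.1 ∧ ν z 0 = z.2 ∧ ∀ t ∈ Ioo (-1 : ℝ) 2,
        HasDerivAt (u z) (ν z t) t ∧ HasDerivAt (ν z) (S (u z t, ν z t)) t ∧
        (u z t, ν z t) ∈ O := by
  obtain ⟨R, hR, hRS⟩ := Metric.nhds_basis_closedBall.mem_iff.1 (hS.eventually (by simp))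
  let χ : ContDiffBump ((p₀, 0) : E × E) := ⟨R / 2, R, by positivity, by linarith⟩
  have hC : ContDiff ℝ 1 (fun z => χ z • S z) := by
    rw [contDiff_iff_contDiffAt]
    intro z
    by_cases hz : z ∈ Metric.closedBall ((p₀, 0) : E × E) R
    · exact χ.contDiffAt.smul (hRS hz)
    · refine (contDiffAt_const (c := (0 : E))).congr_of_eventuallyEq ?_
      filter_upwards [Metric.isClosed_closedBall.isOpen_compl.mem_nhds hz] with y hy
      have : χ y = 0 := χ.zero_of_le_dist (by
        rw [mem_compl_iff, Metric.mem_closedBall, not_le] at hy; exact hy.le)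
      simp [this]
  have hone : ∀ z ∈ Metric.closedBall ((p₀, 0) : E × E) (R / 2), χ z • S z = S z := fun z hz => by
    rw [χ.one_of_mem_closedBall hz, one_smul]
  have hball : Metric.closedBall ((p₀, 0) : E × E) (R / 2) ∈ 𝓝 (p₀, 0) :=
    Metric.closedBall_mem_nhds _ (by positivity)
  have hev : (fun z => χ z • S z) =ᶠ[𝓝 (p₀, 0)] S := by
    filter_upwards [hball] with z hz using hone z hz
  obtain ⟨u, ν, h1, h2, h3, h4⟩ := exists_second_order_flow_of_contDiff hC
    (by rw [hone _ (mem_of_mem_nhds hball), hS0]) (by rw [hev.fderiv_eq, hS']) (inter_mem hO hball)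
  refine ⟨u, ν, h1, h2, h3, h4.mono fun z hz => ⟨hz.1, hz.2.1, fun t ht => ?_⟩⟩
  obtain ⟨h5, h6, h7, h8⟩ := hz.2.2 t ht
  rw [hone _ h8] at h6
  exact ⟨h5, h6, h7⟩

end SecondOrder

/-! ### The geodesic spray -/

section Spray

variable {E : Type*} [NormedAddCommGroup E] [NormedSpace ℝ E]

/-- The geodesic spray of a metric `G` on a vector space: the acceleration of a geodesic as a
function of its position and velocity. -/
def sprayOf (G : E → E →L[ℝ] E →L[ℝ] ℝ) (z : E × E) : E :=
  (G z.1).inverse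
    ((1 / 2 : ℝ) • ((fderiv ℝ G z.1).flip z.2).flip z.2 - fderiv ℝ G z.1 z.2 z.2)

/-- The vector `sprayOf G (p, v)` is the acceleration that the geodesic equation, with the index
lowered, prescribes at the position `p` and the velocity `v`. -/
lemma eq_sprayOf_iff {G : E → E →L[ℝ] E →L[ℝ] ℝ} {p : E} (hG : (G p).IsInvertible) (v a : E) :
    (∀ w : E, G p a w + fderiv ℝ G p v v w - (1 / 2) * fderiv ℝ G p w v v = 0) ↔
      a = sprayOf G (p, v) := by
  have h1 : (∀ w : E, G p a w + fderiv ℝ G p v v w - (1 / 2) * fderiv ℝ G p w v v = 0) ↔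
      G p a = (1 / 2 : ℝ) • ((fderiv ℝ G p).flip v).flip v - fderiv ℝ G p v v := by
    rw [ContinuousLinearMap.ext_iff]
    refine forall_congr' fun w => ?_
    have : ((1 / 2 : ℝ) • ((fderiv ℝ G p).flip v).flip v - fderiv ℝ G p v v) w
      = (1 / 2) * fderiv ℝ G p w v v - fderiv ℝ G p v v w := rfl
    rw [this]
    constructor <;> intro h <;> linarith
  rw [h1, sprayOf]
  obtain ⟨e, he⟩ := hG
  rw [← he, ContinuousLinearMap.inverse_equiv]
  exact e.eq_symm_apply.symm

lemma contDiffAt_sprayOf [CompleteSpace E] {G : E → E →L[ℝ] E →L[ℝ] ℝ} {z : E × E}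
    (hG : ContDiffAt ℝ 2 G z.1) (hinv : (G z.1).IsInvertible) :
    ContDiffAt ℝ 1 (sprayOf G) z := by
  have hG1 : ContDiffAt ℝ 1 (fun z : E × E => G z.1) z :=
    (hG.of_le (by norm_num)).comp z contDiffAt_fst
  have hDG : ContDiffAt ℝ 1 (fun z : E × E => fderiv ℝ G z.1) z :=
    (hG.fderiv_right (m := 1) (by norm_num)).comp z contDiffAt_fst
  have hinv : ContDiffAt ℝ 1 (fun z : E × E => (G z.1).inverse) z :=
    ContDiffAt.comp z (g := ContinuousLinearMap.inverse) hinv.contDiffAt_map_inverse hG1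
  have hf1 : ContDiffAt ℝ 1 (fun z : E × E => (fderiv ℝ G z.1).flip z.2) z :=
    (((ContinuousLinearMap.flipₗᵢ ℝ E E (E →L[ℝ] ℝ)).contDiff.contDiffAt).comp z hDG).clm_apply
      contDiffAt_snd
  have hf2 : ContDiffAt ℝ 1
      (fun z : E × E => ((fderiv ℝ G z.1).flip z.2).flip z.2) z :=
    (((ContinuousLinearMap.flipₗᵢ ℝ E E ℝ).contDiff.contDiffAt).comp z hf1).clm_apply
      contDiffAt_snd
  exact hinv.clm_apply ((hf2.const_smul (1 / 2 : ℝ)).sub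
    ((hDG.clm_apply contDiffAt_snd).clm_apply contDiffAt_snd))

lemma sprayOf_smul (G : E → E →L[ℝ] E →L[ℝ] ℝ) (p v : E) (s : ℝ) :
    sprayOf G (p, s • v) = s ^ 2 • sprayOf G (p, v) := by
  have h : (1 / 2 : ℝ) • ((fderiv ℝ G p).flip (s • v)).flip (s • v)
      - fderiv ℝ G p (s • v) (s • v)
      = s ^ 2 • ((1 / 2 : ℝ) • ((fderiv ℝ G p).flip v).flip v - fderiv ℝ G p v v) := by
    ext w
    simp
    ring
  simp only [sprayOf]
  rw [h, map_smul]

lemma sprayOf_zero (G : E → E →L[ℝ] E →L[ℝ] ℝ) (p : E) : sprayOf G (p, 0) = 0 := by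
  simpa using sprayOf_smul G p 0 0

/-- The spray is quadratic in the velocity, so that it vanishes to first order at the zero
velocity. -/
lemma fderiv_sprayOf {G : E → E →L[ℝ] E →L[ℝ] ℝ} {p : E}
    (hd : DifferentiableAt ℝ (sprayOf G) (p, 0)) :
    fderiv ℝ (sprayOf G) (p, 0) = 0 := by
  have hd := hd.hasFDerivAt
  have h1 : ∀ w, fderiv ℝ (sprayOf G) (p, 0) (w, 0) = 0 := by
    intro w
    have hc : HasDerivAt (fun s : ℝ => ((p + s • w, 0) : E × E)) (w, 0) 0 := by
      have := ((hasDerivAt_id (0 : ℝ)).smul_const w).const_add p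
      simpa using this.prodMk (hasDerivAt_const (0 : ℝ) (0 : E))
    have h2 := HasFDerivAt.comp_hasDerivAt (f := fun s : ℝ => ((p + s • w, 0) : E × E)) 0
      (by simpa using hd) hc
    have h3 : (sprayOf G ∘ fun s : ℝ => ((p + s • w, 0) : E × E)) = fun _ => 0 := by
      ext1 s; exact sprayOf_zero G _
    rw [h3] at h2
    exact h2.unique (hasDerivAt_const _ _)
  have h2 : ∀ v, fderiv ℝ (sprayOf G) (p, 0) (0, v) = 0 := by
    intro v
    have hc : HasDerivAt (fun s : ℝ => ((p, s • v) : E × E)) (0, v) 0 := by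
      have := (hasDerivAt_id (0 : ℝ)).smul_const v
      simpa using (hasDerivAt_const (0 : ℝ) p).prodMk this
    have h2 := HasFDerivAt.comp_hasDerivAt (f := fun s : ℝ => ((p, s • v) : E × E)) 0
      (by simpa using hd) hc
    have h3 : (sprayOf G ∘ fun s : ℝ => ((p, s • v) : E × E)) = fun s => s ^ 2 • sprayOf G (p, v) := by
      ext1 s; exact sprayOf_smul G _ _ _
    rw [h3] at h2
    have h4 : HasDerivAt (fun s : ℝ => s ^ 2 • sprayOf G (p, v)) 0 0 := by
      simpa using (hasDerivAt_pow 2 (0 : ℝ)).smul_const (sprayOf G (p, v))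
    exact h2.unique h4
  refine ContinuousLinearMap.ext fun z => ?_
  have : z = (z.1, 0) + (0, z.2) := by simp
  rw [this, map_add, h1, h2]; simp

/-- The geodesic equation is invariant under changes of coordinates. -/
lemma geodesic_equation_covariant {G G' : E → E →L[ℝ] E →L[ℝ] ℝ} {θ : E → E} {p : E}
    {DG DG' : E →L[ℝ] E →L[ℝ] E →L[ℝ] ℝ} {θ' : E → E →L[ℝ] E} {θ'' : E →L[ℝ] E →L[ℝ] E}
    (hG : HasFDerivAt G DG p) (hG' : HasFDerivAt G' DG' (θ p)) (hθ : HasFDerivAt θ (θ' p) p)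
    (hθ' : HasFDerivAt θ' θ'' p) (hsymm : ∀ u v, θ'' u v = θ'' v u)
    (hiso : ∀ᶠ q in 𝓝 p, ∀ v w, G q v w = G' (θ q) (θ' q v) (θ' q w))
    (hsymG : ∀ v w, G' (θ p) v w = G' (θ p) w v) (v a w : E) :
    G p a w + DG v v w - 1 / 2 * DG w v v = G' (θ p) (θ' p a + θ'' v v) (θ' p w)
      + DG' (θ' p v) (θ' p v) (θ' p w) - 1 / 2 * DG' (θ' p w) (θ' p v) (θ' p v) := by
  have key : ∀ z v w, DG z v w = DG' (θ' p z) (θ' p v) (θ' p w) + G' (θ p) (θ'' z v) (θ' p w)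
      + G' (θ p) (θ' p v) (θ'' z w) := by
    intro z v w
    have ha : ∀ v, HasFDerivAt (fun q => θ' q v) (θ''.flip v) p := fun v => by
      simpa using hθ'.clm_apply (hasFDerivAt_const v p)
    have h1 : HasFDerivAt (fun q => G q v w) ((DG.flip v).flip w) p := by
      have h := hG.clm_apply (hasFDerivAt_const v p)
      simpa using h.clm_apply (hasFDerivAt_const w p)
    have h20 : HasFDerivAt (fun q => G' (θ q)) (DG' ∘L θ' p) p := HasFDerivAt.comp (g := G') p hG' hθ
    have h21 := h20.clm_apply (ha v)
    have h2 := h21.clm_apply (ha w)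
    have h3 := (h1.congr_of_eventuallyEq (hiso.mono fun q hq => (hq v w).symm)).unique h2
    have h4 := congrArg (fun T : E →L[ℝ] ℝ => T z) h3
    simp at h4
    linarith
  have h0 := hiso.self_of_nhds a w
  rw [h0, key v v w, key w v v, map_add, add_apply, hsymm w v,
    hsymG (θ' p v) (θ'' v w)]
  ring

end Spray

section ChartMetric

variable {m : ℕ} {M : Type*} [EMetricSpace M] [ChartedSpace (EuclideanSpace ℝ (Fin m)) M]
  [IsManifold (𝓡 m) ∞ M]

local notation "𝔼" => EuclideanSpace ℝ (Fin m)

/-- The derivative of the inverse of the chart at `x₀`. -/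
def chartSymmDeriv (x₀ : M) (p : 𝔼) : 𝔼 →L[ℝ] TangentSpace (𝓡 m) ((extChartAt (𝓡 m) x₀).symm p) :=
  mfderiv 𝓘(ℝ, 𝔼) (𝓡 m) (extChartAt (𝓡 m) x₀).symm p

lemma isOpen_chart_target (x₀ : M) : IsOpen (extChartAt (𝓡 m) x₀).target :=
  isOpen_extChartAt_target x₀

lemma contMDiffAt_chart_symm {x₀ : M} {p : 𝔼} (hp : p ∈ (extChartAt (𝓡 m) x₀).target) :
    ContMDiffAt 𝓘(ℝ, 𝔼) (𝓡 m) ∞ (extChartAt (𝓡 m) x₀).symm p :=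
  (contMDiffOn_extChartAt_symm x₀).contMDiffAt ((isOpen_chart_target x₀).mem_nhds hp)

lemma mdifferentiableAt_chart_symm {x₀ : M} {p : 𝔼} (hp : p ∈ (extChartAt (𝓡 m) x₀).target) :
    MDifferentiableAt 𝓘(ℝ, 𝔼) (𝓡 m) (extChartAt (𝓡 m) x₀).symm p :=
  (contMDiffAt_chart_symm hp).mdifferentiableAt (by simp)

lemma mem_chart_source_symm {x₀ : M} {p : 𝔼} (hp : p ∈ (extChartAt (𝓡 m) x₀).target) :
    (extChartAt (𝓡 m) x₀).symm p ∈ (chartAt 𝔼 x₀).source := by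
  have := (extChartAt (𝓡 m) x₀).map_target hp
  rwa [extChartAt_source] at this

lemma mfderiv_chart_chartSymmDeriv {x₀ : M} {p : 𝔼} (hp : p ∈ (extChartAt (𝓡 m) x₀).target)
    (v : 𝔼) : mfderiv (𝓡 m) 𝓘(ℝ, 𝔼) (extChartAt (𝓡 m) x₀) ((extChartAt (𝓡 m) x₀).symm p)
      (chartSymmDeriv x₀ p v) = v := by
  have h := mfderiv_extChartAt_comp_mfderivWithin_extChartAt_symm (I := 𝓡 m) hp
  rw [ModelWithCorners.range_eq_univ, mfderivWithin_univ] at h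
  exact congrArg (fun T : 𝔼 →L[ℝ] 𝔼 => T v) h

lemma chartSymmDeriv_mfderiv_chart {x₀ : M} {p : 𝔼} (hp : p ∈ (extChartAt (𝓡 m) x₀).target)
    (v : TangentSpace (𝓡 m) ((extChartAt (𝓡 m) x₀).symm p)) : chartSymmDeriv x₀ p
      (mfderiv (𝓡 m) 𝓘(ℝ, 𝔼) (extChartAt (𝓡 m) x₀) ((extChartAt (𝓡 m) x₀).symm p) v) = v := by
  have h := mfderivWithin_extChartAt_symm_comp_mfderiv_extChartAt (I := 𝓡 m) hp
  rw [ModelWithCorners.range_eq_univ, mfderivWithin_univ] at h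
  exact congrArg (fun T : TangentSpace (𝓡 m) ((extChartAt (𝓡 m) x₀).symm p) →L[ℝ]
    TangentSpace (𝓡 m) ((extChartAt (𝓡 m) x₀).symm p) => T v) h

variable [RiemannianBundle (fun x : M => TangentSpace (𝓡 m) x)]

/-- The inner product of tangent vectors at `x`. -/
def innerAt (x : M) (v w : TangentSpace (𝓡 m) x) : ℝ := inner ℝ v w

lemma chartMetric_eq (x₀ : M) (p v w : 𝔼) : chartMetric x₀ p v w =
    innerAt ((extChartAt (𝓡 m) x₀).symm p) (chartSymmDeriv x₀ p v) (chartSymmDeriv x₀ p w) := rfl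

lemma chartMetric_comm (x₀ : M) (p v w : 𝔼) : chartMetric x₀ p v w = chartMetric x₀ p w v :=
  real_inner_comm _ _

/-- The metric in a chart as a bilinear form. -/
def chartForm (x₀ : M) (p : 𝔼) : 𝔼 →L[ℝ] 𝔼 →L[ℝ] ℝ :=
  LinearMap.toContinuousBilinearMap (LinearMap.mk₂ ℝ (chartMetric x₀ p)
    (fun v v' w => by
      simp only [chartMetric_eq, map_add]; exact inner_add_left _ _ _)
    (fun c v w => by
      simp only [chartMetric_eq, map_smul]; exact real_inner_smul_left _ _ _)
    (fun v w w' => by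
      simp only [chartMetric_eq, map_add]; exact inner_add_right _ _ _)
    (fun c v w => by
      simp only [chartMetric_eq, map_smul]; exact real_inner_smul_right _ _ _))

lemma chartForm_apply (x₀ : M) (p v w : 𝔼) : chartForm x₀ p v w = chartMetric x₀ p v w := rfl

variable [IsContMDiffRiemannianBundle (𝓡 m) ∞ (EuclideanSpace ℝ (Fin m))
  (fun x : M => TangentSpace (𝓡 m) x)]

lemma contMDiffOn_chartSymmDeriv (x₀ : M) (v : 𝔼) :
    ContMDiffOn 𝓘(ℝ, 𝔼) ((𝓡 m).prod 𝓘(ℝ, 𝔼)) ∞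
      (fun p => (⟨(extChartAt (𝓡 m) x₀).symm p, chartSymmDeriv x₀ p v⟩ : TangentBundle (𝓡 m) M))
      (extChartAt (𝓡 m) x₀).target := by
  have h1 := (contMDiffOn_extChartAt_symm (I := 𝓡 m) (n := ∞) x₀).contMDiffOn_tangentMapWithin
    (m := ∞) (by simp) (isOpen_chart_target x₀).uniqueMDiffOn
  have h2 : ContMDiff 𝓘(ℝ, 𝔼) (𝓘(ℝ, 𝔼).prod 𝓘(ℝ, 𝔼)) ∞
      (fun p : 𝔼 => (⟨p, v⟩ : TangentBundle 𝓘(ℝ, 𝔼) 𝔼)) :=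
    contMDiff_vectorSpace_iff_contDiff.2 contDiff_const
  refine (h1.comp h2.contMDiffOn (t := _) (s := (extChartAt (𝓡 m) x₀).target)
    (fun p hp => hp)).congr fun p hp => ?_
  simp only [Function.comp_apply, tangentMapWithin, chartSymmDeriv]
  rw [mfderivWithin_of_isOpen (isOpen_chart_target x₀) hp]
  rfl

lemma contDiffOn_chartMetric (x₀ : M) (v w : 𝔼) :
    ContDiffOn ℝ ∞ (fun p => chartMetric x₀ p v w) (extChartAt (𝓡 m) x₀).target := by
  rw [← contMDiffOn_iff_contDiffOn]
  exact (contMDiffOn_chartSymmDeriv x₀ v).inner_bundle (contMDiffOn_chartSymmDeriv x₀ w)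

lemma contDiffOn_chartForm (x₀ : M) :
    ContDiffOn ℝ ∞ (chartForm x₀) (extChartAt (𝓡 m) x₀).target := by
  rw [contDiffOn_clm_apply]
  intro v
  rw [contDiffOn_clm_apply]
  exact fun w => contDiffOn_chartMetric x₀ v w

lemma contDiffAt_chartForm {x₀ : M} {p : 𝔼} (hp : p ∈ (extChartAt (𝓡 m) x₀).target) :
    ContDiffAt ℝ ∞ (chartForm x₀) p :=
  (contDiffOn_chartForm x₀).contDiffAt ((isOpen_chart_target x₀).mem_nhds hp)

lemma fderiv_chartMetric {x₀ : M} {p : 𝔼} (hp : p ∈ (extChartAt (𝓡 m) x₀).target) (v w z : 𝔼) :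
    fderiv ℝ (fun p => chartMetric x₀ p v w) p z = fderiv ℝ (chartForm x₀) p z v w := by
  have hd := ((contDiffAt_chartForm hp).differentiableAt (by simp)).hasFDerivAt
  have h1 := (hd.clm_apply (hasFDerivAt_const v p)).clm_apply (hasFDerivAt_const w p)
  have h2 : HasFDerivAt (fun p => chartMetric x₀ p v w) _ p := h1
  rw [h2.fderiv]
  simp

lemma chartForm_isInvertible {x₀ : M} {p : 𝔼} (hp : p ∈ (extChartAt (𝓡 m) x₀).target) :
    (chartForm x₀ p).IsInvertible := by
  have hinj : Function.Injective (chartForm x₀ p) := by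
    rw [injective_iff_map_eq_zero]
    intro v hv
    have h1 : chartForm x₀ p v v = 0 := by rw [hv]; rfl
    rw [chartForm_apply, chartMetric] at h1
    have h2 : chartSymmDeriv x₀ p v = 0 := inner_self_eq_zero.1 h1
    have h3 := mfderiv_chart_chartSymmDeriv hp v
    rw [h2, map_zero] at h3
    exact h3.symm
  have hdim : Module.finrank ℝ 𝔼 = Module.finrank ℝ (𝔼 →L[ℝ] ℝ) := by
    rw [← (LinearMap.toContinuousLinearMap (𝕜 := ℝ) (E := 𝔼) (F' := ℝ)).finrank_eq]
    exact (Subspace.dual_finrank_eq (K := ℝ) (V := 𝔼)).symm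
  let e := (LinearEquiv.ofInjectiveOfFinrankEq
    ((chartForm x₀ p : 𝔼 →L[ℝ] 𝔼 →L[ℝ] ℝ) : 𝔼 →ₗ[ℝ] 𝔼 →L[ℝ] ℝ) hinj hdim).toContinuousLinearEquiv
  exact ⟨e, by ext; rfl⟩

/-- The geodesic spray in the chart at `x₀`. -/
def spray (x₀ : M) : 𝔼 × 𝔼 → 𝔼 := sprayOf (chartForm x₀)

lemma eq_spray_iff {x₀ : M} {p : 𝔼} (hp : p ∈ (extChartAt (𝓡 m) x₀).target) (v a : 𝔼) :
    (∀ w : 𝔼, chartMetric x₀ p a w + fderiv ℝ (fun p => chartMetric x₀ p v w) p v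
      - (1 / 2) * fderiv ℝ (fun p => chartMetric x₀ p v v) p w = 0) ↔ a = spray x₀ (p, v) := by
  simp only [fderiv_chartMetric hp]
  exact eq_sprayOf_iff (chartForm_isInvertible hp) v a

lemma contDiffAt_spray {x₀ : M} {z : 𝔼 × 𝔼} (hp : z.1 ∈ (extChartAt (𝓡 m) x₀).target) :
    ContDiffAt ℝ 1 (spray x₀) z :=
  contDiffAt_sprayOf (contDiffAt_infty.1 (contDiffAt_chartForm hp) 2) (chartForm_isInvertible hp)

lemma spray_zero (x₀ : M) (p : 𝔼) : spray x₀ (p, 0) = 0 := sprayOf_zero _ p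

lemma fderiv_spray {x₀ : M} {p : 𝔼} (hp : p ∈ (extChartAt (𝓡 m) x₀).target) :
    fderiv ℝ (spray x₀) (p, 0) = 0 :=
  fderiv_sprayOf ((contDiffAt_spray hp).differentiableAt one_ne_zero)

end ChartMetric

/-! ### Geodesics in charts -/

section ChartChange

variable {m : ℕ} {M : Type*} [EMetricSpace M] [ChartedSpace (EuclideanSpace ℝ (Fin m)) M]
  [IsManifold (𝓡 m) ∞ M]

local notation "𝔼" => EuclideanSpace ℝ (Fin m)

lemma extChart_mem_target {x₀ x : M} (hx : x ∈ (chartAt 𝔼 x₀).source) :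
    extChartAt (𝓡 m) x₀ x ∈ (extChartAt (𝓡 m) x₀).target :=
  (extChartAt (𝓡 m) x₀).map_source (by rwa [extChartAt_source])

lemma chart_symm_chart {x₀ x : M} (hx : x ∈ (chartAt 𝔼 x₀).source) :
    (extChartAt (𝓡 m) x₀).symm (extChartAt (𝓡 m) x₀ x) = x :=
  (extChartAt (𝓡 m) x₀).left_inv (by rwa [extChartAt_source])

lemma chart_chart_symm {x₀ : M} {p : 𝔼} (hp : p ∈ (extChartAt (𝓡 m) x₀).target) :
    extChartAt (𝓡 m) x₀ ((extChartAt (𝓡 m) x₀).symm p) = p :=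
  (extChartAt (𝓡 m) x₀).right_inv hp

/-- The change of coordinates from the chart at `x₀` to the chart at `x₁`. -/
def chartChange (x₀ x₁ : M) (p : 𝔼) : 𝔼 := extChartAt (𝓡 m) x₁ ((extChartAt (𝓡 m) x₀).symm p)

lemma contMDiffAt_chart {x₁ x : M} (hx : x ∈ (chartAt 𝔼 x₁).source) :
    ContMDiffAt (𝓡 m) 𝓘(ℝ, 𝔼) ∞ (extChartAt (𝓡 m) x₁) x :=
  contMDiffAt_extChartAt' hx

lemma contDiffAt_chartChange {x₀ x₁ : M} {p : 𝔼} (hp : p ∈ (extChartAt (𝓡 m) x₀).target)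
    (h1 : (extChartAt (𝓡 m) x₀).symm p ∈ (chartAt 𝔼 x₁).source) :
    ContDiffAt ℝ ∞ (chartChange x₀ x₁) p := by
  rw [← contMDiffAt_iff_contDiffAt]
  exact ContMDiffAt.comp p (contMDiffAt_chart h1) (contMDiffAt_chart_symm hp)

lemma eventually_chart_symm_mem {x₀ x₁ : M} {p : 𝔼} (hp : p ∈ (extChartAt (𝓡 m) x₀).target)
    (h1 : (extChartAt (𝓡 m) x₀).symm p ∈ (chartAt 𝔼 x₁).source) :
    ∀ᶠ q in 𝓝 p, q ∈ (extChartAt (𝓡 m) x₀).target ∧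
      (extChartAt (𝓡 m) x₀).symm q ∈ (chartAt 𝔼 x₁).source :=
  ((isOpen_chart_target x₀).eventually_mem hp).and
    ((contMDiffAt_chart_symm hp).continuousAt.eventually_mem
      ((chartAt 𝔼 x₁).open_source.mem_nhds h1))

lemma chartSymmDeriv_chartChange {x₀ x₁ : M} {p : 𝔼} (hp : p ∈ (extChartAt (𝓡 m) x₀).target)
    (h1 : (extChartAt (𝓡 m) x₀).symm p ∈ (chartAt 𝔼 x₁).source) :
    (chartSymmDeriv x₀ p : 𝔼 →L[ℝ] 𝔼) = (chartSymmDeriv x₁ (chartChange x₀ x₁ p) : 𝔼 →L[ℝ] 𝔼) ∘L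
      fderiv ℝ (chartChange x₀ x₁) p := by
  have hd := (contDiffAt_chartChange hp h1).differentiableAt (by simp)
  have h2 : (extChartAt (𝓡 m) x₀).symm =ᶠ[𝓝 p]
      (extChartAt (𝓡 m) x₁).symm ∘ chartChange x₀ x₁ :=
    (eventually_chart_symm_mem hp h1).mono fun q hq => (chart_symm_chart hq.2).symm
  have h3 := h2.mfderiv_eq (I := 𝓘(ℝ, 𝔼)) (I' := 𝓡 m)
  have h4 := mfderiv_comp p (I := 𝓘(ℝ, 𝔼)) (I' := 𝓘(ℝ, 𝔼)) (I'' := 𝓡 m)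
    (g := (extChartAt (𝓡 m) x₁).symm) (f := chartChange x₀ x₁)
    (mdifferentiableAt_chart_symm (extChart_mem_target h1)) hd.mdifferentiableAt
  have h5 : mfderiv 𝓘(ℝ, 𝔼) 𝓘(ℝ, 𝔼) (chartChange x₀ x₁) p = fderiv ℝ (chartChange x₀ x₁) p :=
    mfderiv_eq_fderiv
  rw [h5] at h4
  exact h3.trans h4

lemma fderiv_chartChange_surjective {x₀ x₁ : M} {p : 𝔼}
    (hp : p ∈ (extChartAt (𝓡 m) x₀).target)
    (h1 : (extChartAt (𝓡 m) x₀).symm p ∈ (chartAt 𝔼 x₁).source) :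
    Function.Surjective (fderiv ℝ (chartChange x₀ x₁) p) := by
  refine (LinearMap.injective_iff_surjective
    (f := (fderiv ℝ (chartChange x₀ x₁) p : 𝔼 →ₗ[ℝ] 𝔼))).1 ?_
  rw [injective_iff_map_eq_zero]
  intro w hw
  have hA := congrArg (fun T : 𝔼 →L[ℝ] 𝔼 => T w) (chartSymmDeriv_chartChange hp h1)
  have h2 : fderiv ℝ (chartChange x₀ x₁) p w = 0 := hw
  have h3 : chartSymmDeriv x₀ p w = 0 := by
    refine hA.trans ?_
    change (chartSymmDeriv x₁ (chartChange x₀ x₁ p) : 𝔼 →L[ℝ] 𝔼)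
      (fderiv ℝ (chartChange x₀ x₁) p w) = 0
    rw [h2, map_zero]
  have h4 := mfderiv_chart_chartSymmDeriv hp w
  rw [h3, map_zero] at h4
  exact h4.symm

variable [RiemannianBundle (fun x : M => TangentSpace (𝓡 m) x)]

/-- The inner product at `x`, on tangent vectors regarded as elements of the model space. -/
def innerModel (x : M) (v w : 𝔼) : ℝ := innerAt x v w

lemma chartMetric_chartChange {x₀ x₁ : M} {p : 𝔼} (hp : p ∈ (extChartAt (𝓡 m) x₀).target)
    (h1 : (extChartAt (𝓡 m) x₀).symm p ∈ (chartAt 𝔼 x₁).source) (v w : 𝔼) :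
    chartMetric x₀ p v w = chartMetric x₁ (chartChange x₀ x₁ p)
      (fderiv ℝ (chartChange x₀ x₁) p v) (fderiv ℝ (chartChange x₀ x₁) p w) := by
  have hx : (extChartAt (𝓡 m) x₀).symm p = (extChartAt (𝓡 m) x₁).symm (chartChange x₀ x₁ p) :=
    (chart_symm_chart h1).symm
  have hA := chartSymmDeriv_chartChange hp h1
  change innerModel ((extChartAt (𝓡 m) x₀).symm p) ((chartSymmDeriv x₀ p : 𝔼 →L[ℝ] 𝔼) v)
    ((chartSymmDeriv x₀ p : 𝔼 →L[ℝ] 𝔼) w) = _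
  rw [hA, hx]
  rfl

variable [IsContMDiffRiemannianBundle (𝓡 m) ∞ (EuclideanSpace ℝ (Fin m))
  (fun x : M => TangentSpace (𝓡 m) x)]

/-- A solution of the geodesic equation in one chart is a geodesic on the manifold, that is, solves
the geodesic equation in every chart. -/
lemma isGeodesicOn_chart_symm {x₀ : M} {u ν : ℝ → 𝔼} {s : Set ℝ} (hs : IsOpen s)
    (h : ∀ t ∈ s, HasDerivAt u (ν t) t ∧ HasDerivAt ν (spray x₀ (u t, ν t)) t ∧
      u t ∈ (extChartAt (𝓡 m) x₀).target) :
    IsGeodesicOn (m := m) (M := M) (fun t => (extChartAt (𝓡 m) x₀).symm (u t)) s := by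
  refine ⟨fun t ht => ((contMDiffAt_chart_symm (x₀ := x₀) (h t ht).2.2).continuousAt.comp
    (h t ht).1.continuousAt).continuousWithinAt, fun x₁ t ht h1 => ?_⟩
  set θ : 𝔼 → 𝔼 := chartChange x₀ x₁ with hθ
  have hp := (h t ht).2.2
  have hθ1 : ContDiffAt ℝ ∞ θ (u t) := contDiffAt_chartChange hp h1
  have hθd : DifferentiableAt ℝ (fderiv ℝ θ) (u t) :=
    (hθ1.fderiv_right (m := 1) (by norm_cast)).differentiableAt one_ne_zero
  have hut := (h t ht).1
  refine ⟨fun τ => fderiv ℝ θ (u τ) (ν τ), fderiv ℝ θ (u t) (spray x₀ (u t, ν t))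
    + fderiv ℝ (fderiv ℝ θ) (u t) (ν t) (ν t), ?_, ?_, ?_⟩
  · filter_upwards [hs.eventually_mem ht,
      hut.continuousAt.eventually (eventually_chart_symm_mem hp h1)] with τ hτ hτ'
    exact ((contDiffAt_chartChange hτ'.1 hτ'.2).differentiableAt (by simp)).hasFDerivAt.comp_hasDerivAt
      τ (h τ hτ).1
  · have h2 : HasDerivAt (fun τ => fderiv ℝ θ (u τ)) (fderiv ℝ (fderiv ℝ θ) (u t) (ν t)) t :=
      hθd.hasFDerivAt.comp_hasDerivAt t hut
    simpa [add_comm] using h2.clm_apply (h t ht).2.1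
  · intro w
    obtain ⟨w, rfl⟩ := fderiv_chartChange_surjective hp h1 w
    have hp1 : θ (u t) ∈ (extChartAt (𝓡 m) x₁).target := extChart_mem_target h1
    have key := geodesic_equation_covariant
      (hG := ((contDiffAt_chartForm hp).differentiableAt (by simp)).hasFDerivAt)
      (hG' := ((contDiffAt_chartForm hp1).differentiableAt (by simp)).hasFDerivAt)
      (hθ := (hθ1.differentiableAt (by simp)).hasFDerivAt) (hθ' := hθd.hasFDerivAt)
      (fun a b => ((contDiffAt_infty.1 hθ1 2).isSymmSndFDerivAt (by simp)).eq a b)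
      ((eventually_chart_symm_mem hp h1).mono fun q hq v w =>
        chartMetric_chartChange hq.1 hq.2 v w)
      (fun v w => chartMetric_comm _ _ v w) (ν t) (spray x₀ (u t, ν t)) w
    have h3 := (eq_spray_iff hp (ν t) _).2 rfl w
    simp only [fderiv_chartMetric hp] at h3
    change chartMetric x₁ (θ (u t)) _ _ + fderiv ℝ _ (θ (u t)) _ - _ * fderiv ℝ _ (θ (u t)) _ = 0
    rw [fderiv_chartMetric hp1, fderiv_chartMetric hp1]
    exact key.symm.trans h3

end ChartChange

section GeodesicChart

variable {m : ℕ} {M : Type*} [EMetricSpace M] [ChartedSpace (EuclideanSpace ℝ (Fin m)) M]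
  [IsManifold (𝓡 m) ∞ M]

local notation "𝔼" => EuclideanSpace ℝ (Fin m)

/-- The velocity of a curve, as a point of the tangent bundle, in terms of its velocity in a chart. -/
lemma velocity_eq {γ : ℝ → M} {x₀ : M} {u : ℝ → 𝔼} {w : 𝔼} {t : ℝ}
    (hγ : γ =ᶠ[𝓝 t] fun τ => (extChartAt (𝓡 m) x₀).symm (u τ)) (hu : HasDerivAt u w t)
    (hut : u t ∈ (extChartAt (𝓡 m) x₀).target) :
    (⟨γ t, mfderiv 𝓘(ℝ, ℝ) (𝓡 m) γ t (1 : ℝ)⟩ : TangentBundle (𝓡 m) M)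
      = ⟨(extChartAt (𝓡 m) x₀).symm (u t), chartSymmDeriv x₀ (u t) w⟩ := by
  have h1 := mfderiv_comp t (I := 𝓘(ℝ, ℝ)) (I' := 𝓘(ℝ, 𝔼)) (I'' := 𝓡 m)
    (mdifferentiableAt_chart_symm hut) hu.differentiableAt.mdifferentiableAt
  have h2 := hγ.mfderiv_eq (I := 𝓘(ℝ, ℝ)) (I' := 𝓡 m)
  have h3 : (mfderiv 𝓘(ℝ, ℝ) (𝓡 m) γ t : ℝ →L[ℝ] 𝔼) (1 : ℝ) = (chartSymmDeriv x₀ (u t) : 𝔼 →L[ℝ] 𝔼) w := by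
    have h4 : (mfderiv 𝓘(ℝ, ℝ) (𝓡 m) γ t : ℝ →L[ℝ] 𝔼)
      = (chartSymmDeriv x₀ (u t) : 𝔼 →L[ℝ] 𝔼) ∘L (mfderiv 𝓘(ℝ, ℝ) 𝓘(ℝ, 𝔼) u t : ℝ →L[ℝ] 𝔼) := h2.trans h1
    have h6 : (mfderiv 𝓘(ℝ, ℝ) 𝓘(ℝ, 𝔼) u t : ℝ →L[ℝ] 𝔼) (1 : ℝ) = w := by
      rw [mfderiv_eq_fderiv, hu.hasFDerivAt.fderiv]
      exact one_smul ℝ w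
    rw [h4, ← h6]
    rfl
  have h5 := hγ.self_of_nhds
  change (⟨γ t, (mfderiv 𝓘(ℝ, ℝ) (𝓡 m) γ t : ℝ →L[ℝ] 𝔼) (1 : ℝ)⟩ : TangentBundle (𝓡 m) M) = _
  rw [h3]
  exact congrArg (fun x => (⟨x, (chartSymmDeriv x₀ (u t) : 𝔼 →L[ℝ] 𝔼) w⟩ : TangentBundle (𝓡 m) M)) h5

variable [RiemannianBundle (fun x : M => TangentSpace (𝓡 m) x)]
  [IsContMDiffRiemannianBundle (𝓡 m) ∞ (EuclideanSpace ℝ (Fin m))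
  (fun x : M => TangentSpace (𝓡 m) x)]

/-- A geodesic, read in a chart, is a solution of the second order equation of the spray. -/
lemma IsGeodesicOn.hasDerivAt_chart {γ : ℝ → M} {s : Set ℝ} (hγ : IsGeodesicOn (m := m) γ s)
    {x₀ : M} {t : ℝ} (ht : t ∈ s) (h0 : γ t ∈ (chartAt 𝔼 x₀).source) :
    HasDerivAt (fun τ => extChartAt (𝓡 m) x₀ (γ τ))
      (deriv (fun τ => extChartAt (𝓡 m) x₀ (γ τ)) t) t ∧
    HasDerivAt (deriv (fun τ => extChartAt (𝓡 m) x₀ (γ τ)))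
      (spray x₀ (extChartAt (𝓡 m) x₀ (γ t), deriv (fun τ => extChartAt (𝓡 m) x₀ (γ τ)) t)) t := by
  obtain ⟨c', a, h1, h2, h3⟩ := hγ.2 x₀ t ht h0
  have h4 := (eq_spray_iff (extChart_mem_target h0) _ _).1 h3
  have h5 : deriv (fun τ => extChartAt (𝓡 m) x₀ (γ τ)) =ᶠ[𝓝 t] c' := h1.mono fun τ hτ => hτ.deriv
  refine ⟨h1.self_of_nhds.differentiableAt.hasDerivAt, ?_⟩
  rw [h5.self_of_nhds, ← h4]
  exact h2.congr_of_eventuallyEq h5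

/-- Uniqueness of geodesics, for a geodesic that runs inside a chart. -/
lemma IsGeodesicOn.eq_chart_symm {γ : ℝ → M} {η : ℝ} (hη : 0 < η)
    (hγ : IsGeodesicOn (m := m) γ (Ioo (-η) (1 + η))) {x₀ : M} {u ν : ℝ → 𝔼}
    (h : ∀ t ∈ Ioo (-1 : ℝ) 2, HasDerivAt u (ν t) t ∧ HasDerivAt ν (spray x₀ (u t, ν t)) t ∧
      u t ∈ (extChartAt (𝓡 m) x₀).target) (h0 : γ 0 = (extChartAt (𝓡 m) x₀).symm (u 0))
    (h0' : deriv (fun τ => extChartAt (𝓡 m) x₀ (γ τ)) 0 = ν 0) :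
    γ 1 = (extChartAt (𝓡 m) x₀).symm (u 1) := by
  set c := fun τ => extChartAt (𝓡 m) x₀ (γ τ) with hc
  have hI : ∀ t ∈ Icc (0 : ℝ) 1, t ∈ Ioo (-1 : ℝ) 2 ∧ t ∈ Ioo (-η) (1 + η) := fun t ht =>
    ⟨⟨by linarith [ht.1], by linarith [ht.2]⟩, ⟨by linarith [ht.1], by linarith [ht.2]⟩⟩
  have hγc : ∀ t ∈ Icc (0 : ℝ) 1, ContinuousAt γ t := fun t ht =>
    hγ.1.continuousAt (isOpen_Ioo.mem_nhds (hI t ht).2)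
  have huc : ∀ t ∈ Icc (0 : ℝ) 1, ContinuousAt (fun t => (extChartAt (𝓡 m) x₀).symm (u t)) t :=
    fun t ht => (contMDiffAt_chart_symm (h t (hI t ht).1).2.2).continuousAt.comp
      (h t (hI t ht).1).1.continuousAt
  set S : Set ℝ := {t | γ t = (extChartAt (𝓡 m) x₀).symm (u t) ∧ deriv c t = ν t} with hS
  have hsrc : ∀ t ∈ Icc (0 : ℝ) 1, γ t = (extChartAt (𝓡 m) x₀).symm (u t) →
      γ t ∈ (chartAt 𝔼 x₀).source := fun t ht he => by
    rw [he]; exact mem_chart_source_symm (h t (hI t ht).1).2.2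
  have hclosed : IsClosed (S ∩ Icc 0 1) := by
    rw [← closure_subset_iff_isClosed]
    intro t ht
    have htI : t ∈ Icc (0 : ℝ) 1 := closure_minimal inter_subset_right isClosed_Icc ht
    have : (𝓝[S ∩ Icc 0 1] t).NeBot := mem_closure_iff_nhdsWithin_neBot.1 ht
    have hmem : ∀ᶠ τ in 𝓝[S ∩ Icc 0 1] t, τ ∈ S ∩ Icc 0 1 := eventually_mem_nhdsWithin
    have h1 : γ t = (extChartAt (𝓡 m) x₀).symm (u t) :=
      tendsto_nhds_unique_of_eventuallyEq ((hγc t htI).mono_left nhdsWithin_le_nhds)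
        ((huc t htI).mono_left nhdsWithin_le_nhds) (hmem.mono fun τ hτ => hτ.1.1)
    have h2 := (hγ.hasDerivAt_chart (hI t htI).2 (hsrc t htI h1)).2.continuousAt
    refine ⟨⟨h1, tendsto_nhds_unique_of_eventuallyEq (h2.mono_left nhdsWithin_le_nhds)
      ((h t (hI t htI).1).2.1.continuousAt.mono_left nhdsWithin_le_nhds)
      (hmem.mono fun τ hτ => hτ.1.2)⟩, htI⟩
  have hstep : ∀ t ∈ S ∩ Ico 0 1, S ∈ 𝓝[>] t := by
    rintro t ⟨⟨h1, h2⟩, ht⟩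
    have htI : t ∈ Icc (0 : ℝ) 1 := Ico_subset_Icc_self ht
    have hs := hsrc t htI h1
    have hct : c t = u t := by
      simp only [hc]; rw [h1]; exact chart_chart_symm (h t (hI t htI).1).2.2
    set F : 𝔼 × 𝔼 → 𝔼 × 𝔼 := fun z => (z.2, spray x₀ z) with hF
    have hFc : ContDiffAt ℝ 1 F (u t, ν t) :=
      contDiffAt_snd.prodMk (contDiffAt_spray (h t (hI t htI).1).2.2)
    obtain ⟨K, U, hU, hL⟩ := hFc.exists_lipschitzOnWith
    have hsrc' : ∀ᶠ τ in 𝓝 t, γ τ ∈ (chartAt 𝔼 x₀).source :=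
      (hγc t htI).eventually_mem ((chartAt 𝔼 x₀).open_source.mem_nhds hs)
    have hca : ContinuousAt (fun τ => (c τ, deriv c τ)) t :=
      (hγ.hasDerivAt_chart (hI t htI).2 hs).1.continuousAt.prodMk
        (hγ.hasDerivAt_chart (hI t htI).2 hs).2.continuousAt
    have hua : ContinuousAt (fun τ => (u τ, ν τ)) t :=
      (h t (hI t htI).1).1.continuousAt.prodMk (h t (hI t htI).1).2.1.continuousAt
    have e1 : ∀ᶠ τ in 𝓝 t, HasDerivAt (fun τ => (c τ, deriv c τ)) (F (c τ, deriv c τ)) τ ∧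
        (c τ, deriv c τ) ∈ U := by
      filter_upwards [hsrc', isOpen_Ioo.eventually_mem (hI t htI).2,
        hca.eventually_mem (by rwa [hct, h2])] with τ h3 h4 h5
      exact ⟨(hγ.hasDerivAt_chart h4 h3).1.prodMk (hγ.hasDerivAt_chart h4 h3).2, h5⟩
    have e2 : ∀ᶠ τ in 𝓝 t, HasDerivAt (fun τ => (u τ, ν τ)) (F (u τ, ν τ)) τ ∧
        (u τ, ν τ) ∈ U := by
      filter_upwards [isOpen_Ioo.eventually_mem (hI t htI).1, hua.eventually_mem hU] with τ h4 h5
      exact ⟨(h τ h4).1.prodMk (h τ h4).2.1, h5⟩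
    have key := ODE_solution_unique_of_eventually (v := fun _ => F) (s := fun _ => U) (K := K)
      (Eventually.of_forall fun _ => hL) e1 e2 (by simp only [hct, h2])
    refine mem_nhdsWithin_of_mem_nhds ?_
    filter_upwards [key, hsrc'] with τ h3 h4
    obtain ⟨h5, h6⟩ := Prod.mk.inj h3
    exact ⟨by rw [← h5]; exact (chart_symm_chart h4).symm, h6⟩
  have := hclosed.Icc_subset_of_forall_mem_nhdsWithin ⟨h0, h0'⟩ hstep
  exact (this (right_mem_Icc.2 zero_le_one)).1

/-- The exponential map in a chart: it is `C^1` near the zero vector at `x₀`, with derivative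
`(p, v) ↦ p + v` there. -/
lemma exists_chart_exp (x₀ : M) : ∃ Ex : 𝔼 × 𝔼 → 𝔼,
    ContDiffAt ℝ 1 Ex (extChartAt (𝓡 m) x₀ x₀, 0) ∧
    HasFDerivAt Ex (.fst ℝ 𝔼 𝔼 + .snd ℝ 𝔼 𝔼) (extChartAt (𝓡 m) x₀ x₀, 0) ∧
    Ex (extChartAt (𝓡 m) x₀ x₀, 0) = extChartAt (𝓡 m) x₀ x₀ ∧
    ∀ᶠ z in 𝓝 (extChartAt (𝓡 m) x₀ x₀, (0 : 𝔼)), z.1 ∈ (extChartAt (𝓡 m) x₀).target ∧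
      Ex z ∈ (extChartAt (𝓡 m) x₀).target ∧
      ∀ y, IsExp ((extChartAt (𝓡 m) x₀).symm z.1) (chartSymmDeriv x₀ z.1 z.2) y ↔
        y = (extChartAt (𝓡 m) x₀).symm (Ex z) := by
  have hp : extChartAt (𝓡 m) x₀ x₀ ∈ (extChartAt (𝓡 m) x₀).target :=
    extChart_mem_target (mem_chart_source 𝔼 x₀)
  obtain ⟨u, ν, h1, h2, h3, h4⟩ := exists_second_order_flow (S := spray x₀)
    (p₀ := extChartAt (𝓡 m) x₀ x₀) (contDiffAt_spray hp) (spray_zero x₀ _) (fderiv_spray hp)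
    (O := (extChartAt (𝓡 m) x₀).target ×ˢ univ)
    (prod_mem_nhds ((isOpen_chart_target x₀).mem_nhds hp) univ_mem)
  refine ⟨fun z => u z 1, h1, h2, h3, h4.mono ?_⟩
  rintro z ⟨hz0, hz1, hz⟩
  have hz' : ∀ t ∈ Ioo (-1 : ℝ) 2, HasDerivAt (u z) (ν z t) t ∧
      HasDerivAt (ν z) (spray x₀ (u z t, ν z t)) t ∧ u z t ∈ (extChartAt (𝓡 m) x₀).target :=
    fun t ht => ⟨(hz t ht).1, (hz t ht).2.1, (hz t ht).2.2.1⟩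
  have m0 : (0 : ℝ) ∈ Ioo (-1 : ℝ) 2 := by constructor <;> norm_num
  have m1 : (1 : ℝ) ∈ Ioo (-1 : ℝ) 2 := by constructor <;> norm_num
  have hzt : z.1 ∈ (extChartAt (𝓡 m) x₀).target := hz0 ▸ (hz' 0 m0).2.2
  refine ⟨hzt, (hz' 1 m1).2.2, fun y => ⟨?_, ?_⟩⟩
  · rintro ⟨γ, η, hη, hγ, hv, rfl⟩
    have hγ0 : γ 0 = (extChartAt (𝓡 m) x₀).symm z.1 := congrArg TotalSpace.proj hv
    have hs : γ 0 ∈ (chartAt 𝔼 x₀).source := hγ0 ▸ mem_chart_source_symm hzt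
    have h0η : (0 : ℝ) ∈ Ioo (-η) (1 + η) := ⟨by linarith, by linarith⟩
    have hd := hγ.hasDerivAt_chart h0η hs
    have hcont : ContinuousAt γ 0 := hγ.1.continuousAt (isOpen_Ioo.mem_nhds h0η)
    have hv2 := velocity_eq (γ := γ) (x₀ := x₀) (t := 0)
      ((hcont.eventually_mem ((chartAt 𝔼 x₀).open_source.mem_nhds hs)).mono
        fun τ hτ => (chart_symm_chart hτ).symm) hd.1 (extChart_mem_target hs)
    rw [hv] at hv2
    have hc0 : extChartAt (𝓡 m) x₀ (γ 0) = z.1 := by rw [hγ0, chart_chart_symm hzt]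
    rw [hc0] at hv2
    have hv3 : chartSymmDeriv x₀ z.1 z.2
        = chartSymmDeriv x₀ z.1 (deriv (fun τ => extChartAt (𝓡 m) x₀ (γ τ)) 0) := by
      simpa using hv2
    have hv4 := mfderiv_chart_chartSymmDeriv hzt z.2
    rw [hv3, mfderiv_chart_chartSymmDeriv hzt] at hv4
    exact hγ.eq_chart_symm hη hz' (by rw [hγ0, hz0]) (hv4.trans hz1.symm)
  · rintro rfl
    refine ⟨fun t => (extChartAt (𝓡 m) x₀).symm (u z t), 1, one_pos, ?_, ?_, rfl⟩
    · have : (1 : ℝ) + 1 = 2 := by norm_num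
      rw [this]
      exact isGeodesicOn_chart_symm isOpen_Ioo hz'
    · have := velocity_eq (γ := fun t => (extChartAt (𝓡 m) x₀).symm (u z t)) (x₀ := x₀) (t := 0)
        (EventuallyEq.refl _ _) (hz' 0 m0).1 (hz' 0 m0).2.2
      rw [this, hz0, hz1]

end GeodesicChart

/-! ### Left inverses, tangent vectors and the Riemannian norm in charts -/

section Pseudoinverse

variable {E V : Type*} [NormedAddCommGroup E] [InnerProductSpace ℝ E] [FiniteDimensional ℝ E]
  [NormedAddCommGroup V] [InnerProductSpace ℝ V] [FiniteDimensional ℝ V]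

/-- The left inverse of an injective linear map that vanishes on the orthogonal complement of its
range. -/
def pinv (A : E →L[ℝ] V) : V →L[ℝ] E :=
  (ContinuousLinearMap.adjoint A ∘L A).inverse ∘L ContinuousLinearMap.adjoint A

lemma gram_isInvertible {A : E →L[ℝ] V} (hA : Function.Injective A) :
    (ContinuousLinearMap.adjoint A ∘L A).IsInvertible := by
  have hinj : Function.Injective (ContinuousLinearMap.adjoint A ∘L A : E →L[ℝ] E) := by
    rw [injective_iff_map_eq_zero]
    intro v hv
    have h1 : inner ℝ (ContinuousLinearMap.adjoint A (A v)) v = (0 : ℝ) := by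
      have : ContinuousLinearMap.adjoint A (A v) = 0 := hv
      rw [this, inner_zero_left]
    rw [ContinuousLinearMap.adjoint_inner_left] at h1
    exact hA ((inner_self_eq_zero.1 h1).trans (map_zero A).symm)
  let e := (LinearEquiv.ofInjectiveEndo
    ((ContinuousLinearMap.adjoint A ∘L A : E →L[ℝ] E) : E →ₗ[ℝ] E) hinj).toContinuousLinearEquiv
  exact ⟨e, by ext; rfl⟩

lemma pinv_comp_self {A : E →L[ℝ] V} (hA : Function.Injective A) :
    pinv A ∘L A = ContinuousLinearMap.id ℝ E := by
  obtain ⟨e, he⟩ := gram_isInvertible hA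
  rw [pinv, ContinuousLinearMap.comp_assoc, ← he, ContinuousLinearMap.inverse_equiv]
  ext v; simp

/-- The left inverse `pinv` is covariant under linear changes of coordinates in the source; hence
the left inverses of the derivatives of an immersion do not depend on charts. -/
lemma pinv_comp_equiv {A : E →L[ℝ] V} (hA : Function.Injective A) (K : E ≃L[ℝ] E) :
    pinv (A ∘L (K : E →L[ℝ] E)) = (K.symm : E →L[ℝ] E) ∘L pinv A := by
  set A' := A ∘L (K : E →L[ℝ] E) with hA'
  have hinj : Function.Injective A' := hA.comp K.injective
  obtain ⟨e', he'⟩ := gram_isInvertible hinj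
  -- both sides solve the normal equations of `A'`
  have h1 : ∀ v, ContinuousLinearMap.adjoint A (A (pinv A v)) = ContinuousLinearMap.adjoint A v := by
    intro v
    obtain ⟨e, he⟩ := gram_isInvertible hA
    have h2 := congrArg (fun T : E →L[ℝ] E => T (pinv A v)) he
    simp only [ContinuousLinearEquiv.coe_coe, ContinuousLinearMap.comp_apply] at h2
    rw [← h2, pinv, ← he, ContinuousLinearMap.inverse_equiv]
    simp
  ext1 v
  have h3 : e' ((K.symm : E →L[ℝ] E) (pinv A v)) = ContinuousLinearMap.adjoint A' v := by
    have h2 := congrArg (fun T : E →L[ℝ] E => T (K.symm (pinv A v))) he'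
    simp only [ContinuousLinearEquiv.coe_coe, ContinuousLinearMap.comp_apply] at h2 ⊢
    rw [h2, hA', ContinuousLinearMap.adjoint_comp]
    simp [h1]
  rw [pinv, ← he', ContinuousLinearMap.inverse_equiv, ContinuousLinearMap.comp_apply, ← h3]
  simp

lemma continuousAt_pinv {A : E →L[ℝ] V} (hA : Function.Injective A) :
    ContinuousAt (pinv : (E →L[ℝ] V) → V →L[ℝ] E) A := by
  have h1 : ContinuousAt (fun A : E →L[ℝ] V => ContinuousLinearMap.adjoint A) A :=
    ContinuousLinearMap.adjoint.continuous.continuousAt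
  have h2 : ContinuousAt (fun A : E →L[ℝ] V => ContinuousLinearMap.adjoint A ∘L A) A :=
    h1.clm_comp continuousAt_id
  have h3 : ContinuousAt (fun A : E →L[ℝ] V => (ContinuousLinearMap.adjoint A ∘L A).inverse) A :=
    ContinuousAt.comp (g := ContinuousLinearMap.inverse)
      ((gram_isInvertible hA).contDiffAt_map_inverse (n := 0) |>.continuousAt) h2
  exact h3.clm_comp h1

end Pseudoinverse

section TangentNorm

variable {m : ℕ} {M : Type*} [EMetricSpace M] [ChartedSpace (EuclideanSpace ℝ (Fin m)) M]
  [IsManifold (𝓡 m) ∞ M]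

local notation "𝔼" => EuclideanSpace ℝ (Fin m)

/-- The derivative of the chart at `x₀`. -/
def chartDeriv (x₀ x : M) : 𝔼 →L[ℝ] 𝔼 := mfderiv (𝓡 m) 𝓘(ℝ, 𝔼) (extChartAt (𝓡 m) x₀) x

/-- The derivative of the inverse of the chart at `x₀`, with values in the model space. -/
def chartSymmDerivE (x₀ : M) (p : 𝔼) : 𝔼 →L[ℝ] 𝔼 := chartSymmDeriv x₀ p

lemma chartDeriv_chartSymmDerivE {x₀ : M} {p : 𝔼} (hp : p ∈ (extChartAt (𝓡 m) x₀).target)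
    (v : 𝔼) : chartDeriv x₀ ((extChartAt (𝓡 m) x₀).symm p) (chartSymmDerivE x₀ p v) = v :=
  mfderiv_chart_chartSymmDeriv hp v

lemma chartSymmDerivE_chartDeriv {x₀ : M} {p : 𝔼} (hp : p ∈ (extChartAt (𝓡 m) x₀).target)
    (v : 𝔼) : chartSymmDerivE x₀ p (chartDeriv x₀ ((extChartAt (𝓡 m) x₀).symm p) v) = v :=
  chartSymmDeriv_mfderiv_chart hp v

lemma eventually_of_chart {x₀ : M} {Q : M → Prop}
    (h : ∀ᶠ p in 𝓝 (extChartAt (𝓡 m) x₀ x₀), p ∈ (extChartAt (𝓡 m) x₀).target →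
      Q ((extChartAt (𝓡 m) x₀).symm p)) : ∀ᶠ x in 𝓝 x₀, Q x := by
  have h1 : ContinuousAt (extChartAt (𝓡 m) x₀) x₀ := continuousAt_extChartAt x₀
  filter_upwards [h1.eventually h, (chartAt 𝔼 x₀).open_source.mem_nhds (mem_chart_source 𝔼 x₀)]
    with x hx hs
  have := hx (extChart_mem_target hs)
  rwa [chart_symm_chart hs] at this

variable {G : Type*} [NormedAddCommGroup G] [NormedSpace ℝ G]

/-- The derivative of a function with values in a vector space, with the tangent space regarded as
the model space. -/
def tderiv (F : M → G) (x : M) : 𝔼 →L[ℝ] G := mfderiv (𝓡 m) 𝓘(ℝ, G) F x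

lemma tderiv_chart_symm {F : M → G} {x₀ : M} {p : 𝔼} (hp : p ∈ (extChartAt (𝓡 m) x₀).target)
    (hF : MDifferentiableAt (𝓡 m) 𝓘(ℝ, G) F ((extChartAt (𝓡 m) x₀).symm p)) :
    tderiv F ((extChartAt (𝓡 m) x₀).symm p) ∘L chartSymmDerivE x₀ p
      = fderiv ℝ (F ∘ (extChartAt (𝓡 m) x₀).symm) p := by
  have h := mfderiv_comp p (I := 𝓘(ℝ, 𝔼)) (I' := 𝓡 m) (I'' := 𝓘(ℝ, G)) hF
    (mdifferentiableAt_chart_symm hp)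
  have h5 : mfderiv 𝓘(ℝ, 𝔼) 𝓘(ℝ, G) (F ∘ (extChartAt (𝓡 m) x₀).symm) p
      = fderiv ℝ (F ∘ (extChartAt (𝓡 m) x₀).symm) p := mfderiv_eq_fderiv
  exact (h5.symm.trans h).symm

lemma contDiffAt_comp_chart_symm {F : M → G} {x₀ : M} {p : 𝔼}
    (hp : p ∈ (extChartAt (𝓡 m) x₀).target)
    (hF : ContMDiffAt (𝓡 m) 𝓘(ℝ, G) 1 F ((extChartAt (𝓡 m) x₀).symm p)) :
    ContDiffAt ℝ 1 (F ∘ (extChartAt (𝓡 m) x₀).symm) p := by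
  rw [← contMDiffAt_iff_contDiffAt]
  exact ContMDiffAt.comp p hF ((contMDiffAt_chart_symm hp).of_le (by norm_cast))

variable [RiemannianBundle (fun x : M => TangentSpace (𝓡 m) x)]

/-- The Riemannian norm of a tangent vector at `x`, as a function on the model space. -/
def rnorm (x : M) (v : TangentSpace (𝓡 m) x) : ℝ := ‖v‖

lemma rnorm_nonneg (x : M) (v : TangentSpace (𝓡 m) x) : 0 ≤ rnorm x v := norm_nonneg v

lemma eq_zero_of_rnorm_eq_zero {x : M} {v : TangentSpace (𝓡 m) x} (h : rnorm x v = 0) : v = 0 :=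
  norm_eq_zero.1 h

lemma rnorm_chart_sq (x₀ : M) (p w : 𝔼) :
    rnorm ((extChartAt (𝓡 m) x₀).symm p) (chartSymmDerivE x₀ p w) ^ 2 = chartMetric x₀ p w w :=
  (real_inner_self_eq_norm_sq (show TangentSpace (𝓡 m) ((extChartAt (𝓡 m) x₀).symm p) from
    chartSymmDeriv x₀ p w)).symm

variable [IsContMDiffRiemannianBundle (𝓡 m) ∞ (EuclideanSpace ℝ (Fin m))
  (fun x : M => TangentSpace (𝓡 m) x)]

/-- The Riemannian norm and the norm of the coordinates are uniformly equivalent near `x₀`. -/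
lemma exists_rnorm_chart_equiv (x₀ : M) : ∃ C : ℝ, 0 < C ∧ ∀ᶠ p in 𝓝 (extChartAt (𝓡 m) x₀ x₀),
    ∀ w, ‖w‖ ≤ C * rnorm ((extChartAt (𝓡 m) x₀).symm p) (chartSymmDerivE x₀ p w) ∧
      rnorm ((extChartAt (𝓡 m) x₀).symm p) (chartSymmDerivE x₀ p w) ≤ C * ‖w‖ := by
  set p₀ := extChartAt (𝓡 m) x₀ x₀ with hp₀
  have hp : p₀ ∈ (extChartAt (𝓡 m) x₀).target := extChart_mem_target (mem_chart_source 𝔼 x₀)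
  have hcont : ContinuousAt (chartForm x₀) p₀ := (contDiffAt_chartForm hp).continuousAt
  obtain ⟨e, he⟩ := chartForm_isInvertible hp
  -- the metric at `p₀` is positive definite
  have hpos : ∃ c > 0, ∀ w : 𝔼, c * ‖w‖ ^ 2 ≤ chartForm x₀ p₀ w w := by
    rcases (Metric.sphere (0 : 𝔼) 1).eq_empty_or_nonempty with hemp | hne
    · refine ⟨1, one_pos, fun w => ?_⟩
      by_cases hw : w = 0
      · simp [hw]
      · exfalso
        have : ‖w‖⁻¹ • w ∈ Metric.sphere (0 : 𝔼) 1 := by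
          simp [norm_smul, hw]
        rw [hemp] at this
        exact this
    · have hc : ContinuousOn (fun w : 𝔼 => chartForm x₀ p₀ w w) (Metric.sphere 0 1) := by fun_prop
      obtain ⟨w₀, hw₀, hmin⟩ := (isCompact_sphere (0 : 𝔼) 1).exists_isMinOn hne hc
      have hw0 : w₀ ≠ 0 := by
        rintro rfl; simp at hw₀
      refine ⟨chartForm x₀ p₀ w₀ w₀, ?_, fun w => ?_⟩
      · rw [chartForm_apply, ← rnorm_chart_sq]
        refine pow_pos (lt_of_le_of_ne (rnorm_nonneg _ _) fun h => hw0 ?_) 2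
        have h1 : chartSymmDerivE x₀ p₀ w₀ = 0 := eq_zero_of_rnorm_eq_zero h.symm
        have h2 := chartDeriv_chartSymmDerivE hp w₀
        rw [h1, map_zero] at h2
        exact h2.symm
      · by_cases hw : w = 0
        · simp [hw]
        · have h3 : ‖w‖⁻¹ • w ∈ Metric.sphere (0 : 𝔼) 1 := by simp [norm_smul, hw]
          have h4 := hmin h3
          simp only [mem_ofPred_eq, map_smul, smul_apply, smul_eq_mul] at h4
          have h5 : 0 < ‖w‖ := norm_pos_iff.2 hw
          calc chartForm x₀ p₀ w₀ w₀ * ‖w‖ ^ 2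
              ≤ (‖w‖⁻¹ * (‖w‖⁻¹ * chartForm x₀ p₀ w w)) * ‖w‖ ^ 2 := by gcongr
            _ = chartForm x₀ p₀ w w := by field_simp
  obtain ⟨c, hc, hcw⟩ := hpos
  set B := ‖chartForm x₀ p₀‖ + c with hB
  have hB0 : 0 < B := by positivity
  have h1 : ∀ᶠ p in 𝓝 p₀, ‖chartForm x₀ p - chartForm x₀ p₀‖ < c / 2 := by
    have := Metric.tendsto_nhds.1 hcont (c / 2) (by positivity)
    simpa [dist_eq_norm] using this
  refine ⟨max (Real.sqrt (2 / c)) (Real.sqrt B), lt_max_of_lt_right (Real.sqrt_pos.2 hB0), ?_⟩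
  filter_upwards [h1] with p hpp w
  set R := rnorm ((extChartAt (𝓡 m) x₀).symm p) (chartSymmDerivE x₀ p w) with hR
  have hR0 : 0 ≤ R := rnorm_nonneg _ _
  have hR2 : R ^ 2 = chartForm x₀ p w w := rnorm_chart_sq x₀ p w
  have h2 : |chartForm x₀ p w w - chartForm x₀ p₀ w w| ≤ c / 2 * ‖w‖ ^ 2 := by
    calc |chartForm x₀ p w w - chartForm x₀ p₀ w w|
        = ‖(chartForm x₀ p - chartForm x₀ p₀) w w‖ := rfl
      _ ≤ ‖chartForm x₀ p - chartForm x₀ p₀‖ * ‖w‖ * ‖w‖ := ContinuousLinearMap.le_opNorm₂ _ _ _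
      _ ≤ c / 2 * ‖w‖ * ‖w‖ := by gcongr
      _ = _ := by ring
  have h3 : |chartForm x₀ p₀ w w| ≤ ‖chartForm x₀ p₀‖ * ‖w‖ ^ 2 := by
    have := ContinuousLinearMap.le_opNorm₂ (chartForm x₀ p₀) w w
    rw [Real.norm_eq_abs] at this
    linarith [this, sq (‖w‖), mul_assoc (‖chartForm x₀ p₀‖) ‖w‖ ‖w‖]
  have h4 := hcw w
  rw [abs_le] at h2 h3
  constructor
  · have h5 : ‖w‖ ^ 2 ≤ 2 / c * R ^ 2 := by
      rw [hR2, div_mul_eq_mul_div, le_div_iff₀ hc]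
      nlinarith
    have h6 : ‖w‖ ≤ Real.sqrt (2 / c) * R := by
      refine abs_le_of_sq_le_sq' ?_ (by positivity) |>.2
      rw [mul_pow, Real.sq_sqrt (by positivity)]; exact h5
    exact h6.trans (by gcongr; exact le_max_left _ _)
  · have h5 : R ^ 2 ≤ B * ‖w‖ ^ 2 := by
      rw [hR2, hB]; nlinarith [sq_nonneg ‖w‖]
    have h6 : R ≤ Real.sqrt B * ‖w‖ := by
      refine abs_le_of_sq_le_sq' ?_ (by positivity) |>.2
      rw [mul_pow, Real.sq_sqrt hB0.le]; exact h5
    exact h6.trans (by gcongr; exact le_max_right _ _)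

end TangentNorm

/-! ### Lipschitz bounds for the Riemannian distance -/

section LocalLipschitz

variable {m : ℕ} {M : Type*} [EMetricSpace M] [ChartedSpace (EuclideanSpace ℝ (Fin m)) M]
  [IsManifold (𝓡 m) ∞ M] [RiemannianBundle (fun x : M => TangentSpace (𝓡 m) x)]

local notation "𝔼" => EuclideanSpace ℝ (Fin m)

lemma mfderiv_chart_symm_curve {x₀ : M} {u : ℝ → 𝔼} {w : 𝔼} {t : ℝ} (hu : HasDerivAt u w t)
    (hut : u t ∈ (extChartAt (𝓡 m) x₀).target) :
    (mfderiv 𝓘(ℝ, ℝ) (𝓡 m) ((extChartAt (𝓡 m) x₀).symm ∘ u) t : ℝ →L[ℝ] 𝔼) (1 : ℝ)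
      = chartSymmDerivE x₀ (u t) w := by
  have h1 := mfderiv_comp t (I := 𝓘(ℝ, ℝ)) (I' := 𝓘(ℝ, 𝔼)) (I'' := 𝓡 m)
    (mdifferentiableAt_chart_symm hut) hu.differentiableAt.mdifferentiableAt
  have h4 : (mfderiv 𝓘(ℝ, ℝ) (𝓡 m) ((extChartAt (𝓡 m) x₀).symm ∘ u) t : ℝ →L[ℝ] 𝔼)
    = chartSymmDerivE x₀ (u t) ∘L (mfderiv 𝓘(ℝ, ℝ) 𝓘(ℝ, 𝔼) u t : ℝ →L[ℝ] 𝔼) := h1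
  have h6 : (mfderiv 𝓘(ℝ, ℝ) 𝓘(ℝ, 𝔼) u t : ℝ →L[ℝ] 𝔼) (1 : ℝ) = w := by
    rw [mfderiv_eq_fderiv, hu.hasFDerivAt.fderiv]
    exact one_smul ℝ w
  rw [h4, ← h6]
  rfl

lemma enorm_tangent_eq (x : M) (v : TangentSpace (𝓡 m) x) : ‖v‖ₑ = ENNReal.ofReal (rnorm x v) :=
  (ofReal_norm v).symm

variable [IsContMDiffRiemannianBundle (𝓡 m) ∞ (EuclideanSpace ℝ (Fin m))
  (fun x : M => TangentSpace (𝓡 m) x)] [IsRiemannianManifold (𝓡 m) M]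

/-- Charts have locally Lipschitz inverses. -/
lemma exists_edist_chart_symm_le (x₀ : M) : ∃ C : ℝ, 0 < C ∧ ∃ r > 0,
    Metric.ball (extChartAt (𝓡 m) x₀ x₀) r ⊆ (extChartAt (𝓡 m) x₀).target ∧
    ∀ p ∈ Metric.ball (extChartAt (𝓡 m) x₀ x₀) r, ∀ q ∈ Metric.ball (extChartAt (𝓡 m) x₀ x₀) r,
      edist ((extChartAt (𝓡 m) x₀).symm p) ((extChartAt (𝓡 m) x₀).symm q)
        ≤ ENNReal.ofReal (C * ‖q - p‖) := by
  obtain ⟨C, hC, h⟩ := exists_rnorm_chart_equiv (m := m) x₀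
  have hp : extChartAt (𝓡 m) x₀ x₀ ∈ (extChartAt (𝓡 m) x₀).target :=
    extChart_mem_target (mem_chart_source 𝔼 x₀)
  obtain ⟨r, hr, hball⟩ := Metric.eventually_nhds_iff_ball.1
    (h.and ((isOpen_chart_target x₀).eventually_mem hp))
  refine ⟨C, hC, r, hr, fun p hp => (hball p hp).2, fun p hp q hq => ?_⟩
  set u : ℝ → 𝔼 := fun t => p + t • (q - p) with hu
  have hud : ∀ t, HasDerivAt u (q - p) t := fun t => by
    have h := ((hasDerivAt_id t).smul_const (q - p)).const_add p
    rwa [one_smul] at h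
  have hub : ∀ t ∈ Icc (0 : ℝ) 1, u t ∈ Metric.ball (extChartAt (𝓡 m) x₀ x₀) r := fun t ht =>
    (convex_ball (extChartAt (𝓡 m) x₀ x₀) r).add_smul_sub_mem hp hq ht
  have hcont : ContMDiffOn 𝓘(ℝ, ℝ) (𝓡 m) 1 ((extChartAt (𝓡 m) x₀).symm ∘ u) (Icc 0 1) := by
    refine ((contMDiffOn_extChartAt_symm x₀).of_le (by norm_cast)).comp (n := 1)
      (t := (extChartAt (𝓡 m) x₀).target) (f := u) ?_ fun t ht => (hball _ (hub t ht)).2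
    exact (contMDiff_iff_contDiff.2 (by fun_prop)).contMDiffOn
  have h1 := riemannianEDist_le_pathELength (I := 𝓡 m) hcont rfl rfl zero_le_one
  have h0 : u 0 = p := by simp [hu]
  have h0' : u 1 = q := by simp [hu]
  simp only [Function.comp_apply, h0, h0'] at h1
  rw [IsRiemannianManifold.out (I := 𝓡 m)]
  refine h1.trans ?_
  rw [pathELength_eq_lintegral_mfderiv_Icc]
  calc _ ≤ ∫⁻ t in Icc (0 : ℝ) 1, ENNReal.ofReal (C * ‖q - p‖) := by
        refine MeasureTheory.setLIntegral_mono' measurableSet_Icc fun t ht => ?_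
        rw [enorm_tangent_eq]
        refine ENNReal.ofReal_le_ofReal ?_
        have h2 := ((hball _ (hub t ht)).1 (q - p)).2
        rw [← mfderiv_chart_symm_curve (hud t) (hball _ (hub t ht)).2] at h2
        exact h2
    _ = _ := by simp

/-- A `C^1` function is locally Lipschitz for the Riemannian distance. -/
lemma exists_edist_le_of_contMDiffOn {G : Type*} [NormedAddCommGroup G] [NormedSpace ℝ G]
    [CompleteSpace G] {F : M → G} {x₀ : M} {r C : ℝ} (hr : 0 < r)
    (hF : ContMDiffOn (𝓡 m) 𝓘(ℝ, G) 1 F (rBall x₀ r))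
    (hC : ∀ x ∈ rBall x₀ r, ∀ v : 𝔼, ‖tderiv F x v‖ ≤ C * rnorm (m := m) x v) (hC0 : 0 ≤ C) {y z : M}
    (hy : y ∈ rBall x₀ (r / 2)) (hyz : edist y z < ENNReal.ofReal (r / 2)) :
    edist (F y) (F z) ≤ ENNReal.ofReal C * edist y z := by
  have hopen : IsOpen (rBall x₀ r) := Metric.isOpen_eball
  have key : ∀ R, edist y z < R → R < ENNReal.ofReal (r / 2) →
      edist (F y) (F z) ≤ ENNReal.ofReal C * R := by
    intro R h1 h2
    rw [IsRiemannianManifold.out (I := 𝓡 m)] at h1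
    obtain ⟨γ, h3, h4, h5, h6⟩ := exists_lt_of_riemannianEDist_lt h1
    have h7 : ∀ t ∈ Icc (0 : ℝ) 1, γ t ∈ rBall x₀ r := by
      intro t ht
      have h8 : edist y (γ t) < ENNReal.ofReal (r / 2) := by
        rw [IsRiemannianManifold.out (I := 𝓡 m)]
        refine lt_of_le_of_lt ?_ (h6.trans h2)
        refine (riemannianEDist_le_pathELength (h5.mono (Icc_subset_Icc_right ht.2)) h3 rfl
          ht.1).trans (pathELength_mono le_rfl ht.2)
      have h9 : edist (γ t) x₀ < ENNReal.ofReal (r / 2) + ENNReal.ofReal (r / 2) := by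
        refine lt_of_le_of_lt (edist_triangle _ y _) (ENNReal.add_lt_add ?_ hy)
        rwa [edist_comm]
      rwa [← ENNReal.ofReal_add (by positivity) (by positivity), add_halves] at h9
    have h8 : ContDiffOn ℝ 1 (F ∘ γ) (Icc 0 1) := by
      rw [← contMDiffOn_iff_contDiffOn]
      exact hF.comp h5 h7
    have h9 := enorm_sub_le_lintegral_deriv_of_contDiffOn_Icc h8 zero_le_one
    simp only [Function.comp_apply, h3, h4] at h9
    rw [← MeasureTheory.restrict_Ioo_eq_restrict_Icc] at h9
    rw [edist_comm, edist_eq_enorm_sub]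
    refine h9.trans ?_
    calc _ ≤ ∫⁻ t in Ioo (0 : ℝ) 1, ENNReal.ofReal C * ‖mfderiv 𝓘(ℝ, ℝ) (𝓡 m) γ t 1‖ₑ := by
          refine MeasureTheory.setLIntegral_mono' measurableSet_Ioo fun t ht => ?_
          have hn : Icc (0 : ℝ) 1 ∈ 𝓝 t := Icc_mem_nhds ht.1 ht.2
          have ht' := Ioo_subset_Icc_self ht
          have e1 : MDifferentiableAt 𝓘(ℝ, ℝ) (𝓡 m) γ t :=
            (h5.contMDiffAt hn).mdifferentiableAt one_ne_zero
          have e2 : MDifferentiableAt (𝓡 m) 𝓘(ℝ, G) F (γ t) :=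
            (hF.contMDiffAt (hopen.mem_nhds (h7 t ht'))).mdifferentiableAt one_ne_zero
          have e3 := mfderiv_comp t e2 e1
          have e4 : deriv (F ∘ γ) t
              = tderiv F (γ t) ((mfderiv 𝓘(ℝ, ℝ) (𝓡 m) γ t : ℝ →L[ℝ] 𝔼) (1 : ℝ)) := by
            rw [← fderiv_apply_one_eq_deriv, ← mfderiv_eq_fderiv]
            exact congrArg (fun T : ℝ →L[ℝ] G => T 1) e3
          rw [enorm_tangent_eq, ← ENNReal.ofReal_mul hC0, ← ofReal_norm, e4]
          exact ENNReal.ofReal_le_ofReal (hC _ (h7 t ht') _)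
      _ = ENNReal.ofReal C * pathELength (𝓡 m) γ 0 1 := by
          rw [pathELength_eq_lintegral_mfderiv_Ioo,
            MeasureTheory.lintegral_const_mul' _ _ ENNReal.ofReal_ne_top]
      _ ≤ _ := by gcongr
  have : (𝓝[>] (edist y z)).NeBot := nhdsGT_neBot_of_exists_gt ⟨_, hyz⟩
  have h1 : Tendsto (fun R => ENNReal.ofReal C * R) (𝓝[>] (edist y z))
      (𝓝 (ENNReal.ofReal C * edist y z)) :=
    (ENNReal.Tendsto.const_mul tendsto_id (Or.inr ENNReal.ofReal_ne_top)).mono_left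
      nhdsWithin_le_nhds
  refine ge_of_tendsto h1 ?_
  filter_upwards [self_mem_nhdsWithin, nhdsWithin_le_nhds (eventually_lt_nhds hyz)] with R h2 h3
  exact key R h2 h3

end LocalLipschitz

/-! ### The exponential map near the zero section -/

section ExpLocal

variable {m : ℕ} {M : Type*} [EMetricSpace M] [ChartedSpace (EuclideanSpace ℝ (Fin m)) M]
  [IsManifold (𝓡 m) ∞ M] [RiemannianBundle (fun x : M => TangentSpace (𝓡 m) x)]

local notation "𝔼" => EuclideanSpace ℝ (Fin m)

lemma isExp_zero (x : M) : IsExp x (0 : TangentSpace (𝓡 m) x) x := by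
  refine ⟨fun _ => x, 1, one_pos, ⟨continuousOn_const, fun x₀ t _ _ => ?_⟩, ?_, rfl⟩
  · refine ⟨fun _ => 0, 0, Eventually.of_forall fun u => hasDerivAt_const _ _,
      hasDerivAt_const _ _, fun w => ?_⟩
    have h : ∀ p w : 𝔼, chartMetric x₀ p 0 w = 0 := fun p w => by
      simp only [chartMetric_eq, map_zero]; exact inner_zero_left _
    simp [h]
  · rw [mfderiv_const]; rfl

lemma expMap_eq_of_iff {x : M} {v : TangentSpace (𝓡 m) x} {z : M} (h : ∀ y, IsExp x v y ↔ y = z) :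
    expMap x v = z := by
  have h1 : ∃ y, IsExp x v y := ⟨z, (h z).2 rfl⟩
  rw [expMap, dif_pos h1]
  exact (h _).1 h1.choose_spec

variable [IsContMDiffRiemannianBundle (𝓡 m) ∞ (EuclideanSpace ℝ (Fin m))
  (fun x : M => TangentSpace (𝓡 m) x)]

/-- The map `expMap` in a chart, near the zero vector at `x₀`, where geodesics exist and are unique;
in particular the default value in the definition of `expMap` plays no role there. -/
lemma exists_expMap_chart (x₀ : M) : ∃ Ex : 𝔼 × 𝔼 → 𝔼,
    ContDiffAt ℝ 1 Ex (extChartAt (𝓡 m) x₀ x₀, 0) ∧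
    HasFDerivAt Ex (.fst ℝ 𝔼 𝔼 + .snd ℝ 𝔼 𝔼) (extChartAt (𝓡 m) x₀ x₀, 0) ∧
    Ex (extChartAt (𝓡 m) x₀ x₀, 0) = extChartAt (𝓡 m) x₀ x₀ ∧
    ∀ᶠ z in 𝓝 (extChartAt (𝓡 m) x₀ x₀, (0 : 𝔼)), z.1 ∈ (extChartAt (𝓡 m) x₀).target ∧
      Ex z ∈ (extChartAt (𝓡 m) x₀).target ∧ Ex (z.1, 0) = z.1 ∧
      (∃! y, IsExp ((extChartAt (𝓡 m) x₀).symm z.1) (chartSymmDerivE x₀ z.1 z.2) y) ∧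
      expMap (m := m) ((extChartAt (𝓡 m) x₀).symm z.1) (chartSymmDerivE x₀ z.1 z.2)
        = (extChartAt (𝓡 m) x₀).symm (Ex z) := by
  obtain ⟨Ex, h1, h2, h3, h4⟩ := exists_chart_exp (m := m) x₀
  refine ⟨Ex, h1, h2, h3, ?_⟩
  have h5 : Tendsto (fun z : 𝔼 × 𝔼 => (z.1, (0 : 𝔼))) (𝓝 (extChartAt (𝓡 m) x₀ x₀, 0))
      (𝓝 (extChartAt (𝓡 m) x₀ x₀, 0)) :=
    Continuous.tendsto' (by fun_prop) _ _ rfl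
  filter_upwards [h4, h5.eventually h4] with z hz hz0
  refine ⟨hz.1, hz.2.1, ?_, ⟨_, (hz.2.2 _).2 rfl, fun y hy => (hz.2.2 y).1 hy⟩,
    expMap_eq_of_iff hz.2.2⟩
  have h6 : (extChartAt (𝓡 m) x₀).symm z.1 = (extChartAt (𝓡 m) x₀).symm (Ex (z.1, 0)) := by
    refine (hz0.2.2 _).1 ?_
    have := isExp_zero (m := m) ((extChartAt (𝓡 m) x₀).symm z.1)
    rwa [← map_zero (chartSymmDeriv x₀ z.1)] at this
  have h7 := congrArg (extChartAt (𝓡 m) x₀) h6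
  rw [chart_chart_symm hz.1, chart_chart_symm hz0.2.1] at h7
  exact h7.symm

/-- A property of tangent vectors that holds near the zero vector at `x₀` holds for all vectors of
Riemannian norm less than a constant, at all points near `x₀`. -/
lemma exists_eventually_of_rnorm_lt {x₀ : M} {Q : 𝔼 × 𝔼 → Prop}
    (hQ : ∀ᶠ z in 𝓝 (extChartAt (𝓡 m) x₀ x₀, (0 : 𝔼)), Q z) :
    ∃ ρ > 0, ∀ᶠ p in 𝓝 (extChartAt (𝓡 m) x₀ x₀), ∀ w,
      rnorm ((extChartAt (𝓡 m) x₀).symm p) (chartSymmDerivE x₀ p w) < ρ → Q (p, w) := by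
  obtain ⟨C, hC, h⟩ := exists_rnorm_chart_equiv (m := m) x₀
  rw [nhds_prod_eq] at hQ
  obtain ⟨Pa, ha, Pb, hb, hab⟩ := eventually_prod_iff.1 hQ
  obtain ⟨r, hr, hb⟩ := Metric.eventually_nhds_iff_ball.1 hb
  refine ⟨r / C, by positivity, ?_⟩
  filter_upwards [h, ha] with p hp hpa w hw
  refine hab hpa (hb w ?_)
  rw [mem_ball_zero_iff]
  refine (hp w).1.trans_lt ?_
  rwa [lt_div_iff₀ hC, mul_comm] at hw

/-- To prove a statement about all small tangent vectors near `x₀` one may write base point and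
vector in the chart at `x₀`. -/
lemma eventually_tangent_of_chart {x₀ : M} {Q : ℝ → M → 𝔼 → Prop} {ρ : ℝ}
    (h : ∀ᶠ p in 𝓝 (extChartAt (𝓡 m) x₀ x₀), p ∈ (extChartAt (𝓡 m) x₀).target → ∀ w,
      rnorm ((extChartAt (𝓡 m) x₀).symm p) (chartSymmDerivE x₀ p w) < ρ →
      Q ρ ((extChartAt (𝓡 m) x₀).symm p) (chartSymmDerivE x₀ p w)) :
    ∀ᶠ x in 𝓝 x₀, ∀ v : 𝔼, rnorm x v < ρ → Q ρ x v := by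
  refine eventually_of_chart (h.mono fun p hp hpt v hv => ?_)
  have := hp hpt (chartDeriv x₀ ((extChartAt (𝓡 m) x₀).symm p) v)
  rw [chartSymmDerivE_chartDeriv hpt] at this
  exact this hv

lemma exists_existsUnique_isExp [CompactSpace M] : ∃ ρ > 0, ∀ (x : M) (v : 𝔼), rnorm x v < ρ →
    ∃! y, IsExp x v y := by
  refine exists_pos_forall_of_locally (P := fun ρ (x : M) => ∀ v : 𝔼, rnorm x v < ρ →
    ∃! y, IsExp x v y) (fun x ρ ρ' _ h hP v hv => hP v (hv.trans_le h)) fun x₀ => ?_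
  obtain ⟨Ex, -, -, -, h⟩ := exists_expMap_chart (m := m) x₀
  obtain ⟨ρ, hρ, h⟩ := exists_eventually_of_rnorm_lt h
  exact ⟨ρ, hρ, eventually_tangent_of_chart (Q := fun _ x v => ∃! y, IsExp x v y)
    (h.mono fun p hp _ w hw => (hp w hw).2.2.2.1)⟩

lemma expMap_zero [CompactSpace M] (x : M) : expMap x (0 : TangentSpace (𝓡 m) x) = x := by
  obtain ⟨ρ, hρ, h⟩ := exists_existsUnique_isExp (m := m) (M := M)
  have h0 : rnorm x (0 : TangentSpace (𝓡 m) x) < ρ := by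
    rw [rnorm, norm_zero]; exact hρ
  obtain ⟨y, -, hy⟩ := h x 0 h0
  exact expMap_eq_of_iff fun z => ⟨fun hz => (hy z hz).trans (hy x (isExp_zero x)).symm,
    fun hz => hz ▸ isExp_zero x⟩

lemma exists_contMDiffAt_expMap [CompactSpace M] : ∃ ρ > 0, ∀ (x : M) (v : 𝔼), rnorm x v < ρ →
    ContMDiffAt 𝓘(ℝ, 𝔼) (𝓡 m) 1 (fun v : 𝔼 => expMap x v) v := by
  refine exists_pos_forall_of_locally (P := fun ρ (x : M) => ∀ v : 𝔼, rnorm x v < ρ →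
    ContMDiffAt 𝓘(ℝ, 𝔼) (𝓡 m) 1 (fun v : 𝔼 => expMap x v) v)
    (fun x ρ ρ' _ h hP v hv => hP v (hv.trans_le h)) fun x₀ => ?_
  obtain ⟨Ex, h1, -, -, h⟩ := exists_expMap_chart (m := m) x₀
  have h2 := h1.eventually (by simp)
  obtain ⟨ρ, hρ, h⟩ := exists_eventually_of_rnorm_lt (h2.and h.eventually_nhds)
  refine ⟨ρ, hρ, eventually_tangent_of_chart (Q := fun _ x v =>
    ContMDiffAt 𝓘(ℝ, 𝔼) (𝓡 m) 1 (fun v : 𝔼 => expMap x v) v)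
    (h.mono fun p hp hpt w hw => ?_)⟩
  obtain ⟨h3, h4⟩ := hp w hw
  set v : 𝔼 := chartSymmDerivE x₀ p w with hv
  set K : 𝔼 →L[ℝ] 𝔼 := chartDeriv (m := m) x₀ ((extChartAt (𝓡 m) x₀).symm p) with hK
  have hKv : K v = w := chartDeriv_chartSymmDerivE hpt w
  have h5 : Tendsto (fun v => (p, K v)) (𝓝 v) (𝓝 (p, w)) :=
    Continuous.tendsto' (by fun_prop) _ _ (by rw [hKv])
  have h6 : (fun v : 𝔼 => expMap (m := m) ((extChartAt (𝓡 m) x₀).symm p) v) =ᶠ[𝓝 v]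
      fun v => (extChartAt (𝓡 m) x₀).symm (Ex (p, K v)) :=
    (h5.eventually h4).mono fun v' hv' => by
      have := hv'.2.2.2.2
      simp only [hK, chartSymmDerivE_chartDeriv hpt] at this
      exact this
  refine ContMDiffAt.congr_of_eventuallyEq ?_ h6
  have h7 : ContDiffAt ℝ 1 (fun v => Ex (p, K v)) v := by
    refine ContDiffAt.comp v (g := Ex) (f := fun v => (p, K v)) (by rwa [hKv]) ?_
    exact contDiffAt_const.prodMk K.contDiff.contDiffAt
  refine ContMDiffAt.comp v ((contMDiffAt_chart_symm ?_).of_le (by norm_cast)) h7.contMDiffAt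
  rw [hKv]; exact h4.self_of_nhds.2.1

lemma exists_edist_expMap_le [CompactSpace M] [IsRiemannianManifold (𝓡 m) M] :
    ∃ ρ > 0, ∀ (x : M) (v : 𝔼), rnorm x v < ρ →
      edist (expMap x v) x ≤ ENNReal.ofReal (ρ⁻¹ * rnorm x v) := by
  refine exists_pos_forall_of_locally (P := fun ρ (x : M) => ∀ v : 𝔼, rnorm x v < ρ →
    edist (expMap x v) x ≤ ENNReal.ofReal (ρ⁻¹ * rnorm x v))
    (fun x ρ ρ' h0 h hP v hv => (hP v (hv.trans_le h)).trans (ENNReal.ofReal_le_ofReal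
      (mul_le_mul_of_nonneg_right (inv_anti₀ h0 h) (rnorm_nonneg _ _)))) fun x₀ => ?_
  obtain ⟨Ex, h1, h2, h3, h⟩ := exists_expMap_chart (m := m) x₀
  obtain ⟨C, hC, hC'⟩ := exists_rnorm_chart_equiv (m := m) x₀
  obtain ⟨C₂, hC₂, r, hr, -, hlip⟩ := exists_edist_chart_symm_le (m := m) x₀
  obtain ⟨K, U, hU, hK⟩ := h1.exists_lipschitzOnWith
  have h0 : Tendsto (fun z : 𝔼 × 𝔼 => (z.1, (0 : 𝔼))) (𝓝 (extChartAt (𝓡 m) x₀ x₀, 0))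
      (𝓝 (extChartAt (𝓡 m) x₀ x₀, 0)) := Continuous.tendsto' (by fun_prop) _ _ rfl
  have hExc : Tendsto Ex (𝓝 (extChartAt (𝓡 m) x₀ x₀, 0)) (𝓝 (extChartAt (𝓡 m) x₀ x₀)) := by
    have := h1.continuousAt.tendsto; rwa [h3] at this
  have hfst : Tendsto (fun z : 𝔼 × 𝔼 => z.1) (𝓝 (extChartAt (𝓡 m) x₀ x₀, 0))
      (𝓝 (extChartAt (𝓡 m) x₀ x₀)) := Continuous.tendsto' (by fun_prop) _ _ rfl
  have hall := h.and ((eventually_mem_set.2 hU).and ((h0.eventually (eventually_mem_set.2 hU)).and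
    ((hExc.eventually (Metric.ball_mem_nhds _ hr)).and
      (hfst.eventually (Metric.ball_mem_nhds _ hr)))))
  obtain ⟨ρ, hρ, h⟩ := exists_eventually_of_rnorm_lt hall
  set B := C₂ * (K + 1) * C with hB
  have hB0 : 0 < B := by positivity
  refine ⟨min ρ B⁻¹, by positivity, eventually_tangent_of_chart (Q := fun ρ x v =>
    edist (expMap x v) x ≤ ENNReal.ofReal (ρ⁻¹ * rnorm x v)) ?_⟩
  filter_upwards [h, hC'] with p hp hp' hpt w hw
  obtain ⟨h4, h5, h6, h7, h8⟩ := hp w (hw.trans_le (min_le_left _ _))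
  rw [h4.2.2.2.2, edist_comm]
  refine (hlip p h8 _ h7).trans (ENNReal.ofReal_le_ofReal ?_)
  have h9 : ‖Ex (p, w) - p‖ ≤ K * ‖w‖ := by
    have := hK.dist_le_mul _ h5 _ h6
    have h4' : Ex (p, 0) = p := h4.2.2.1
    rw [h4', dist_eq_norm, dist_eq_norm] at this
    simpa [Prod.norm_def] using this
  set R := rnorm ((extChartAt (𝓡 m) x₀).symm p) (chartSymmDerivE x₀ p w)
  have hR : 0 ≤ R := rnorm_nonneg _ _
  calc C₂ * ‖Ex (p, w) - p‖ ≤ C₂ * ((K + 1) * (C * R)) := by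
        gcongr
        exact h9.trans (mul_le_mul (by simp) (hp' w).1 (norm_nonneg _) (by positivity))
    _ = B * R := by rw [hB]; ring
    _ ≤ (min ρ B⁻¹)⁻¹ * R := by
        gcongr
        rw [le_inv_comm₀ hB0 (by positivity)]
        exact min_le_right _ _

/-- A `C^1` function `F`, composed with the exponential map at `x`, differs from the derivative of
`F` at `x` by a map with a small Lipschitz constant, uniformly for `x` near `x₀`. -/
lemma exists_norm_comp_expMap_sub_le {G : Type*} [NormedAddCommGroup G] [NormedSpace ℝ G]
    {F : M → G} {x₀ : M} (hF : ContMDiffAt (𝓡 m) 𝓘(ℝ, G) 1 F x₀) {η : ℝ} (hη : 0 < η) :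
    ∃ ρ > 0, ∀ᶠ x in 𝓝 x₀, ∀ v v' : 𝔼, rnorm x v < ρ → rnorm x v' < ρ →
      ‖F (expMap x v) - F (expMap x v') - tderiv F x (v - v')‖ ≤ η * rnorm x (v - v') := by
  obtain ⟨Ex, h1, h2, h3, h⟩ := exists_expMap_chart (m := m) x₀
  obtain ⟨C, hC, hC'⟩ := exists_rnorm_chart_equiv (m := m) x₀
  set p₀ := extChartAt (𝓡 m) x₀ x₀ with hp₀
  have hsrc := mem_chart_source 𝔼 x₀
  have hp₀t : p₀ ∈ (extChartAt (𝓡 m) x₀).target := extChart_mem_target hsrc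
  set G₀ := F ∘ (extChartAt (𝓡 m) x₀).symm with hG₀
  have hF0 : ContMDiffAt (𝓡 m) 𝓘(ℝ, G) 1 F ((extChartAt (𝓡 m) x₀).symm p₀) := by
    rwa [hp₀, chart_symm_chart hsrc]
  have hGc : ContDiffAt ℝ 1 G₀ p₀ := contDiffAt_comp_chart_symm hp₀t hF0
  have hcomp : ContDiffAt ℝ 1 (fun z => G₀ (Ex z)) (p₀, 0) :=
    ContDiffAt.comp (p₀, (0 : 𝔼)) (g := G₀) (f := Ex) (by rwa [h3]) h1
  have hder : HasFDerivAt (fun z => G₀ (Ex z))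
      (fderiv ℝ G₀ p₀ ∘L (.fst ℝ 𝔼 𝔼 + .snd ℝ 𝔼 𝔼)) (p₀, 0) :=
    HasFDerivAt.comp (p₀, (0 : 𝔼)) (g := G₀) (f := Ex)
      (by rw [h3]; exact (hGc.differentiableAt one_ne_zero).hasFDerivAt) h2
  have hstrict : HasStrictFDerivAt (fun z => G₀ (Ex z))
      (fderiv ℝ G₀ p₀ ∘L (.fst ℝ 𝔼 𝔼 + .snd ℝ 𝔼 𝔼)) (p₀, 0) :=
    hcomp.hasStrictFDerivAt' hder one_ne_zero
  have hη' : 0 < η / (2 * C) := by positivity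
  have hst := hstrict.isLittleO.def hη'
  rw [nhds_prod_eq] at hst
  obtain ⟨U, hU, hUst⟩ := (eventually_prod_self_iff (r := fun z z' : 𝔼 × 𝔼 =>
    ‖G₀ (Ex z) - G₀ (Ex z') - (fderiv ℝ G₀ p₀ ∘L (.fst ℝ 𝔼 𝔼 + .snd ℝ 𝔼 𝔼)) (z - z')‖
      ≤ η / (2 * C) * ‖z - z'‖)).1 hst
  obtain ⟨ρ, hρ, hh⟩ := exists_eventually_of_rnorm_lt (h.and (eventually_mem_set.2 hU))
  have hdF : ∀ᶠ p in 𝓝 p₀, ‖fderiv ℝ G₀ p - fderiv ℝ G₀ p₀‖ < η / (2 * C) := by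
    have h5 : ContinuousAt (fderiv ℝ G₀) p₀ :=
      (hGc.fderiv_right (m := 0) (by simp)).continuousAt
    simpa [dist_eq_norm] using Metric.tendsto_nhds.1 h5 _ hη'
  have hFd : ∀ᶠ p in 𝓝 p₀, ContMDiffAt (𝓡 m) 𝓘(ℝ, G) 1 F ((extChartAt (𝓡 m) x₀).symm p) :=
    (contMDiffAt_chart_symm (m := m) (x₀ := x₀) hp₀t).continuousAt.eventually
      ((contMDiffAt_iff_contMDiffAt_nhds (by simp)).1 hF0)
  refine ⟨ρ, hρ, eventually_of_chart (m := m) ?_⟩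
  filter_upwards [hh, hC', hdF, hFd] with p hp hpC hpd hpF hpt v v' hv hv'
  obtain ⟨w, rfl⟩ : ∃ w, chartSymmDerivE x₀ p w = v := ⟨_, chartSymmDerivE_chartDeriv hpt v⟩
  obtain ⟨w', rfl⟩ : ∃ w, chartSymmDerivE x₀ p w = v' := ⟨_, chartSymmDerivE_chartDeriv hpt v'⟩
  obtain ⟨e1, e2⟩ := hp w hv
  obtain ⟨e1', e2'⟩ := hp w' hv'
  have e3 := hUst (p, w) e2 (p, w') e2'
  have e4 : tderiv F ((extChartAt (𝓡 m) x₀).symm p) (chartSymmDerivE x₀ p (w - w'))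
      = fderiv ℝ G₀ p (w - w') :=
    congrArg (fun T : 𝔼 →L[ℝ] G => T (w - w'))
      (tderiv_chart_symm hpt (hpF.mdifferentiableAt one_ne_zero))
  have e5 := hpC (w - w')
  rw [map_sub] at e4 e5
  rw [e1.2.2.2.2, e1'.2.2.2.2, e4]
  have e6 : ‖G₀ (Ex (p, w)) - G₀ (Ex (p, w')) - fderiv ℝ G₀ p₀ (w - w')‖
      ≤ η / (2 * C) * ‖w - w'‖ := by
    simpa [Prod.norm_def] using e3
  have e7 : ‖(fderiv ℝ G₀ p - fderiv ℝ G₀ p₀) (w - w')‖ ≤ η / (2 * C) * ‖w - w'‖ :=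
    (ContinuousLinearMap.le_opNorm _ _).trans (by gcongr)
  have e8 : F ((extChartAt (𝓡 m) x₀).symm (Ex (p, w))) - F ((extChartAt (𝓡 m) x₀).symm (Ex (p, w')))
      - fderiv ℝ G₀ p (w - w') = (G₀ (Ex (p, w)) - G₀ (Ex (p, w')) - fderiv ℝ G₀ p₀ (w - w'))
        - (fderiv ℝ G₀ p - fderiv ℝ G₀ p₀) (w - w') := by
    simp only [hG₀, Function.comp_apply, sub_apply]; abel
  rw [e8]
  refine (norm_sub_le _ _).trans ((add_le_add e6 e7).trans ?_)
  calc η / (2 * C) * ‖w - w'‖ + η / (2 * C) * ‖w - w'‖ = η / C * ‖w - w'‖ := by field_simp; ring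
    _ ≤ η / C * (C * _) := by gcongr; exact e5.1
    _ = _ := by field_simp

end ExpLocal

/-! ### Tangent vectors as elements of an ambient Euclidean space -/

section Immersion

variable {m : ℕ} {M : Type*} [EMetricSpace M] [ChartedSpace (EuclideanSpace ℝ (Fin m)) M]
  {V : Type*} [NormedAddCommGroup V] [InnerProductSpace ℝ V] [FiniteDimensional ℝ V]
  {G : Type*} [NormedAddCommGroup G] [NormedSpace ℝ G]

local notation "𝔼" => EuclideanSpace ℝ (Fin m)

/-- `e` is a `C^1` immersion of `M` into a vector space. -/
structure IsC1Immersion (e : M → V) : Prop where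
  contMDiff : ContMDiff (𝓡 m) 𝓘(ℝ, V) 1 e
  injective : ∀ x, Function.Injective (tderiv (m := m) e x)

/-- The left inverse of the derivative of an immersion. -/
def embInv (e : M → V) (x : M) : V →L[ℝ] 𝔼 := pinv (tderiv e x)

/-- The derivative of a function on `M`, with tangent vectors regarded as elements of `V` by means
of the immersion `e`, and extended by zero to the normal space. -/
def vderiv (m : ℕ) [ChartedSpace (EuclideanSpace ℝ (Fin m)) M] (e : M → V) (F : M → G) (x : M) :
    V →L[ℝ] G :=
  tderiv (m := m) F x ∘L embInv e x

lemma IsC1Immersion.embInv_tderiv {e : M → V} (he : IsC1Immersion (m := m) e) (x : M) (t : 𝔼) :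
    embInv e x (tderiv e x t) = t :=
  congrArg (fun T : 𝔼 →L[ℝ] 𝔼 => T t) (pinv_comp_self (he.injective x))

lemma IsC1Immersion.vderiv_tderiv {e : M → V} (he : IsC1Immersion (m := m) e) (F : M → G) (x : M)
    (t : 𝔼) : vderiv m e F x (tderiv e x t) = tderiv F x t := by
  rw [vderiv, ContinuousLinearMap.comp_apply, he.embInv_tderiv]

lemma vderiv_apply (e : M → V) (F : M → G) (x : M) (v : V) :
    vderiv m e F x v = tderiv (m := m) F x (embInv e x v) := rfl

variable [IsManifold (𝓡 m) ∞ M]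

lemma IsC1Immersion.vderiv_comp {e : M → V} (he : IsC1Immersion (m := m) e) {F : M → G}
    {f : M → M} {x : M} (hf : MDifferentiableAt (𝓡 m) (𝓡 m) f x)
    (hF : MDifferentiableAt (𝓡 m) 𝓘(ℝ, G) F (f x)) :
    vderiv m e (F ∘ f) x = vderiv m e F (f x) ∘L vderiv m e (e ∘ f) x := by
  have h1 := mfderiv_comp x hF hf
  have h2 := mfderiv_comp x ((he.contMDiff (f x)).mdifferentiableAt one_ne_zero) hf
  set T : 𝔼 →L[ℝ] 𝔼 := mfderiv (𝓡 m) (𝓡 m) f x with hT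
  have h1' : tderiv (F ∘ f) x = tderiv F (f x) ∘L T := h1
  have h2' : tderiv (e ∘ f) x = tderiv e (f x) ∘L T := h2
  ext v
  simp only [vderiv, ContinuousLinearMap.comp_apply, h1', h2', he.embInv_tderiv]

lemma IsC1Immersion.injective_chart {e : M → V} (he : IsC1Immersion (m := m) e) {x₀ : M} {p : 𝔼}
    (hp : p ∈ (extChartAt (𝓡 m) x₀).target) :
    Function.Injective (fderiv ℝ (e ∘ (extChartAt (𝓡 m) x₀).symm) p) := by
  rw [← tderiv_chart_symm hp ((he.contMDiff _).mdifferentiableAt one_ne_zero)]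
  refine (he.injective _).comp ?_
  exact Function.LeftInverse.injective (chartDeriv_chartSymmDerivE hp)

lemma IsC1Immersion.embInv_chart {e : M → V} (he : IsC1Immersion (m := m) e) {x₀ : M} {p : 𝔼}
    (hp : p ∈ (extChartAt (𝓡 m) x₀).target) :
    embInv e ((extChartAt (𝓡 m) x₀).symm p)
      = chartSymmDerivE x₀ p ∘L pinv (fderiv ℝ (e ∘ (extChartAt (𝓡 m) x₀).symm) p) := by
  let K : 𝔼 ≃L[ℝ] 𝔼 := ContinuousLinearEquiv.equivOfInverse
    (chartDeriv x₀ ((extChartAt (𝓡 m) x₀).symm p)) (chartSymmDerivE x₀ p)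
    (chartSymmDerivE_chartDeriv hp) (chartDeriv_chartSymmDerivE hp)
  have h1 := tderiv_chart_symm hp ((he.contMDiff ((extChartAt (𝓡 m) x₀).symm p)).mdifferentiableAt
    one_ne_zero)
  have h2 : tderiv e ((extChartAt (𝓡 m) x₀).symm p)
      = fderiv ℝ (e ∘ (extChartAt (𝓡 m) x₀).symm) p ∘L (K : 𝔼 →L[ℝ] 𝔼) := by
    rw [← h1]
    ext1 v
    exact congrArg _ (chartSymmDerivE_chartDeriv hp v).symm
  rw [embInv, h2, pinv_comp_equiv (he.injective_chart hp)]
  rfl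

lemma IsC1Immersion.vderiv_chart {e : M → V} (he : IsC1Immersion (m := m) e) {x₀ : M} {p : 𝔼}
    (hp : p ∈ (extChartAt (𝓡 m) x₀).target) {F : M → G}
    (hF : MDifferentiableAt (𝓡 m) 𝓘(ℝ, G) F ((extChartAt (𝓡 m) x₀).symm p)) :
    vderiv m e F ((extChartAt (𝓡 m) x₀).symm p) = fderiv ℝ (F ∘ (extChartAt (𝓡 m) x₀).symm) p ∘L
      pinv (fderiv ℝ (e ∘ (extChartAt (𝓡 m) x₀).symm) p) := by
  rw [vderiv, he.embInv_chart hp, ← tderiv_chart_symm hp hF]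
  rfl

lemma IsC1Immersion.continuousAt_pinv_chart {e : M → V} (he : IsC1Immersion (m := m) e) {x₀ : M}
    {p : 𝔼} (hp : p ∈ (extChartAt (𝓡 m) x₀).target) :
    ContinuousAt (fun p => pinv (fderiv ℝ (e ∘ (extChartAt (𝓡 m) x₀).symm) p)) p :=
  ContinuousAt.comp (g := pinv) (continuousAt_pinv (he.injective_chart hp))
    ((contDiffAt_comp_chart_symm hp (he.contMDiff _)).fderiv_right (m := 0) (by simp)).continuousAt

/-- Derivatives at different points, regarded as maps on `V`, can be compared, and the derivative of
a `C^1` map is continuous in this sense. -/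
lemma IsC1Immersion.continuousAt_vderiv {e : M → V} (he : IsC1Immersion (m := m) e) {F : M → G}
    {x₀ : M} (hF : ContMDiffAt (𝓡 m) 𝓘(ℝ, G) 1 F x₀) : ContinuousAt (vderiv m e F) x₀ := by
  set p₀ := extChartAt (𝓡 m) x₀ x₀ with hp₀
  have hsrc := mem_chart_source 𝔼 x₀
  have hp₀t : p₀ ∈ (extChartAt (𝓡 m) x₀).target := extChart_mem_target hsrc
  have hF0 : ContMDiffAt (𝓡 m) 𝓘(ℝ, G) 1 F ((extChartAt (𝓡 m) x₀).symm p₀) := by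
    rwa [hp₀, chart_symm_chart hsrc]
  have h1 : ContinuousAt (fun p => fderiv ℝ (F ∘ (extChartAt (𝓡 m) x₀).symm) p ∘L
      pinv (fderiv ℝ (e ∘ (extChartAt (𝓡 m) x₀).symm) p)) p₀ :=
    ((contDiffAt_comp_chart_symm hp₀t hF0).fderiv_right (m := 0)
      (by simp)).continuousAt.clm_comp (he.continuousAt_pinv_chart hp₀t)
  have h2 := ContinuousAt.comp (f := extChartAt (𝓡 m) x₀) (x := x₀) h1 (continuousAt_extChartAt x₀)
  refine h2.congr ?_
  filter_upwards [(chartAt 𝔼 x₀).open_source.mem_nhds hsrc,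
    (contMDiffAt_iff_contMDiffAt_nhds (by simp)).1 hF] with x hx hFx
  have h3 := he.vderiv_chart (extChart_mem_target hx) (F := F)
    (by rw [chart_symm_chart hx]; exact hFx.mdifferentiableAt one_ne_zero)
  rw [chart_symm_chart hx] at h3
  exact h3.symm

variable [RiemannianBundle (fun x : M => TangentSpace (𝓡 m) x)]
  [IsContMDiffRiemannianBundle (𝓡 m) ∞ (EuclideanSpace ℝ (Fin m))
  (fun x : M => TangentSpace (𝓡 m) x)]

/-- The Riemannian norm and the norm of `V` are uniformly equivalent. -/
lemma IsC1Immersion.exists_rnorm_equiv [CompactSpace M] {e : M → V}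
    (he : IsC1Immersion (m := m) e) : ∃ C : ℝ, 0 < C ∧ ∀ x : M,
      (∀ v, rnorm x (embInv (m := m) e x v) ≤ C * ‖v‖) ∧
      ∀ t : 𝔼, ‖tderiv e x t‖ ≤ C * rnorm x t := by
  suffices h : ∃ ρ > 0, ∀ x : M, (∀ v, rnorm x (embInv (m := m) e x v) ≤ ρ⁻¹ * ‖v‖) ∧
      ∀ t : 𝔼, ‖tderiv e x t‖ ≤ ρ⁻¹ * rnorm x t by
    obtain ⟨ρ, hρ, h⟩ := h
    exact ⟨ρ⁻¹, by positivity, h⟩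
  refine exists_pos_forall_of_locally (P := fun ρ x =>
    (∀ v, rnorm x (embInv (m := m) e x v) ≤ ρ⁻¹ * ‖v‖) ∧
      ∀ t : 𝔼, ‖tderiv e x t‖ ≤ ρ⁻¹ * rnorm x t) (fun x ρ ρ' h0 h hP => ?_) fun x₀ => ?_
  · have h1 := inv_anti₀ h0 h
    exact ⟨fun v => (hP.1 v).trans (mul_le_mul_of_nonneg_right h1 (norm_nonneg _)),
      fun t => (hP.2 t).trans (mul_le_mul_of_nonneg_right h1 (rnorm_nonneg _ _))⟩
  · set p₀ := extChartAt (𝓡 m) x₀ x₀ with hp₀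
    have hp₀t : p₀ ∈ (extChartAt (𝓡 m) x₀).target := extChart_mem_target (mem_chart_source 𝔼 x₀)
    obtain ⟨C, hC, h⟩ := exists_rnorm_chart_equiv (m := m) x₀
    set A : 𝔼 → 𝔼 →L[ℝ] V := fun p => fderiv ℝ (e ∘ (extChartAt (𝓡 m) x₀).symm) p with hA
    have hAc : ContinuousAt A p₀ := ((contDiffAt_comp_chart_symm hp₀t
      (he.contMDiff _)).fderiv_right (m := 0) (by simp)).continuousAt
    have h1 : ∀ᶠ p in 𝓝 p₀, ‖A p‖ < ‖A p₀‖ + 1 :=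
      hAc.norm.eventually (gt_mem_nhds (lt_add_one _))
    have h2 : ∀ᶠ p in 𝓝 p₀, ‖pinv (A p)‖ < ‖pinv (A p₀)‖ + 1 :=
      (he.continuousAt_pinv_chart hp₀t).norm.eventually (gt_mem_nhds (lt_add_one _))
    set B := C * (‖A p₀‖ + 1 + (‖pinv (A p₀)‖ + 1)) with hB
    have hB0 : 0 < B := by positivity
    refine ⟨B⁻¹, by positivity, eventually_of_chart (m := m) ?_⟩
    filter_upwards [h, h1, h2] with p hp hp1 hp2 hpt
    rw [inv_inv]
    constructor
    · intro v
      rw [he.embInv_chart hpt, ContinuousLinearMap.comp_apply]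
      refine (hp _).2.trans ?_
      rw [hB, mul_assoc]
      gcongr
      refine (ContinuousLinearMap.le_opNorm _ _).trans ?_
      gcongr
      have := norm_nonneg (A p₀)
      linarith [hp2.le]
    · intro t
      obtain ⟨w, rfl⟩ : ∃ w, chartSymmDerivE x₀ p w = t := ⟨_, chartSymmDerivE_chartDeriv hpt t⟩
      have h3 : tderiv e ((extChartAt (𝓡 m) x₀).symm p) (chartSymmDerivE x₀ p w) = A p w :=
        congrArg (fun T : 𝔼 →L[ℝ] V => T w) (tderiv_chart_symm hpt
          ((he.contMDiff _).mdifferentiableAt one_ne_zero))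
      rw [h3]
      calc ‖A p w‖ ≤ (‖A p₀‖ + 1 + (‖pinv (A p₀)‖ + 1)) * (C * _) := by
            refine (ContinuousLinearMap.le_opNorm _ _).trans ?_
            refine mul_le_mul ?_ (hp w).1 (norm_nonneg _) (by positivity)
            have := norm_nonneg (pinv (A p₀))
            linarith [hp1.le]
        _ = _ := by rw [hB]; ring

/-- The exponential map, on tangent vectors regarded as elements of `V`. -/
def expV (m : ℕ) [ChartedSpace (EuclideanSpace ℝ (Fin m)) M]
    [RiemannianBundle (fun x : M => TangentSpace (𝓡 m) x)] (e : M → V) (x : M) (v : V) : M :=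
  expMap (m := m) x (embInv e x v)

/-- `exists_norm_comp_expMap_sub_le` for tangent vectors regarded as elements of `V`. -/
lemma IsC1Immersion.exists_norm_comp_expV_sub_le [CompactSpace M] {e : M → V}
    (he : IsC1Immersion (m := m) e) {F : M → G} {x₀ : M}
    (hF : ContMDiffAt (𝓡 m) 𝓘(ℝ, G) 1 F x₀) {η : ℝ} (hη : 0 < η) :
    ∃ ρ > 0, ∀ᶠ x in 𝓝 x₀, ∀ v v' : V, ‖v‖ < ρ → ‖v'‖ < ρ →
      ‖F (expV m e x v) - F (expV m e x v') - vderiv m e F x (v - v')‖ ≤ η * ‖v - v'‖ := by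
  obtain ⟨C, hC, h⟩ := he.exists_rnorm_equiv
  obtain ⟨ρ, hρ, h1⟩ := exists_norm_comp_expMap_sub_le hF (η := η / C) (by positivity)
  refine ⟨ρ / C, by positivity, h1.mono fun x hx v v' hv hv' => ?_⟩
  rw [lt_div_iff₀ hC, mul_comm] at hv hv'
  have h2 := hx (embInv e x v) (embInv e x v') (((h x).1 v).trans_lt hv) (((h x).1 v').trans_lt hv')
  rw [← map_sub] at h2
  refine h2.trans ?_
  calc η / C * rnorm x (embInv (m := m) e x (v - v')) ≤ η / C * (C * ‖v - v'‖) := by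
        gcongr; exact (h x).1 _
    _ = _ := by field_simp

/-- The exponential map is continuous in the base point and the vector together. -/
lemma IsC1Immersion.exists_continuousAt_expV [CompactSpace M] {e : M → V}
    (he : IsC1Immersion (m := m) e) : ∃ ρ > 0, ∀ (x : M) (v : V), ‖v‖ < ρ →
      ContinuousAt (fun z : M × V => expV m e z.1 z.2) (x, v) := by
  obtain ⟨C, hC, hCe⟩ := he.exists_rnorm_equiv
  refine exists_pos_forall_of_locally (P := fun ρ x => ∀ v : V, ‖v‖ < ρ →
    ContinuousAt (fun z : M × V => expV m e z.1 z.2) (x, v))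
    (fun x ρ ρ' _ h hP v hv => hP v (hv.trans_le h)) fun x₀ => ?_
  obtain ⟨Ex, h1, -, -, h⟩ := exists_expMap_chart (m := m) x₀
  have h2 := h1.eventually (by simp)
  obtain ⟨ρ, hρ, h⟩ := exists_eventually_of_rnorm_lt (h2.and h.eventually_nhds)
  refine ⟨ρ / C, by positivity, eventually_of_chart (m := m) (h.mono fun p hp hpt v hv => ?_)⟩
  rw [lt_div_iff₀ hC, mul_comm] at hv
  set A : 𝔼 → V →L[ℝ] 𝔼 := fun p => pinv (fderiv ℝ (e ∘ (extChartAt (𝓡 m) x₀).symm) p) with hA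
  have hAc : ContinuousAt A p := he.continuousAt_pinv_chart hpt
  set x := (extChartAt (𝓡 m) x₀).symm p with hx
  have hxs : x ∈ (chartAt 𝔼 x₀).source := mem_chart_source_symm hpt
  have hkx : extChartAt (𝓡 m) x₀ x = p := chart_chart_symm hpt
  have hform : ∀ p ∈ (extChartAt (𝓡 m) x₀).target,
      embInv e ((extChartAt (𝓡 m) x₀).symm p) = chartSymmDerivE x₀ p ∘L A p :=
    fun p hp => he.embInv_chart hp
  obtain ⟨h3, h4⟩ := hp (A p v) (by
    have := (hCe x).1 v
    rw [hx, hform p hpt] at this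
    exact this.trans_lt hv)
  have hκ : ContinuousAt (fun z : M × V => extChartAt (𝓡 m) x₀ z.1) (x, v) :=
    ContinuousAt.comp (f := Prod.fst) (x := (x, v)) (contMDiffAt_chart (m := m) hxs).continuousAt
      continuousAt_fst
  have hpair : Tendsto (fun z : M × V => (extChartAt (𝓡 m) x₀ z.1, A (extChartAt (𝓡 m) x₀ z.1) z.2))
      (𝓝 (x, v)) (𝓝 (p, A p v)) := by
    have h5 : ContinuousAt (fun z : M × V => A (extChartAt (𝓡 m) x₀ z.1)) (x, v) :=
      ContinuousAt.comp (g := A) (by simp only [hkx]; exact hAc) hκ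
    have h6 := hκ.prodMk (h5.clm_apply continuousAt_snd)
    have h7 := h6.tendsto
    simp only [hkx] at h7
    exact h7
  have hev : (fun z : M × V => expV m e z.1 z.2) =ᶠ[𝓝 (x, v)] fun z =>
      (extChartAt (𝓡 m) x₀).symm (Ex (extChartAt (𝓡 m) x₀ z.1, A (extChartAt (𝓡 m) x₀ z.1) z.2)) := by
    filter_upwards [hpair.eventually h4, (continuousAt_fst (p := (x, v))).eventually_mem
      ((chartAt 𝔼 x₀).open_source.mem_nhds hxs)] with z hz hzs
    have h8 := hform _ (extChart_mem_target hzs)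
    have h9 := hz.2.2.2.2
    rw [chart_symm_chart hzs] at h8 h9
    rw [expV, h8]
    exact h9
  refine ContinuousAt.congr ?_ hev.symm
  have h10 : ContinuousAt (fun z : M × V =>
      Ex (extChartAt (𝓡 m) x₀ z.1, A (extChartAt (𝓡 m) x₀ z.1) z.2)) (x, v) := by
    rw [ContinuousAt]
    simp only [hkx]
    exact h3.continuousAt.tendsto.comp hpair
  refine ContinuousAt.comp (g := (extChartAt (𝓡 m) x₀).symm) ?_ h10
  simp only [hkx]
  exact (contMDiffAt_chart_symm h4.self_of_nhds.2.1).continuousAt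

end Immersion

/-! ### Shadowing for hyperbolic cocycles -/

section Shadowing

variable {M : Type*} [TopologicalSpace M] {V W : Type*} [NormedAddCommGroup V] [NormedSpace ℝ V]
  [NormedAddCommGroup W] [NormedSpace ℝ W]

/-- A hyperbolic cocycle over `f`, on the bundle over `M` whose fibre at `x` is the sum of the
ranges of two projections `Ps x` and `Pu x` of `V`: `D x` is the action on the fibres, `Di x` the
inverse action on the range of `Pu`, and `v ↦ ‖Js x v‖`, `v ↦ ‖Ju x v‖` are adapted norms on the
ranges of `Ps` and `Pu`, which are contracted by `D` and by `Di` respectively. -/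
structure IsHyperbolicCocycle (f : M → M) (Ps Pu D Di : M → V →L[ℝ] V) (Js Ju : M → V →L[ℝ] W)
    (θ : ℝ) : Prop where
  continuous_Ps : Continuous Ps
  continuous_Pu : Continuous Pu
  continuous_D : Continuous D
  continuous_Di : Continuous Di
  continuous_Js : Continuous Js
  continuous_Ju : Continuous Ju
  θ_nonneg : 0 ≤ θ
  θ_lt_one : θ < 1
  Ps_Ps : ∀ x v, Ps x (Ps x v) = Ps x v
  Pu_Pu : ∀ x v, Pu x (Pu x v) = Pu x v
  Ps_Pu : ∀ x v, Ps x (Pu x v) = 0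
  Pu_Ps : ∀ x v, Pu x (Ps x v) = 0
  Js_Ps : ∀ x v, Js x (Ps x v) = Js x v
  Ju_Pu : ∀ x v, Ju x (Pu x v) = Ju x v
  norm_Ps_le : ∀ x v, ‖Ps x v‖ ≤ ‖Js x v‖
  norm_Pu_le : ∀ x v, ‖Pu x v‖ ≤ ‖Ju x v‖
  Js_D : ∀ x v, ‖Js (f x) (D x v)‖ ≤ θ * ‖Js x v‖
  Ju_Di : ∀ x v, ‖Ju x (Di (f x) v)‖ ≤ θ * ‖Ju (f x) v‖
  Di_Pu : ∀ x v, Di x (Pu x v) = Di x v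
  Pu_Di : ∀ x v, Pu x (Di (f x) v) = Di (f x) v
  Di_D : ∀ x v, Di (f x) (D x v) = Pu x v
  D_Di : ∀ x v, D x (Di (f x) v) = Pu (f x) v

namespace IsHyperbolicCocycle

variable {f : M → M} {Ps Pu D Di : M → V →L[ℝ] V} {Js Ju : M → V →L[ℝ] W} {θ : ℝ}

lemma Js_Pu (h : IsHyperbolicCocycle f Ps Pu D Di Js Ju θ) (x : M) (v : V) :
    Js x (Pu x v) = 0 := by
  rw [← h.Js_Ps, h.Ps_Pu, map_zero]

lemma Ju_Ps (h : IsHyperbolicCocycle f Ps Pu D Di Js Ju θ) (x : M) (v : V) :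
    Ju x (Ps x v) = 0 := by
  rw [← h.Ju_Pu, h.Pu_Ps, map_zero]

lemma Di_Ps (h : IsHyperbolicCocycle f Ps Pu D Di Js Ju θ) (x : M) (v : V) :
    Di x (Ps x v) = 0 := by
  rw [← h.Di_Pu, h.Pu_Ps, map_zero]

lemma exists_bound [CompactSpace M] (h : IsHyperbolicCocycle f Ps Pu D Di Js Ju θ) :
    ∃ B : ℝ, 1 ≤ B ∧ ∀ x, ‖Ps x‖ ≤ B ∧ ‖Pu x‖ ≤ B ∧ ‖D x‖ ≤ B ∧ ‖Di x‖ ≤ B ∧ ‖Js x‖ ≤ B ∧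
      ‖Ju x‖ ≤ B := by
  have key : ∀ {U : Type _} [NormedAddCommGroup U] (A : M → U), Continuous A →
      ∃ B, ∀ x, ‖A x‖ ≤ B := fun A hA => by
    obtain ⟨B, hB⟩ := isCompact_univ.exists_bound_of_continuousOn hA.continuousOn
    exact ⟨B, fun x => hB x (mem_univ x)⟩
  have key' : ∀ (A : M → V →L[ℝ] W), Continuous A → ∃ B, ∀ x, ‖A x‖ ≤ B := fun A hA => by
    obtain ⟨B, hB⟩ := isCompact_univ.exists_bound_of_continuousOn hA.continuousOn
    exact ⟨B, fun x => hB x (mem_univ x)⟩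
  obtain ⟨b1, h1⟩ := key Ps h.continuous_Ps
  obtain ⟨b2, h2⟩ := key Pu h.continuous_Pu
  obtain ⟨b3, h3⟩ := key D h.continuous_D
  obtain ⟨b4, h4⟩ := key Di h.continuous_Di
  obtain ⟨b5, h5⟩ := key' Js h.continuous_Js
  obtain ⟨b6, h6⟩ := key' Ju h.continuous_Ju
  refine ⟨1 + (|b1| + |b2| + |b3| + |b4| + |b5| + |b6|), by
    have : 0 ≤ |b1| + |b2| + |b3| + |b4| + |b5| + |b6| := by positivity
    linarith, fun x => ?_⟩
  have g1 := abs_nonneg b1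
  have g2 := abs_nonneg b2
  have g3 := abs_nonneg b3
  have g4 := abs_nonneg b4
  have g5 := abs_nonneg b5
  have g6 := abs_nonneg b6
  refine ⟨?_, ?_, ?_, ?_, ?_, ?_⟩
  · linarith [h1 x, le_abs_self b1]
  · linarith [h2 x, le_abs_self b2]
  · linarith [h3 x, le_abs_self b3]
  · linarith [h4 x, le_abs_self b4]
  · linarith [h5 x, le_abs_self b5]
  · linarith [h6 x, le_abs_self b6]

/-- The adapted norm on the fibre at `x`. -/
def adaptedNorm (Js Ju : M → V →L[ℝ] W) (x : M) (v : V) : ℝ := max ‖Js x v‖ ‖Ju x v‖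

lemma norm_le_adaptedNorm (h : IsHyperbolicCocycle f Ps Pu D Di Js Ju θ) {x : M} {v : V}
    (hv : Ps x v + Pu x v = v) : ‖v‖ ≤ 2 * adaptedNorm Js Ju x v := by
  have h1 := (h.norm_Ps_le x v).trans (le_max_left _ ‖Ju x v‖)
  have h2 := (h.norm_Pu_le x v).trans (le_max_right ‖Js x v‖ _)
  have h3 := norm_add_le (Ps x v) (Pu x v)
  rw [hv] at h3
  rw [adaptedNorm]
  linarith

/-- The graph transform: its fixed points are the orbits of the fibre maps `H`. -/
def graphTransform (Ps Pu Di : M → V →L[ℝ] V) (g : M ≃ₜ M) (H : M → V → V) (v : M → V) (x : M) :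
    V :=
  Ps x (H (g.symm x) (v (g.symm x))) + Pu x (v x + Di (g x) (v (g x) - H x (v x)))

lemma proj_graphTransform (h : IsHyperbolicCocycle f Ps Pu D Di Js Ju θ) (g : M ≃ₜ M)
    (H : M → V → V) (v : M → V) (x : M) :
    Ps x (graphTransform Ps Pu Di g H v x) + Pu x (graphTransform Ps Pu Di g H v x)
      = graphTransform Ps Pu Di g H v x := by
  simp only [graphTransform, map_add, h.Ps_Ps, h.Pu_Pu, h.Ps_Pu, h.Pu_Ps]
  abel

/-- The graph transform contracts the adapted norm. -/
lemma adaptedNorm_graphTransform_le (h : IsHyperbolicCocycle f Ps Pu D Di Js Ju θ) {B η ε : ℝ}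
    (hB1 : 1 ≤ B) (hB : ∀ x, ‖Ps x‖ ≤ B ∧ ‖Pu x‖ ≤ B ∧ ‖D x‖ ≤ B ∧ ‖Di x‖ ≤ B ∧ ‖Js x‖ ≤ B ∧
      ‖Ju x‖ ≤ B) (hη : 0 ≤ η) {g : M ≃ₜ M}
    (hJs : ∀ x, ‖Js (g x) - Js (f x)‖ ≤ η) (hJu : ∀ x, ‖Ju (g x) - Ju (f x)‖ ≤ η)
    (hDi : ∀ x, ‖Di (g x) - Di (f x)‖ ≤ η) {H : M → V → V}
    (hH : ∀ x v w, Ps x v + Pu x v = v → Ps x w + Pu x w = w → ‖v‖ ≤ ε → ‖w‖ ≤ ε →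
      ‖H x v - H x w - (Ps (g x) (D x (v - w)) + Pu (g x) (D x (v - w)))‖ ≤ η * ‖v - w‖)
    {v w : M → V} (hv : ∀ x, Ps x (v x) + Pu x (v x) = v x)
    (hw : ∀ x, Ps x (w x) + Pu x (w x) = w x) (hvε : ∀ x, ‖v x‖ ≤ ε) (hwε : ∀ x, ‖w x‖ ≤ ε)
    {A : ℝ} (hA : ∀ x, adaptedNorm Js Ju x (v x - w x) ≤ A) (x : M) :
    adaptedNorm Js Ju x (graphTransform Ps Pu Di g H v x - graphTransform Ps Pu Di g H w x)
      ≤ (θ + 8 * B ^ 2 * η) * A := by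
  set d : M → V := fun x => v x - w x with hd
  have hdp : ∀ x, Ps x (d x) + Pu x (d x) = d x := fun x => by
    simp only [hd, map_sub]
    rw [← hv x, ← hw x]
    simp only [map_add, h.Ps_Ps, h.Pu_Pu, h.Ps_Pu, h.Pu_Ps]
    abel
  have hdA : ∀ x, ‖d x‖ ≤ 2 * A := fun x =>
    (h.norm_le_adaptedNorm (hdp x)).trans (by linarith [hA x])
  have hA0 : 0 ≤ A := (le_max_of_le_left (norm_nonneg _)).trans (hA x)
  have hB0 : 0 ≤ B := by linarith
  set E : M → V := fun x => H x (v x) - H x (w x)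
    - (Ps (g x) (D x (d x)) + Pu (g x) (D x (d x))) with hE
  have hEη : ∀ x, ‖E x‖ ≤ η * (2 * A) := fun x =>
    (hH x (v x) (w x) (hv x) (hw x) (hvε x) (hwε x)).trans
      (mul_le_mul_of_nonneg_left (hdA x) hη)
  have hHd : ∀ x, H x (v x) - H x (w x)
      = Ps (g x) (D x (d x)) + Pu (g x) (D x (d x)) + E x := fun x => by simp only [hE]; abel
  have hDd : ∀ x, ‖D x (d x)‖ ≤ B * (2 * A) := fun x =>
    (D x).le_of_opNorm_le_of_le (hB x).2.2.1 (hdA x)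
  have hBη : η * A ≤ B * (η * A) := le_mul_of_one_le_left (by positivity) hB1
  have hBη2 : B * (η * A) ≤ B ^ 2 * (η * A) := by
    rw [sq, mul_assoc]; exact le_mul_of_one_le_left (by positivity) hB1
  refine max_le ?_ ?_
  · have h1 : Js x (graphTransform Ps Pu Di g H v x - graphTransform Ps Pu Di g H w x)
        = Js x (D (g.symm x) (d (g.symm x))) + Js x (E (g.symm x)) := by
      have := hHd (g.symm x)
      rw [g.apply_symm_apply] at this
      simp only [graphTransform, map_sub, map_add, h.Js_Ps, h.Js_Pu, sub_zero, add_zero]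
      rw [← map_sub, this]
      simp only [map_add, h.Js_Ps, h.Js_Pu, add_zero]
    have h2 : Js x (D (g.symm x) (d (g.symm x)))
        = Js (f (g.symm x)) (D (g.symm x) (d (g.symm x)))
          + (Js x - Js (f (g.symm x))) (D (g.symm x) (d (g.symm x))) := by
      simp
    have h3 : ‖(Js x - Js (f (g.symm x))) (D (g.symm x) (d (g.symm x)))‖ ≤ η * (B * (2 * A)) := by
      refine ContinuousLinearMap.le_of_opNorm_le_of_le _ ?_ (hDd _)
      have := hJs (g.symm x)
      rwa [g.apply_symm_apply] at this
    have h4 : ‖Js (f (g.symm x)) (D (g.symm x) (d (g.symm x)))‖ ≤ θ * A :=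
      (h.Js_D _ _).trans (mul_le_mul_of_nonneg_left ((le_max_left _ _).trans (hA _)) h.θ_nonneg)
    have h5 : ‖Js x (E (g.symm x))‖ ≤ B * (η * (2 * A)) :=
      (Js x).le_of_opNorm_le_of_le (hB x).2.2.2.2.1 (hEη _)
    rw [h1, h2]
    have h6 := norm_add₃_le (a := Js (f (g.symm x)) (D (g.symm x) (d (g.symm x))))
      (b := (Js x - Js (f (g.symm x))) (D (g.symm x) (d (g.symm x)))) (c := Js x (E (g.symm x)))
    nlinarith
  · have h1 : Ju x (graphTransform Ps Pu Di g H v x - graphTransform Ps Pu Di g H w x)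
        = Ju x (Di (f x) (d (g x))) + Ju x ((Di (g x) - Di (f x)) (d (g x)))
          - Ju x ((Di (g x) - Di (f x)) (D x (d x))) - Ju x (Di (g x) (E x)) := by
      have e1 : Ju x (graphTransform Ps Pu Di g H v x - graphTransform Ps Pu Di g H w x)
          = Ju x (d x) + Ju x (Di (g x) (d (g x)))
            - Ju x (Di (g x) (H x (v x) - H x (w x))) := by
        simp only [graphTransform, map_sub, map_add, h.Ju_Ps, h.Ju_Pu, zero_add, hd]
        abel
      have e2 : Di (g x) (H x (v x) - H x (w x)) = Di (g x) (D x (d x)) + Di (g x) (E x) := by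
        rw [hHd]
        simp only [map_add, h.Di_Ps, h.Di_Pu, zero_add]
      have e3 : Ju x (Di (f x) (D x (d x))) = Ju x (d x) := by rw [h.Di_D, h.Ju_Pu]
      rw [e1, e2]
      simp only [sub_apply, map_add, map_sub, e3]
      abel
    have h2 : ‖Ju x (Di (f x) (d (g x)))‖ ≤ θ * A + 2 * (η * A) := by
      refine (h.Ju_Di _ _).trans ?_
      have e1 : ‖Ju (f x) (d (g x))‖ ≤ A + η * (2 * A) := by
        have e2 : Ju (f x) (d (g x)) = Ju (g x) (d (g x)) - (Ju (g x) - Ju (f x)) (d (g x)) := by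
          simp
        rw [e2]
        refine (norm_sub_le _ _).trans (add_le_add ((le_max_right _ _).trans (hA _)) ?_)
        exact ContinuousLinearMap.le_of_opNorm_le_of_le _ (hJu x) (hdA _)
      have := mul_le_mul_of_nonneg_left e1 h.θ_nonneg
      have e3 : θ * (η * (2 * A)) ≤ 1 * (η * (2 * A)) :=
        mul_le_mul_of_nonneg_right h.θ_lt_one.le (by positivity)
      linarith
    have hJuB := (hB x).2.2.2.2.2
    have h3 : ‖Ju x ((Di (g x) - Di (f x)) (d (g x)))‖ ≤ B * (η * (2 * A)) :=
      (Ju x).le_of_opNorm_le_of_le hJuB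
        (ContinuousLinearMap.le_of_opNorm_le_of_le _ (hDi x) (hdA _))
    have h4 : ‖Ju x ((Di (g x) - Di (f x)) (D x (d x)))‖ ≤ B * (η * (B * (2 * A))) :=
      (Ju x).le_of_opNorm_le_of_le hJuB
        (ContinuousLinearMap.le_of_opNorm_le_of_le _ (hDi x) (hDd _))
    have h5 : ‖Ju x (Di (g x) (E x))‖ ≤ B * (B * (η * (2 * A))) :=
      (Ju x).le_of_opNorm_le_of_le hJuB
        ((Di (g x)).le_of_opNorm_le_of_le (hB (g x)).2.2.2.1 (hEη _))
    rw [h1]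
    have h6 := norm_sub_le (Ju x (Di (f x) (d (g x))) + Ju x ((Di (g x) - Di (f x)) (d (g x)))
      - Ju x ((Di (g x) - Di (f x)) (D x (d x)))) (Ju x (Di (g x) (E x)))
    have h7 := norm_sub_le (Ju x (Di (f x) (d (g x))) + Ju x ((Di (g x) - Di (f x)) (d (g x))))
      (Ju x ((Di (g x) - Di (f x)) (D x (d x))))
    have h8 := norm_add_le (Ju x (Di (f x) (d (g x)))) (Ju x ((Di (g x) - Di (f x)) (d (g x))))
    nlinarith

/-- A fixed point of the graph transform is an orbit of the fibre maps. -/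
lemma orbit_of_graphTransform_eq (h : IsHyperbolicCocycle f Ps Pu D Di Js Ju θ) {B η : ℝ}
    (hB1 : 1 ≤ B) (hB : ∀ x, ‖Ps x‖ ≤ B ∧ ‖Pu x‖ ≤ B ∧ ‖D x‖ ≤ B ∧ ‖Di x‖ ≤ B ∧ ‖Js x‖ ≤ B ∧
      ‖Ju x‖ ≤ B) (hη : 0 ≤ η) (hη1 : 4 * B ^ 2 * η < 1) {g : M ≃ₜ M}
    (hPu : ∀ x, ‖Pu (g x) - Pu (f x)‖ ≤ η) (hDi : ∀ x, ‖Di (g x) - Di (f x)‖ ≤ η) {H : M → V → V}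
    {v : M → V} (hv : ∀ x, graphTransform Ps Pu Di g H v x = v x)
    (hHp : ∀ x, Ps (g x) (H x (v x)) + Pu (g x) (H x (v x)) = H x (v x)) (x : M) :
    v (g x) = H x (v x) := by
  have hvp : ∀ x, Ps x (v x) + Pu x (v x) = v x := fun x => by
    have := h.proj_graphTransform g H v x
    rwa [hv x] at this
  have hs : ∀ x, Ps x (H (g.symm x) (v (g.symm x))) = Ps x (v x) := fun x => by
    have := congrArg (Ps x) (hv x)
    simpa only [graphTransform, map_add, h.Ps_Ps, h.Ps_Pu, add_zero] using this
  have hu : ∀ x, Pu x (Di (g x) (v (g x) - H x (v x))) = 0 := fun x => by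
    have := congrArg (Pu x) (hv x)
    simp only [graphTransform, map_add, h.Pu_Ps, h.Pu_Pu, zero_add] at this
    exact add_eq_left.1 this
  set d := v (g x) - H x (v x) with hd
  have h1 : Ps (g x) d = 0 := by
    have := hs (g x)
    rw [g.symm_apply_apply] at this
    rw [hd, map_sub, this, sub_self]
  have h2 : Pu (g x) d = d := by
    have : Ps (g x) d + Pu (g x) d = d := by
      rw [hd, map_sub, map_sub, ← sub_eq_zero]
      have e1 := hvp (g x)
      have e2 := hHp x
      rw [← sub_eq_zero] at e1 e2
      have : Ps (g x) (v (g x)) - Ps (g x) (H x (v x)) + (Pu (g x) (v (g x)) - Pu (g x) (H x (v x)))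
          - (v (g x) - H x (v x)) = (Ps (g x) (v (g x)) + Pu (g x) (v (g x)) - v (g x))
            - (Ps (g x) (H x (v x)) + Pu (g x) (H x (v x)) - H x (v x)) := by abel
      rw [this, e1, e2, sub_zero]
    rwa [h1, zero_add] at this
  have h3 : Di (f x) d = - Pu x ((Di (g x) - Di (f x)) d) := by
    rw [sub_apply, (Pu x).map_sub, hu x, h.Pu_Di]; abel
  have hB0 : 0 ≤ B := by linarith
  have h4 : ‖Di (f x) d‖ ≤ B * (η * ‖d‖) := by
    rw [h3, norm_neg]
    exact (Pu x).le_of_opNorm_le_of_le (hB x).2.1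
      (ContinuousLinearMap.le_of_opNorm_le _ (hDi x) _)
  have h5 : ‖Pu (f x) d‖ ≤ B * (B * (η * ‖d‖)) := by
    rw [← h.D_Di]
    exact (D x).le_of_opNorm_le_of_le (hB x).2.2.1 h4
  have h6 : ‖d‖ ≤ B * (B * (η * ‖d‖)) + η * ‖d‖ := by
    calc ‖d‖ = ‖Pu (f x) d + (Pu (g x) - Pu (f x)) d‖ := by rw [sub_apply, h2]; congr 1; abel
      _ ≤ _ := (norm_add_le _ _).trans (add_le_add h5
        (ContinuousLinearMap.le_of_opNorm_le _ (hPu x) _))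
  have h7 : d = 0 := by
    by_contra hne
    have hd0 : 0 < ‖d‖ := norm_pos_iff.2 hne
    have hBB : 1 ≤ B ^ 2 := one_le_pow₀ hB1
    nlinarith [mul_nonneg hη hd0.le]
  exact sub_eq_zero.1 h7

lemma graphTransform_eq_of_orbit {g : M ≃ₜ M} {H : M → V → V} {v : M → V}
    (hvp : ∀ x, Ps x (v x) + Pu x (v x) = v x) (hv : ∀ x, v (g x) = H x (v x)) (x : M) :
    graphTransform Ps Pu Di g H v x = v x := by
  have := hv (g.symm x)
  rw [g.apply_symm_apply] at this
  rw [graphTransform, ← this, hv x, sub_self, map_zero, add_zero, hvp]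

/-- Fibre maps close to the linear cocycle have a unique small orbit, and it is continuous. -/
theorem exists_orbit [CompactSpace M] [CompleteSpace V]
    (h : IsHyperbolicCocycle f Ps Pu D Di Js Ju θ) :
    ∃ η > 0, ∃ C > 0, ∀ (g : M ≃ₜ M), (∀ x, ‖Pu (g x) - Pu (f x)‖ ≤ η) →
      (∀ x, ‖Di (g x) - Di (f x)‖ ≤ η) → (∀ x, ‖Js (g x) - Js (f x)‖ ≤ η) →
      (∀ x, ‖Ju (g x) - Ju (f x)‖ ≤ η) → ∀ (ε : ℝ) (H : M → V → V),
      (∀ x v, Ps x v + Pu x v = v → ‖v‖ ≤ ε → Ps (g x) (H x v) + Pu (g x) (H x v) = H x v) →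
      (∀ x v w, Ps x v + Pu x v = v → Ps x w + Pu x w = w → ‖v‖ ≤ ε → ‖w‖ ≤ ε →
        ‖H x v - H x w - (Ps (g x) (D x (v - w)) + Pu (g x) (D x (v - w)))‖ ≤ η * ‖v - w‖) →
      (∀ v : M → V, Continuous v → (∀ x, Ps x (v x) + Pu x (v x) = v x) → (∀ x, ‖v x‖ ≤ ε) →
        Continuous fun x => H x (v x)) →
      (∀ v w : M → V, (∀ x, Ps x (v x) + Pu x (v x) = v x) → (∀ x, Ps x (w x) + Pu x (w x) = w x) →
        (∀ x, ‖v x‖ ≤ ε) → (∀ x, ‖w x‖ ≤ ε) → (∀ x, v (g x) = H x (v x)) →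
        (∀ x, w (g x) = H x (w x)) → v = w) ∧
      ∀ R > 0, R ≤ ε → (∀ x, ‖H x 0‖ ≤ R / C) → ∃ v : M → V, Continuous v ∧
        (∀ x, Ps x (v x) + Pu x (v x) = v x) ∧ (∀ x, ‖v x‖ ≤ R) ∧ ∀ x, v (g x) = H x (v x) := by
  obtain ⟨B, hB1, hB⟩ := h.exists_bound
  have hB0 : 0 < B := by linarith
  have hθ1 := h.θ_lt_one
  have hθ0 := h.θ_nonneg
  -- With this `η` the graph transform contracts the adapted norms by the factor `θ'` below.
  set η := (1 - θ) / (16 * B ^ 2) with hη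
  set θ' := (1 + θ) / 2 with hθ'
  have hηpos : 0 < η := div_pos (by linarith) (by positivity)
  have hηeq : θ + 8 * B ^ 2 * η = θ' := by rw [hη, hθ']; field_simp; ring
  have hη1 : 4 * B ^ 2 * η < 1 := by
    have : 4 * B ^ 2 * η = (1 - θ) / 4 := by rw [hη]; field_simp; ring
    rw [this]; linarith
  have hθ'0 : 0 ≤ θ' := by rw [hθ']; linarith
  have hθ'1 : θ' < 1 := by rw [hθ']; linarith
  refine ⟨η, hηpos, 4 * B ^ 2 / (1 - θ), div_pos (by positivity) (by linarith),
    fun g hPu hDi hJs hJu ε H hHp hH hHc => ?_⟩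
  set T := graphTransform Ps Pu Di g H with hT
  have hcontr : ∀ v w : M → V, (∀ x, Ps x (v x) + Pu x (v x) = v x) →
      (∀ x, Ps x (w x) + Pu x (w x) = w x) → (∀ x, ‖v x‖ ≤ ε) → (∀ x, ‖w x‖ ≤ ε) → ∀ A,
      (∀ x, adaptedNorm Js Ju x (v x - w x) ≤ A) →
      ∀ x, adaptedNorm Js Ju x (T v x - T w x) ≤ θ' * A := fun v w hv hw hvε hwε A hA x => by
    rw [← hηeq]
    exact h.adaptedNorm_graphTransform_le hB1 hB hηpos.le hJs hJu hDi hH hv hw hvε hwε hA x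
  have hnB : ∀ x v, adaptedNorm Js Ju x v ≤ B * ‖v‖ := fun x v =>
    max_le ((Js x).le_of_opNorm_le (hB x).2.2.2.2.1 v) ((Ju x).le_of_opNorm_le (hB x).2.2.2.2.2 v)
  have hsub : ∀ v w : M → V, (∀ x, Ps x (v x) + Pu x (v x) = v x) →
      (∀ x, Ps x (w x) + Pu x (w x) = w x) →
      ∀ x, Ps x (v x - w x) + Pu x (v x - w x) = v x - w x := fun v w hv hw x => by
    have e1 := hv x
    have e2 := hw x
    calc _ = (Ps x (v x) + Pu x (v x)) - (Ps x (w x) + Pu x (w x)) := by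
          simp only [map_sub]; abel
      _ = _ := by rw [e1, e2]
  have hpow : Tendsto (fun n : ℕ => θ' ^ n) atTop (𝓝 0) :=
    tendsto_pow_atTop_nhds_zero_of_lt_one hθ'0 hθ'1
  constructor
  · intro v w hv hw hvε hwε hvo hwo
    have hvT : T v = v := funext (graphTransform_eq_of_orbit hv hvo)
    have hwT : T w = w := funext (graphTransform_eq_of_orbit hw hwo)
    have hA : ∀ n : ℕ, ∀ x, adaptedNorm Js Ju x (v x - w x) ≤ θ' ^ n * (B * (ε + ε)) := by
      intro n
      induction n with
      | zero =>
        intro x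
        rw [pow_zero, one_mul]
        exact (hnB _ _).trans (mul_le_mul_of_nonneg_left
          ((norm_sub_le _ _).trans (add_le_add (hvε x) (hwε x))) hB0.le)
      | succ n ih =>
        intro x
        have := hcontr v w hv hw hvε hwε _ ih x
        rw [hvT, hwT] at this
        rwa [pow_succ', mul_assoc]
    funext x
    have h1 : ‖v x - w x‖ ≤ 0 := by
      refine ge_of_tendsto' (f := fun n : ℕ => 2 * (θ' ^ n * (B * (ε + ε)))) (x := atTop) ?_
        fun n => (h.norm_le_adaptedNorm (hsub v w hv hw x)).trans (by linarith [hA n x])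
      simpa using (hpow.mul_const (B * (ε + ε))).const_mul 2
    exact sub_eq_zero.1 (norm_le_zero_iff.1 h1)
  · intro R hR hRε hκ
    set κ := R / (4 * B ^ 2 / (1 - θ)) with hκdef
    have hκB : B ^ 2 * κ = (1 - θ') * (R / 2) := by
      have : (1 - θ) ≠ 0 := by linarith
      rw [hκdef, hθ']; field_simp; ring
    have hT0 : ∀ x, adaptedNorm Js Ju x (T (fun _ => 0) x) ≤ (1 - θ') * (R / 2) := by
      intro x
      rw [← hκB]
      have hκ0 : 0 ≤ κ := (norm_nonneg _).trans (hκ x)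
      refine max_le ?_ ?_
      · have e1 : Js x (T (fun _ => 0) x) = Js x (H (g.symm x) 0) := by
          simp only [hT, graphTransform, map_add, h.Js_Ps, h.Js_Pu, add_zero]
        rw [e1]
        refine ((Js x).le_of_opNorm_le_of_le (hB x).2.2.2.2.1 (hκ _)).trans ?_
        gcongr; exact le_self_pow₀ hB1 two_ne_zero
      · have e1 : Ju x (T (fun _ => 0) x) = - Ju x (Di (g x) (H x 0)) := by
          simp only [hT, graphTransform, map_add, h.Ju_Ps, h.Ju_Pu, zero_add, zero_sub, map_neg]
        rw [e1, norm_neg, sq, mul_assoc]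
        exact (Ju x).le_of_opNorm_le_of_le (hB x).2.2.2.2.2
          ((Di (g x)).le_of_opNorm_le_of_le (hB _).2.2.2.1 (hκ _))
    -- the iterates of the graph transform, starting from the zero section
    set v : ℕ → M → V := fun n => T^[n] fun _ => 0 with hv
    have hvs : ∀ n, v (n + 1) = T (v n) := fun n => Function.iterate_succ_apply' _ _ _
    have hinv : ∀ n, Continuous (v n) ∧ (∀ x, Ps x (v n x) + Pu x (v n x) = v n x) ∧
        ∀ x, adaptedNorm Js Ju x (v n x) ≤ R / 2 := by
      intro n
      induction n with
      | zero =>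
        refine ⟨continuous_const, fun x => ?_, fun x => ?_⟩
        · simp [hv]
        · simp only [hv, adaptedNorm, Function.iterate_zero, id_eq, map_zero, norm_zero, max_self]
          positivity
      | succ n ih =>
        obtain ⟨ih1, ih2, ih3⟩ := ih
        have hnorm : ∀ x, ‖v n x‖ ≤ ε := fun x =>
          (h.norm_le_adaptedNorm (ih2 x)).trans (by linarith [ih3 x])
        rw [hvs]
        refine ⟨?_, h.proj_graphTransform g H _, fun x => ?_⟩
        · have c1 := hHc _ ih1 ih2 hnorm
          exact (h.continuous_Ps.clm_apply (c1.comp g.symm.continuous)).add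
            (h.continuous_Pu.clm_apply (ih1.add
              ((h.continuous_Di.comp g.continuous).clm_apply ((ih1.comp g.continuous).sub c1))))
        · have e1 := hcontr (v n) (fun _ => 0) ih2 (fun x => by simp) hnorm
            (fun x => by simpa using hR.le.trans hRε) (R / 2) (fun x => by simpa using ih3 x) x
          have e2 := hT0 x
          have e3 : adaptedNorm Js Ju x (T (v n) x) ≤ adaptedNorm Js Ju x
              (T (v n) x - T (fun _ => 0) x) + adaptedNorm Js Ju x (T (fun _ => 0) x) := by
            have e4 : T (v n) x = (T (v n) x - T (fun _ => 0) x) + T (fun _ => 0) x := by abel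
            conv_lhs => rw [e4]
            rw [adaptedNorm, map_add, map_add]
            exact max_le ((norm_add_le _ _).trans (add_le_add (le_max_left _ _) (le_max_left _ _)))
              ((norm_add_le _ _).trans (add_le_add (le_max_right _ _) (le_max_right _ _)))
          linarith
    have hnormR : ∀ n x, ‖v n x‖ ≤ R := fun n x =>
      (h.norm_le_adaptedNorm ((hinv n).2.1 x)).trans (by linarith [(hinv n).2.2 x])
    have hnorm : ∀ n x, ‖v n x‖ ≤ ε := fun n x => (hnormR n x).trans hRε
    have hstep : ∀ n x, adaptedNorm Js Ju x (v (n + 1) x - v n x) ≤ θ' ^ n * R := by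
      intro n
      induction n with
      | zero =>
        intro x
        have e1 : v (0 + 1) x - v 0 x = T (fun _ => 0) x := by simp [hv]
        rw [e1, pow_zero, one_mul]
        refine (hT0 x).trans ?_
        nlinarith
      | succ n ih =>
        intro x
        rw [hvs (n + 1), hvs n]
        rw [hvs n] at ih
        have := hcontr (T (v n)) (v n) (h.proj_graphTransform g H _) (hinv n).2.1
          (by rw [← hvs]; exact hnorm (n + 1)) (hnorm n) _ ih x
        rwa [pow_succ', mul_assoc]
    have hdist : ∀ x n, dist (v n x) (v (n + 1) x) ≤ 2 * R * θ' ^ n := fun x n => by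
      rw [dist_comm, dist_eq_norm]
      refine (h.norm_le_adaptedNorm (hsub _ _ (hinv _).2.1 (hinv _).2.1 x)).trans ?_
      linarith [hstep n x]
    have hlim : ∀ x, ∃ y, Tendsto (fun n => v n x) atTop (𝓝 y) := fun x =>
      cauchySeq_tendsto_of_complete (cauchySeq_of_le_geometric _ _ hθ'1 (hdist x))
    choose w hw using hlim
    have hrate : ∀ n x, dist (v n x) (w x) ≤ 2 * R * θ' ^ n / (1 - θ') := fun n x =>
      dist_le_of_le_geometric_of_tendsto _ _ hθ'1 (hdist x) (hw x) n
    have hrate0 : Tendsto (fun n => 2 * R * θ' ^ n / (1 - θ')) atTop (𝓝 0) := by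
      simpa using (hpow.const_mul (2 * R)).div_const (1 - θ')
    have hunif : TendstoUniformly v w atTop := by
      rw [Metric.tendstoUniformly_iff]
      intro ε' hε'
      filter_upwards [hrate0.eventually (gt_mem_nhds hε')] with n hn x
      rw [dist_comm]
      exact (hrate n x).trans_lt hn
    have hwp : ∀ x, Ps x (w x) + Pu x (w x) = w x := fun x =>
      tendsto_nhds_unique ((((Ps x).continuous.tendsto _).comp (hw x)).add
        (((Pu x).continuous.tendsto _).comp (hw x)))
        ((hw x).congr fun n => ((hinv n).2.1 x).symm)
    have hwR : ∀ x, ‖w x‖ ≤ R := fun x => le_of_tendsto' (hw x).norm fun n => hnormR n x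
    have hwT : ∀ x, T w x = w x := by
      intro x
      refine tendsto_nhds_unique (f := fun n => v (n + 1) x) (l := atTop) ?_
        ((hw x).comp (tendsto_add_atTop_nat 1))
      rw [tendsto_iff_norm_sub_tendsto_zero]
      refine squeeze_zero (fun _ => norm_nonneg _) (g := fun n =>
        2 * (θ' * (B * (2 * R * θ' ^ n / (1 - θ'))))) (fun n => ?_) ?_
      · rw [hvs]
        refine (h.norm_le_adaptedNorm (hsub _ _ (h.proj_graphTransform g H _)
          (h.proj_graphTransform g H _) x)).trans ?_
        refine mul_le_mul_of_nonneg_left ?_ zero_le_two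
        refine hcontr (v n) w (hinv n).2.1 hwp (hnorm n) (fun x => (hwR x).trans hRε) _
          (fun x => (hnB _ _).trans (mul_le_mul_of_nonneg_left ?_ hB0.le)) x
        rw [← dist_eq_norm]; exact hrate n x
      · simpa using ((hrate0.const_mul B).const_mul θ').const_mul 2
    refine ⟨w, hunif.continuous (Frequently.of_forall fun n => (hinv n).1), hwp, hwR, ?_⟩
    exact h.orbit_of_graphTransform_eq hB1 hB hηpos.le hη1 hPu hDi hwT
      fun x => hHp x _ (hwp x) ((hwR x).trans hRε)

end IsHyperbolicCocycle

end Shadowing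

/-! ### Continuity of closed splittings, and growth rates -/

section Projections

variable {M : Type*} [TopologicalSpace M] [CompactSpace M] [T2Space M]
  {V : Type*} [NormedAddCommGroup V] [NormedSpace ℝ V] [FiniteDimensional ℝ V]

/-- A closed decomposition of `V` into three subspaces that depend on a point of a compact space is
continuous: the graph of the map that assigns to `x` the components of `v` is closed, and the
components are bounded by compactness. -/
lemma exists_continuous_projections {S U F : M → Submodule ℝ V}
    (hS : IsClosed {z : M × V | z.2 ∈ S z.1}) (hU : IsClosed {z : M × V | z.2 ∈ U z.1})
    (hF : IsClosed {z : M × V | z.2 ∈ F z.1})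
    (hdec : ∀ x v, ∃ s ∈ S x, ∃ u ∈ U x, v - s - u ∈ F x)
    (hind : ∀ x, ∀ s ∈ S x, ∀ u ∈ U x, s + u ∈ F x → s = 0 ∧ u = 0) :
    ∃ Ps Pu : M → V →L[ℝ] V, Continuous Ps ∧ Continuous Pu ∧ (∀ x v, Ps x v ∈ S x) ∧
      (∀ x v, Pu x v ∈ U x) ∧ (∀ x v, v - Ps x v - Pu x v ∈ F x) := by
  have huniq : ∀ x v, ∀ s ∈ S x, ∀ u ∈ U x, v - s - u ∈ F x → ∀ s' ∈ S x, ∀ u' ∈ U x,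
      v - s' - u' ∈ F x → s = s' ∧ u = u' := fun x v s hs u hu h s' hs' u' hu' h' => by
    have := hind x (s - s') ((S x).sub_mem hs hs') (u - u') ((U x).sub_mem hu hu')
      (by convert (F x).sub_mem h' h using 1; abel)
    exact ⟨sub_eq_zero.1 this.1, sub_eq_zero.1 this.2⟩
  choose s hs u hu hsu using hdec
  have hbd : ∃ B : ℝ, ∀ x v, ‖(s x v, u x v)‖ ≤ B * ‖v‖ := by
    set K : Set (M × (V × V) × V) := {z | z.2.1.1 ∈ S z.1 ∧ z.2.1.2 ∈ U z.1 ∧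
      z.2.2 - z.2.1.1 - z.2.1.2 ∈ F z.1} ∩
      (univ ×ˢ (Metric.sphere (0 : V × V) 1 ×ˢ Metric.closedBall 0 1))
      with hK
    have hKc : IsCompact K := by
      refine IsCompact.inter_left (isCompact_univ.prod
        ((isCompact_sphere _ _).prod (isCompact_closedBall _ _))) ?_
      have c1 : Continuous fun z : M × (V × V) × V => (z.1, z.2.1.1) := by fun_prop
      have c2 : Continuous fun z : M × (V × V) × V => (z.1, z.2.1.2) := by fun_prop
      have c3 : Continuous fun z : M × (V × V) × V => (z.1, z.2.2 - z.2.1.1 - z.2.1.2) := by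
        fun_prop
      exact (hS.preimage c1).inter ((hU.preimage c2).inter (hF.preimage c3))
    have hpos : ∀ z ∈ K, 0 < ‖z.2.2‖ := by
      rintro ⟨x, ⟨a, b⟩, v⟩ ⟨⟨ha, hb, hv⟩, -, hab, -⟩
      rw [norm_pos_iff]
      rintro rfl
      obtain ⟨rfl, rfl⟩ := huniq x 0 a ha b hb hv 0 (S x).zero_mem 0 (U x).zero_mem (by simp)
      simp at hab
    obtain ⟨c, hc, hcK⟩ : ∃ c > 0, ∀ z ∈ K, c ≤ ‖z.2.2‖ := by
      rcases K.eq_empty_or_nonempty with h | h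
      · exact ⟨1, one_pos, by simp [h]⟩
      · obtain ⟨z, hz, hmin⟩ := hKc.exists_isMinOn h
          (f := fun z : M × (V × V) × V => ‖z.2.2‖) (by fun_prop)
        exact ⟨‖z.2.2‖, hpos z hz, fun w hw => hmin hw⟩
    refine ⟨max 1 c⁻¹, fun x v => ?_⟩
    set a : V × V := (s x v, u x v) with ha
    rcases eq_or_ne a 0 with h0 | h0
    · rw [h0, norm_zero]; positivity
    have hn : 0 < ‖a‖ := norm_pos_iff.2 h0
    rcases le_total ‖a‖ ‖v‖ with hav | hav
    · nlinarith [le_max_left 1 c⁻¹, norm_nonneg v]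
    have := hcK (x, ‖a‖⁻¹ • a, ‖a‖⁻¹ • v) ⟨⟨(S x).smul_mem _ (hs x v), (U x).smul_mem _ (hu x v), by
      convert (F x).smul_mem ‖a‖⁻¹ (hsu x v) using 1
      simp only [ha, smul_sub, Prod.smul_fst, Prod.smul_snd]⟩, mem_univ _, by
      simp [norm_smul, hn.ne'], by
      simp only [Metric.mem_closedBall, dist_zero_right, norm_smul, norm_inv, norm_norm]
      rw [inv_mul_le_iff₀ hn]; linarith⟩
    simp only [norm_smul, norm_inv, norm_norm] at this
    rw [le_inv_mul_iff₀ hn] at this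
    calc ‖a‖ = c⁻¹ * (‖a‖ * c) := by field_simp
      _ ≤ c⁻¹ * ‖v‖ := by gcongr
      _ ≤ _ := by gcongr; exact le_max_right _ _
  obtain ⟨B, hB⟩ := hbd
  have hadd : ∀ x v w, s x (v + w) = s x v + s x w ∧ u x (v + w) = u x v + u x w := fun x v w =>
    huniq x (v + w) _ (hs x _) _ (hu x _) (hsu x _) _ ((S x).add_mem (hs x v) (hs x w)) _
      ((U x).add_mem (hu x v) (hu x w)) (by
        convert (F x).add_mem (hsu x v) (hsu x w) using 1; abel)
  have hsmul : ∀ x (c : ℝ) v, s x (c • v) = c • s x v ∧ u x (c • v) = c • u x v := fun x c v =>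
    huniq x (c • v) _ (hs x _) _ (hu x _) (hsu x _) _ ((S x).smul_mem c (hs x v)) _
      ((U x).smul_mem c (hu x v)) (by
        convert (F x).smul_mem c (hsu x v) using 1; simp only [smul_sub])
  have hcont : ∀ v, Continuous fun x => (s x v, u x v) := fun v => by
    rw [continuous_iff_isClosed]
    intro Z hZ
    have hc : IsCompact ({z : M × V × V | z.2.1 ∈ S z.1 ∧ z.2.2 ∈ U z.1 ∧ v - z.2.1 - z.2.2 ∈ F z.1}
        ∩ (univ ×ˢ (Metric.closedBall (0 : V × V) (B * ‖v‖) ∩ Z))) := by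
      refine IsCompact.inter_left (isCompact_univ.prod
        ((isCompact_closedBall _ _).inter_right hZ)) ?_
      have c1 : Continuous fun z : M × V × V => (z.1, z.2.1) := by fun_prop
      have c2 : Continuous fun z : M × V × V => (z.1, z.2.2) := by fun_prop
      have c3 : Continuous fun z : M × V × V => (z.1, v - z.2.1 - z.2.2) := by fun_prop
      exact (hS.preimage c1).inter ((hU.preimage c2).inter (hF.preimage c3))
    convert (hc.image continuous_fst).isClosed using 1
    ext x
    constructor
    · intro hx
      exact ⟨(x, s x v, u x v), ⟨⟨hs x v, hu x v, hsu x v⟩, mem_univ _,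
        by simpa using hB x v, hx⟩, rfl⟩
    · rintro ⟨⟨x, a, b⟩, ⟨⟨ha, hb, hab⟩, -, -, hz⟩, rfl⟩
      obtain ⟨rfl, rfl⟩ := huniq x v _ (hs x v) _ (hu x v) (hsu x v) a ha b hb hab
      exact hz
  refine ⟨fun x => LinearMap.toContinuousLinearMap ⟨⟨s x, fun v w => (hadd x v w).1⟩,
      fun c v => (hsmul x c v).1⟩, fun x => LinearMap.toContinuousLinearMap
      ⟨⟨u x, fun v w => (hadd x v w).2⟩, fun c v => (hsmul x c v).2⟩, ?_, ?_, hs, hu, hsu⟩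
  · rw [continuous_clm_apply]
    exact fun v => (hcont v).fst
  · rw [continuous_clm_apply]
    exact fun v => (hcont v).snd

end Projections

section Growth

/-- A geometric sequence is not dominated by one with a smaller ratio. -/
lemma nonpos_of_forall_mul_pow_le {a b x K : ℝ} (ha : 0 < a) (hab : a < b)
    (h : ∀ n : ℕ, x * b ^ n ≤ K * a ^ n) : x ≤ 0 := by
  have hb : 0 < b := ha.trans hab
  have h1 : Tendsto (fun n : ℕ => K * (a / b) ^ n) atTop (𝓝 (K * 0)) :=
    (tendsto_pow_atTop_nhds_zero_of_lt_one (by positivity)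
      ((div_lt_one hb).2 hab)).const_mul K
  rw [mul_zero] at h1
  refine ge_of_tendsto' h1 fun n => ?_
  rw [div_pow, mul_div_assoc', le_div_iff₀ (by positivity)]
  exact h n

/-- Domination: a vector whose growth rate is at most that of the slowest part has no other
components. -/
lemma eq_zero_of_norm_sum_le {V : Type*} [NormedAddCommGroup V] {s c u : ℕ → V}
    {l l' μ' μ B a a' b : ℝ} (hl : 0 < l) (hl' : l < l') (hμ' : l' ≤ μ') (hμ : μ' < μ)
    (hs : ∀ n, ‖s n‖ ≤ B * l ^ n) (hc : ∀ n, a * l' ^ n ≤ ‖c n‖) (hc' : ∀ n, ‖c n‖ ≤ a' * μ' ^ n)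
    (hu : ∀ n, b * μ ^ n ≤ ‖u n‖) (hB : 0 ≤ B) (hv : ∀ n, ‖s n + c n + u n‖ ≤ B * l ^ n) :
    b ≤ 0 ∧ (u = 0 → a ≤ 0) := by
  refine ⟨nonpos_of_forall_mul_pow_le (K := B + B + a') (hl.trans (hl'.trans_le hμ')) hμ
    fun n => ?_, fun h0 => nonpos_of_forall_mul_pow_le (K := B + B) hl hl' fun n => ?_⟩
  · have h1 : ‖u n‖ ≤ ‖s n + c n + u n‖ + ‖s n‖ + ‖c n‖ := by
      have : u n = s n + c n + u n - s n - c n := by abel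
      calc ‖u n‖ = ‖s n + c n + u n - s n - c n‖ := by rw [← this]
        _ ≤ _ := (norm_sub_le _ _).trans (add_le_add_left (norm_sub_le _ _) _)
    have h2 : l ^ n ≤ μ' ^ n := pow_le_pow_left₀ hl.le (hl'.le.trans hμ') n
    have h3 := mul_le_mul_of_nonneg_left h2 hB
    linarith [hu n, hv n, hs n, hc' n]
  · have h1 : ‖c n‖ ≤ ‖s n + c n + u n‖ + ‖s n‖ := by
      have : c n = s n + c n + u n - s n := by rw [h0]; simp
      calc ‖c n‖ = ‖s n + c n + u n - s n‖ := by rw [← this]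
        _ ≤ _ := norm_sub_le _ _
    linarith [hc n, hv n, hs n]

end Growth

/-! ### Partially hyperbolic diffeomorphisms -/

section Domination

lemma exists_add_add_eq {V : Type*} [AddCommGroup V] [Module ℝ V] {A B D : Submodule ℝ V}
    (h : IsCompl B (A ⊔ D)) (t : V) : ∃ s ∈ A, ∃ c ∈ B, ∃ u ∈ D, s + c + u = t := by
  have ht : t ∈ B ⊔ (A ⊔ D) := by rw [h.sup_eq_top]; exact Submodule.mem_top
  obtain ⟨c, hc, w, hw, rfl⟩ := Submodule.mem_sup.1 ht
  obtain ⟨s, hs, u, hu, rfl⟩ := Submodule.mem_sup.1 hw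
  exact ⟨s, hs, c, hc, u, hu, by abel⟩

lemma eq_zero_of_add_add_eq_zero {V : Type*} [AddCommGroup V] [Module ℝ V]
    {A B D : Submodule ℝ V} (h : IsCompl B (A ⊔ D)) (hAD : Disjoint A D) {s c u : V} (hs : s ∈ A)
    (hc : c ∈ B) (hu : u ∈ D) (hsum : s + c + u = 0) : s = 0 ∧ c = 0 ∧ u = 0 := by
  have h5 : c = -(s + u) := by rw [← sub_eq_zero, ← hsum]; abel
  have h6 : s + u ∈ A ⊔ D := Submodule.add_mem_sup hs hu
  have hc0 : c = 0 := Submodule.disjoint_def.1 h.disjoint _ hc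
    (h5 ▸ (A ⊔ D).neg_mem h6)
  have h9 : s = -u := by rw [hc0, add_zero] at hsum; exact eq_neg_of_add_eq_zero_left hsum
  have hs0 : s = 0 := Submodule.disjoint_def.1 hAD s hs (h9 ▸ D.neg_mem hu)
  exact ⟨hs0, hc0, by simpa [hs0, hc0] using hsum⟩

variable {m : ℕ} {M : Type*} [EMetricSpace M] [ChartedSpace (EuclideanSpace ℝ (Fin m)) M]

local notation "𝔼" => EuclideanSpace ℝ (Fin m)

/-- The derivative of a self-map of `M`, with tangent spaces identified with the model space. -/
def dmap (m : ℕ) [ChartedSpace (EuclideanSpace ℝ (Fin m)) M] (f : M → M) (x : M) :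
    EuclideanSpace ℝ (Fin m) →L[ℝ] EuclideanSpace ℝ (Fin m) :=
  mfderiv (𝓡 m) (𝓡 m) f x

lemma dmap_comp {f g : M → M} {x : M} (hg : MDifferentiableAt (𝓡 m) (𝓡 m) g (f x))
    (hf : MDifferentiableAt (𝓡 m) (𝓡 m) f x) (t : 𝔼) :
    dmap m (g ∘ f) x t = dmap m g (f x) (dmap m f x t) :=
  congrArg (fun T : 𝔼 →L[ℝ] 𝔼 => T t) (mfderiv_comp x hg hf)

lemma dmap_id (x : M) (t : 𝔼) : dmap m (id : M → M) x t = t :=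
  congrArg (fun T : 𝔼 →L[ℝ] 𝔼 => T t) (mfderiv_id (I := 𝓡 m) (x := x))

lemma tderiv_comp_dmap {G : Type*} [NormedAddCommGroup G] [NormedSpace ℝ G] {F : M → G}
    {f : M → M} {x : M} (hF : MDifferentiableAt (𝓡 m) 𝓘(ℝ, G) F (f x))
    (hf : MDifferentiableAt (𝓡 m) (𝓡 m) f x) (t : 𝔼) :
    tderiv (F ∘ f) x t = tderiv F (f x) (dmap m f x t) :=
  congrArg (fun T : 𝔼 →L[ℝ] G => T t) (mfderiv_comp x hF hf)

variable [RiemannianBundle (fun x : M => TangentSpace (𝓡 m) x)]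

/-- A partially hyperbolic diffeomorphism `f` with inverse `f'`, its splitting and its rates, in a
form that is symmetric under the exchange of `f` and `f'`. -/
structure IsDominatedPair (f f' : M → M)
    (Es Ec Eu : M → Submodule ℝ (EuclideanSpace ℝ (Fin m))) (l l' μ' μ C : ℝ) : Prop where
  contMDiff : ContMDiff (𝓡 m) (𝓡 m) 1 f
  contMDiff_inv : ContMDiff (𝓡 m) (𝓡 m) 1 f'
  left_inv : ∀ x, f' (f x) = x
  right_inv : ∀ x, f (f' x) = x
  exists_decomp : ∀ x (t : EuclideanSpace ℝ (Fin m)),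
    ∃ s ∈ Es x, ∃ c ∈ Ec x, ∃ u ∈ Eu x, s + c + u = t
  indep : ∀ x, ∀ s ∈ Es x, ∀ c ∈ Ec x, ∀ u ∈ Eu x, s + c + u = 0 → s = 0 ∧ c = 0 ∧ u = 0
  map_s : ∀ x, ∀ t ∈ Es x, dmap m f x t ∈ Es (f x)
  map_c : ∀ x, ∀ t ∈ Ec x, dmap m f x t ∈ Ec (f x)
  map_u : ∀ x, ∀ t ∈ Eu x, dmap m f x t ∈ Eu (f x)
  inv_s : ∀ x, ∀ t ∈ Es x, dmap m f' x t ∈ Es (f' x)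
  inv_c : ∀ x, ∀ t ∈ Ec x, dmap m f' x t ∈ Ec (f' x)
  inv_u : ∀ x, ∀ t ∈ Eu x, dmap m f' x t ∈ Eu (f' x)
  l_pos : 0 < l
  l_lt_one : l < 1
  one_lt_μ : 1 < μ
  l_lt : l < l'
  l'_le : l' ≤ μ'
  μ'_lt : μ' < μ
  C_pos : 0 < C
  norm_s_le : ∀ n x, ∀ t ∈ Es x,
    rnorm (m := m) (f^[n] x) (dmap m f^[n] x t) ≤ C * l ^ n * rnorm (m := m) x t
  le_norm_c : ∀ n x, ∀ t ∈ Ec x,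
    C⁻¹ * l' ^ n * rnorm (m := m) x t ≤ rnorm (m := m) (f^[n] x) (dmap m f^[n] x t)
  norm_c_le : ∀ n x, ∀ t ∈ Ec x,
    rnorm (m := m) (f^[n] x) (dmap m f^[n] x t) ≤ C * μ' ^ n * rnorm (m := m) x t
  le_norm_u : ∀ n x, ∀ t ∈ Eu x,
    C⁻¹ * μ ^ n * rnorm (m := m) x t ≤ rnorm (m := m) (f^[n] x) (dmap m f^[n] x t)

namespace IsDominatedPair

variable {f f' : M → M} {Es Ec Eu : M → Submodule ℝ (EuclideanSpace ℝ (Fin m))}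
  {l l' μ' μ C : ℝ}

lemma mdifferentiableAt_inv (h : IsDominatedPair f f' Es Ec Eu l l' μ' μ C) (x : M) :
    MDifferentiableAt (𝓡 m) (𝓡 m) f' x :=
  (h.contMDiff_inv x).mdifferentiableAt one_ne_zero

lemma dmap_iterate_inv (h : IsDominatedPair f f' Es Ec Eu l l' μ' μ C) (n : ℕ) (x : M) (t : 𝔼) :
    dmap m f^[n] (f'^[n] x) (dmap m f'^[n] x t) = t := by
  have h1 : f^[n] ∘ f'^[n] = id :=
    funext (Function.LeftInverse.iterate (f := f') (g := f) h.right_inv n)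
  rw [← dmap_comp (((h.contMDiff.iterate n) _).mdifferentiableAt one_ne_zero)
    (((h.contMDiff_inv.iterate n) _).mdifferentiableAt one_ne_zero), h1, dmap_id]

lemma iterate_mem (h : IsDominatedPair f f' Es Ec Eu l l' μ' μ C)
    {E : M → Submodule ℝ (EuclideanSpace ℝ (Fin m))}
    (hE : ∀ x, ∀ t ∈ E x, dmap m f' x t ∈ E (f' x)) (n : ℕ) (x : M) (t : 𝔼) (ht : t ∈ E x) :
    dmap m f'^[n] x t ∈ E (f'^[n] x) := by
  induction n with
  | zero => simpa [dmap_id] using ht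
  | succ n ih =>
    rw [Function.iterate_succ', dmap_comp (h.mdifferentiableAt_inv _)
      (((h.contMDiff_inv.iterate n) _).mdifferentiableAt one_ne_zero)]
    exact hE _ _ ih

lemma symm (h : IsDominatedPair f f' Es Ec Eu l l' μ' μ C) :
    IsDominatedPair f' f Eu Ec Es μ⁻¹ μ'⁻¹ l'⁻¹ l⁻¹ C := by
  have hl := h.l_pos
  have hl' := hl.trans h.l_lt
  have hμ' := hl'.trans_le h.l'_le
  have hμ := hμ'.trans h.μ'_lt
  have hC := h.C_pos
  have hff : ∀ n x, f^[n] (f'^[n] x) = x := fun n =>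
    Function.LeftInverse.iterate (f := f') (g := f) h.right_inv n
  refine ⟨h.contMDiff_inv, h.contMDiff, h.right_inv, h.left_inv, fun x t => ?_,
    fun x s hs c hc u hu hsum => ?_, h.inv_u, h.inv_c, h.inv_s, h.map_u, h.map_c, h.map_s,
    inv_pos.2 hμ, inv_lt_one_of_one_lt₀ h.one_lt_μ, (one_lt_inv₀ hl).2 h.l_lt_one,
    inv_strictAnti₀ hμ' h.μ'_lt, inv_anti₀ hl' h.l'_le, inv_strictAnti₀ hl h.l_lt, hC,
    fun n x t ht => ?_, fun n x t ht => ?_, fun n x t ht => ?_, fun n x t ht => ?_⟩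
  · obtain ⟨s, hs, c, hc, u, hu, hsum⟩ := h.exists_decomp x t
    exact ⟨u, hu, c, hc, s, hs, by rw [← hsum]; abel⟩
  · obtain ⟨h1, h2, h3⟩ := h.indep x u hu c hc s hs (by rw [← hsum]; abel)
    exact ⟨h3, h2, h1⟩
  · have := h.le_norm_u n _ _ (h.iterate_mem h.inv_u n x t ht)
    rw [h.dmap_iterate_inv, hff] at this
    rw [inv_pow, ← div_eq_mul_inv, div_mul_eq_mul_div, le_div_iff₀ (by positivity)]
    rw [mul_assoc, inv_mul_le_iff₀ hC] at this
    linarith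
  · have := h.norm_c_le n _ _ (h.iterate_mem h.inv_c n x t ht)
    rw [h.dmap_iterate_inv, hff] at this
    rw [inv_pow, ← mul_inv, inv_mul_le_iff₀ (by positivity)]
    exact this
  · have := h.le_norm_c n _ _ (h.iterate_mem h.inv_c n x t ht)
    rw [h.dmap_iterate_inv, hff] at this
    rw [inv_pow, ← div_eq_mul_inv, div_mul_eq_mul_div, le_div_iff₀ (by positivity)]
    rw [mul_assoc, inv_mul_le_iff₀ hC] at this
    linarith
  · have := h.norm_s_le n _ _ (h.iterate_mem h.inv_s n x t ht)
    rw [h.dmap_iterate_inv, hff] at this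
    rw [inv_pow, ← mul_inv, inv_mul_le_iff₀ (by positivity)]
    exact this

end IsDominatedPair

lemma IsPartiallyHyperbolic.exists_isDominatedPair {f f' : M → M}
    {Es Ec Eu : ∀ x : M, Submodule ℝ (TangentSpace (𝓡 m) x)}
    (hf : IsPartiallyHyperbolic f Es Ec Eu) (h1 : ContMDiff (𝓡 m) (𝓡 m) 1 f)
    (h2 : ContMDiff (𝓡 m) (𝓡 m) 1 f') (h3 : ∀ x, f' (f x) = x) (h4 : ∀ x, f (f' x) = x) :
    ∃ l l' μ' μ C, IsDominatedPair (m := m) f f' Es Ec Eu l l' μ' μ C := by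
  obtain ⟨l, l', μ', μ, C, hl, hl1, hμ1, hll', hl'μ', hμ'μ, hC, hb⟩ := hf.bounds
  have hinv : ∀ {E : ∀ x : M, Submodule ℝ (TangentSpace (𝓡 m) x)},
      (∀ x, (E x).map (mfderiv (𝓡 m) (𝓡 m) f x).toLinearMap = E (f x)) → ∀ x,
      ∀ t ∈ E x, (dmap m f' x t : 𝔼) ∈ E (f' x) := fun {E} hE x t ht => by
    have hE' := hE (f' x)
    have h5 : ∀ w : 𝔼, dmap m f' (f (f' x)) (dmap m f (f' x) w) = w := fun w => by
      rw [← dmap_comp ((h2 _).mdifferentiableAt one_ne_zero)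
        ((h1 _).mdifferentiableAt one_ne_zero), show f' ∘ f = id from funext h3, dmap_id]
    have key : ∀ y, f (f' x) = y → ∀ t ∈ E y, (dmap m f' y t : 𝔼) ∈ E (f' x) := by
      rintro _ rfl t ht
      rw [← hE'] at ht
      obtain ⟨w, hw, rfl⟩ := ht
      exact Set.mem_of_eq_of_mem (h5 w) hw
    exact key x (h4 x) t ht
  have hmap : ∀ {E : ∀ x : M, Submodule ℝ (TangentSpace (𝓡 m) x)},
      (∀ x, (E x).map (mfderiv (𝓡 m) (𝓡 m) f x).toLinearMap = E (f x)) → ∀ x,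
      ∀ t ∈ E x, (dmap m f x t : 𝔼) ∈ E (f x) := fun {E} hE x t ht => by
    rw [← hE x]; exact ⟨t, ht, rfl⟩
  have hdec : ∀ x (t : 𝔼), ∃ s ∈ Es x, ∃ c ∈ Ec x, ∃ u ∈ Eu x, (s + c + u : 𝔼) = t := fun x t =>
    exists_add_add_eq (V := TangentSpace (𝓡 m) x) (hf.isCompl x) t
  have hind : ∀ x, ∀ s ∈ Es x, ∀ c ∈ Ec x, ∀ u ∈ Eu x, (s + c + u : 𝔼) = 0 →
      s = 0 ∧ c = 0 ∧ u = 0 := fun x s hs c hc u hu =>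
    eq_zero_of_add_add_eq_zero (V := TangentSpace (𝓡 m) x) (hf.isCompl x) (hf.disjoint_su x) hs hc
      hu
  refine ⟨l, l', μ', μ, C, ?_⟩
  exact
    { contMDiff := h1
      contMDiff_inv := h2
      left_inv := h3
      right_inv := h4
      exists_decomp := hdec
      indep := hind
      map_s := hmap hf.map_s
      map_c := hmap hf.map_c
      map_u := hmap hf.map_u
      inv_s := hinv hf.map_s
      inv_c := hinv hf.map_c
      inv_u := hinv hf.map_u
      l_pos := hl
      l_lt_one := hl1
      one_lt_μ := hμ1
      l_lt := hll'
      l'_le := hl'μ'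
      μ'_lt := hμ'μ
      C_pos := hC
      norm_s_le := fun n x => (hb n x).1
      le_norm_c := fun n x t ht => ((hb n x).2.1 t ht).1
      norm_c_le := fun n x t ht => ((hb n x).2.1 t ht).2
      le_norm_u := fun n x => (hb n x).2.2 }

end Domination

/-! ### The cocycle on the stable and unstable bundles -/

section Splitting

variable {m : ℕ} {M : Type*} [EMetricSpace M] [ChartedSpace (EuclideanSpace ℝ (Fin m)) M]
  {V : Type*} [NormedAddCommGroup V] [InnerProductSpace ℝ V] [FiniteDimensional ℝ V]

local notation "𝔼" => EuclideanSpace ℝ (Fin m)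

/-- A family of tangent subspaces, regarded as subspaces of `V` by means of a map `e : M → V`. -/
def embSub (e : M → V) (E : M → Submodule ℝ (EuclideanSpace ℝ (Fin m))) (x : M) : Submodule ℝ V :=
  (E x).map (tderiv (m := m) e x).toLinearMap

lemma mem_embSub {e : M → V} {E : M → Submodule ℝ 𝔼} {x : M} {v : V} :
    v ∈ embSub e E x ↔ ∃ t ∈ E x, tderiv e x t = v := Iff.rfl

variable [RiemannianBundle (fun x : M => TangentSpace (𝓡 m) x)]
  [IsManifold (𝓡 m) ∞ M]
  [IsContMDiffRiemannianBundle (𝓡 m) ∞ (EuclideanSpace ℝ (Fin m))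
      (fun x : M => TangentSpace (𝓡 m) x)] [CompactSpace M]

namespace IsDominatedPair

variable {f f' : M → M} {Es Ec Eu : M → Submodule ℝ (EuclideanSpace ℝ (Fin m))}
  {l l' μ' μ C : ℝ} {e : M → V}

lemma tderiv_iterate (h : IsDominatedPair f f' Es Ec Eu l l' μ' μ C)
    (he : IsC1Immersion (m := m) e) (n : ℕ) (x : M) (t : 𝔼) :
    tderiv (e ∘ f^[n]) x t = tderiv e (f^[n] x) (dmap m f^[n] x t) :=
  tderiv_comp_dmap ((he.contMDiff _).mdifferentiableAt one_ne_zero)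
    (((h.contMDiff.iterate n) _).mdifferentiableAt one_ne_zero) t

/-- The uniform contraction of the stable subspaces. -/
lemma exists_norm_vderiv_le (h : IsDominatedPair f f' Es Ec Eu l l' μ' μ C)
    (he : IsC1Immersion (m := m) e) : ∃ B : ℝ, 0 < B ∧ ∀ n x, ∀ v ∈ embSub e Es x,
      ‖vderiv m e (e ∘ f^[n]) x v‖ ≤ B * l ^ n * ‖v‖ := by
  obtain ⟨K, hK, hKe⟩ := he.exists_rnorm_equiv
  have hC := h.C_pos
  have hl := h.l_pos
  refine ⟨K * C * K, by positivity, fun n x v hv => ?_⟩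
  obtain ⟨t, ht, rfl⟩ := mem_embSub.1 hv
  rw [he.vderiv_tderiv, h.tderiv_iterate he]
  have h1 := (hKe x).1 (tderiv e x t)
  rw [he.embInv_tderiv] at h1
  calc _ ≤ K * rnorm (m := m) (f^[n] x) (dmap m f^[n] x t) := (hKe _).2 _
    _ ≤ K * (C * l ^ n * rnorm (m := m) x t) := by gcongr; exact h.norm_s_le n x t ht
    _ ≤ K * (C * l ^ n * (K * ‖tderiv (m := m) e x t‖)) := by gcongr
    _ = _ := by ring

/-- The stable subspaces form a closed set, since they are characterized by the growth rate of
their vectors. -/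
lemma isClosed_embSub (h : IsDominatedPair f f' Es Ec Eu l l' μ' μ C)
    (he : IsC1Immersion (m := m) e) : IsClosed {z : M × V | z.2 ∈ embSub e Es z.1} := by
  obtain ⟨K, hK, hKe⟩ := he.exists_rnorm_equiv
  obtain ⟨B, hB, hb⟩ := h.exists_norm_vderiv_le he
  have hC := h.C_pos
  have hl := h.l_pos
  have hl' := hl.trans h.l_lt
  have hcont : ∀ F : M → V, ContMDiff (𝓡 m) 𝓘(ℝ, V) 1 F →
      Continuous fun z : M × V => vderiv m e F z.1 z.2 := fun F hF => by
    have : Continuous (vderiv m e F) := continuous_iff_continuousAt.2 fun x =>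
      he.continuousAt_vderiv (hF x)
    fun_prop
  -- Tangent vectors are stable if and only if they are contracted at the rate `l` with the uniform
  -- constant `B`; this is an intersection of closed conditions.
  have hset : {z : M × V | z.2 ∈ embSub e Es z.1} = {z : M × V | vderiv m e e z.1 z.2 = z.2} ∩
      ⋂ n : ℕ, {z : M × V | ‖vderiv m e (e ∘ f^[n]) z.1 z.2‖ ≤ B * l ^ n * ‖z.2‖} := by
    ext ⟨x, v⟩
    simp only [mem_inter_iff, mem_iInter, mem_ofPred_eq]
    constructor
    · intro hv
      refine ⟨?_, fun n => hb n x v hv⟩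
      obtain ⟨t, ht, rfl⟩ := mem_embSub.1 hv
      rw [he.vderiv_tderiv]
    · rintro ⟨h1, h2⟩
      obtain ⟨s, hs, c, hc, u, hu, hsum⟩ := h.exists_decomp x (embInv e x v)
      have hdec : ∀ n, tderiv (e ∘ f^[n]) x s + tderiv (e ∘ f^[n]) x c + tderiv (e ∘ f^[n]) x u
          = vderiv m e (e ∘ f^[n]) x v := fun n => by
        rw [← map_add, ← map_add, hsum, vderiv_apply]
      have hlow : ∀ (y : M) (w : 𝔼), K⁻¹ * rnorm (m := m) y w ≤ ‖tderiv (m := m) e y w‖ :=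
        fun y w => by
          have h1 := (hKe y).1 (tderiv e y w)
          rw [he.embInv_tderiv] at h1
          rwa [inv_mul_le_iff₀ hK]
      have hr : ∀ w : 𝔼, 0 ≤ rnorm (m := m) x w := fun w => rnorm_nonneg _ _
      have key := eq_zero_of_norm_sum_le (s := fun n => tderiv (m := m) (e ∘ f^[n]) x s)
        (c := fun n => tderiv (m := m) (e ∘ f^[n]) x c)
        (u := fun n => tderiv (m := m) (e ∘ f^[n]) x u)
        (B := K * C * rnorm (m := m) x s + B * ‖v‖) (a := K⁻¹ * C⁻¹ * rnorm (m := m) x c)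
        (a' := K * C * rnorm (m := m) x c) (b := K⁻¹ * C⁻¹ * rnorm (m := m) x u) hl h.l_lt h.l'_le
        h.μ'_lt (fun n => ?_) (fun n => ?_) (fun n => ?_) (fun n => ?_) ?_ (fun n => ?_)
      · have hKC : 0 < K⁻¹ * C⁻¹ := by positivity
        have hu0 : u = 0 := eq_zero_of_rnorm_eq_zero (m := m) (x := x)
          (le_antisymm (nonpos_of_mul_nonpos_right key.1 hKC) (hr u))
        have hc0 : c = 0 := eq_zero_of_rnorm_eq_zero (m := m) (x := x)
          (le_antisymm (nonpos_of_mul_nonpos_right (key.2 (by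
            funext n; simp only [hu0, map_zero, Pi.zero_apply])) hKC) (hr c))
        rw [hu0, hc0, add_zero, add_zero] at hsum
        rw [vderiv_apply, ← hsum] at h1
        exact mem_embSub.2 ⟨s, hs, h1⟩
      · rw [h.tderiv_iterate he]
        calc _ ≤ K * rnorm (m := m) (f^[n] x) (dmap m f^[n] x s) := (hKe _).2 _
          _ ≤ K * (C * l ^ n * rnorm (m := m) x s) := by gcongr; exact h.norm_s_le n x s hs
          _ = K * C * rnorm (m := m) x s * l ^ n := by ring
          _ ≤ _ := by
            have : 0 ≤ B * ‖v‖ := by positivity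
            gcongr
            linarith
      · rw [h.tderiv_iterate he]
        refine le_trans (le_of_eq ?_) ((mul_le_mul_of_nonneg_left (h.le_norm_c n x c hc)
          (inv_pos.2 hK).le).trans (hlow _ _))
        ring
      · rw [h.tderiv_iterate he]
        calc _ ≤ K * rnorm (m := m) (f^[n] x) (dmap m f^[n] x c) := (hKe _).2 _
          _ ≤ K * (C * μ' ^ n * rnorm (m := m) x c) := by gcongr; exact h.norm_c_le n x c hc
          _ = _ := by ring
      · rw [h.tderiv_iterate he]
        refine le_trans (le_of_eq ?_) ((mul_le_mul_of_nonneg_left (h.le_norm_u n x u hu)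
          (inv_pos.2 hK).le).trans (hlow _ _))
        ring
      · have := hr s
        positivity
      · rw [hdec n]
        refine (h2 n).trans ?_
        have : 0 ≤ K * C * rnorm (m := m) x s * l ^ n := by
          have := hr s
          positivity
        linarith
  rw [hset]
  refine (isClosed_eq (hcont e he.contMDiff) continuous_snd).inter
    (isClosed_iInter fun n => isClosed_le (hcont _ ?_).norm (by fun_prop))
  exact he.contMDiff.comp (h.contMDiff.iterate n)

end IsDominatedPair

/-- The center subspaces, enlarged by the kernels of `embInv`, form a closed set: in a foliation chart
they are the kernels of the derivatives of the transverse coordinates. -/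
lemma isClosed_center {m k q : ℕ} {M : Type*} [EMetricSpace M]
    [ChartedSpace (EuclideanSpace ℝ (Fin m)) M] [IsManifold (𝓡 m) ∞ M] [CompactSpace M]
    {e : M → V} (he : IsC1Immersion (m := m) e)
    {Ec : M → Submodule ℝ (EuclideanSpace ℝ (Fin m))} {W : C1Foliation m k q M}
    (hW : W.IsTangentTo Ec) : IsClosed {z : M × V | embInv e z.1 z.2 ∈ Ec z.1} := by
  rw [← isOpen_compl_iff, isOpen_iff_mem_nhds]
  rintro ⟨x, v⟩ hx
  obtain ⟨φ, hφ, hxφ⟩ := W.covers x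
  have h1 : ContinuousAt (vderiv m e φ) x := he.continuousAt_vderiv
    ((W.contMDiffOn φ hφ).contMDiffAt (φ.open_source.mem_nhds hxφ))
  have h2 : ContinuousAt (fun z : M × V => (vderiv m e φ z.1 z.2).2) (x, v) := by
    have h3 : ContinuousAt (fun z : M × V => vderiv m e φ z.1) (x, v) :=
      ContinuousAt.comp (g := vderiv m e φ) (f := Prod.fst) h1 continuousAt_fst
    exact (h3.clm_apply continuousAt_snd).snd
  have h3 : (vderiv m e φ x v).2 ≠ 0 := fun h0 => hx ((hW φ hφ x hxφ _).2 h0)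
  filter_upwards [h2.eventually_ne h3, continuousAt_fst.eventually (φ.open_source.mem_nhds hxφ)]
    with z hz hzφ hmem
  exact hz ((hW φ hφ z.1 hzφ _).1 hmem)

/-- The continuous projections of `V` onto the stable and the unstable subspaces, along the sum of
the center subspaces and the normal spaces. -/
lemma IsDominatedPair.exists_projections {k q : ℕ} {f f' : M → M}
    {Es Ec Eu : M → Submodule ℝ (EuclideanSpace ℝ (Fin m))} {l l' μ' μ C : ℝ} {e : M → V}
    (h : IsDominatedPair f f' Es Ec Eu l l' μ' μ C)
    (he : IsC1Immersion (m := m) e) {W : C1Foliation m k q M} (hW : W.IsTangentTo Ec) :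
    ∃ Ps Pu : M → V →L[ℝ] V, Continuous Ps ∧ Continuous Pu ∧ (∀ x v, Ps x v ∈ embSub e Es x) ∧
      (∀ x v, Pu x v ∈ embSub e Eu x) ∧ (∀ x v, embInv e x (v - (Ps x v + Pu x v)) ∈ Ec x) ∧
      ∀ x, ∀ s ∈ embSub e Es x, ∀ u ∈ embSub e Eu x, ∀ w, embInv e x w ∈ Ec x →
        Ps x (s + u + w) = s ∧ Pu x (s + u + w) = u := by
  have hind : ∀ x, ∀ s ∈ embSub e Es x, ∀ u ∈ embSub e Eu x,
      s + u ∈ (Ec x).comap (embInv e x).toLinearMap → s = 0 ∧ u = 0 := by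
    rintro x s hs u hu hsu
    obtain ⟨s, hs₁, rfl⟩ := mem_embSub.1 hs
    obtain ⟨u, hu₁, rfl⟩ := mem_embSub.1 hu
    have hsu' : embInv e x (tderiv e x s + tderiv e x u) ∈ Ec x := hsu
    rw [map_add, he.embInv_tderiv, he.embInv_tderiv] at hsu'
    obtain ⟨rfl, -, rfl⟩ := h.indep x s hs₁ _ ((Ec x).neg_mem hsu') u hu₁ (by abel)
    simp
  obtain ⟨Ps, Pu, h1, h2, h3, h4, h5⟩ := exists_continuous_projections
    (S := embSub e Es) (U := embSub e Eu) (F := fun x => (Ec x).comap (embInv e x).toLinearMap)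
    (h.isClosed_embSub he) (h.symm.isClosed_embSub he) (isClosed_center he hW) (fun x v => by
      obtain ⟨s, hs, c, hc, u, hu, hsum⟩ := h.exists_decomp x (embInv e x v)
      refine ⟨_, mem_embSub.2 ⟨s, hs, rfl⟩, _, mem_embSub.2 ⟨u, hu, rfl⟩, ?_⟩
      change embInv e x (v - tderiv e x s - tderiv e x u) ∈ Ec x
      rw [map_sub, map_sub, he.embInv_tderiv, he.embInv_tderiv, ← hsum]
      convert hc using 1
      abel) hind
  refine ⟨Ps, Pu, h1, h2, h3, h4, fun x v => ?_, fun x s hs u hu w hw => ?_⟩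
  · have := h5 x v
    rw [sub_sub] at this
    exact this
  · have h6 := hind x _ ((embSub e Es x).sub_mem hs (h3 x (s + u + w))) _
      ((embSub e Eu x).sub_mem hu (h4 x (s + u + w))) (by
        have := ((Ec x).comap (embInv e x).toLinearMap).sub_mem (h5 x (s + u + w))
          (show w ∈ (Ec x).comap (embInv e x).toLinearMap from hw)
        convert this using 1
        abel)
    exact ⟨(sub_eq_zero.1 h6.1).symm, (sub_eq_zero.1 h6.2).symm⟩

/-- The family `(θ⁻ʲ • A j x ∘ P x)_{j < N}`, whose norm is an adapted norm on the range of `P x`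
when `A j` is the `j`-th iterate of a cocycle that is eventually contracted with a rate less
than `θ`. -/
def adaptedMap {M V : Type*} [NormedAddCommGroup V] [NormedSpace ℝ V] (A : ℕ → M → V →L[ℝ] V)
    (P : M → V →L[ℝ] V) (θ : ℝ) (N : ℕ) (x : M) : V →L[ℝ] (Fin N → V) :=
  ContinuousLinearMap.pi fun j : Fin N => (θ⁻¹ ^ (j : ℕ)) • (A j x ∘L P x)

section Adapted

variable {M V : Type*} [NormedAddCommGroup V] [NormedSpace ℝ V] {A : ℕ → M → V →L[ℝ] V}
  {P : M → V →L[ℝ] V} {θ : ℝ} {N : ℕ}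

lemma adaptedMap_apply (x : M) (v : V) (j : Fin N) :
    adaptedMap A P θ N x v j = (θ⁻¹ ^ (j : ℕ)) • A j x (P x v) := rfl

lemma norm_le_norm_adaptedMap (hN : 0 < N) (x : M) (v : V) (h0 : A 0 x (P x v) = P x v) :
    ‖P x v‖ ≤ ‖adaptedMap A P θ N x v‖ := by
  have := norm_le_pi_norm (adaptedMap A P θ N x v) ⟨0, hN⟩
  simpa [adaptedMap_apply, h0] using this

lemma norm_adaptedMap_le {f : M → M} (hN : 0 < N) (hθ : 0 < θ) (x : M) (v w : V)
    (h0 : A 0 x (P x v) = P x v) (hA : ∀ j, A j (f x) (P (f x) w) = A (j + 1) x (P x v))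
    (hb : ‖A N x (P x v)‖ ≤ θ ^ N * ‖P x v‖) :
    ‖adaptedMap A P θ N (f x) w‖ ≤ θ * ‖adaptedMap A P θ N x v‖ := by
  refine (pi_norm_le_iff_of_nonneg (by positivity)).2 fun j => ?_
  rw [adaptedMap_apply, hA, norm_smul, Real.norm_of_nonneg (by positivity)]
  have h1 : θ⁻¹ ^ (j : ℕ) = θ * θ⁻¹ ^ ((j : ℕ) + 1) := by
    rw [pow_succ]; field_simp
  rw [h1, mul_assoc]
  refine mul_le_mul_of_nonneg_left ?_ hθ.le
  rcases Nat.lt_or_ge ((j : ℕ) + 1) N with hj | hj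
  · have := norm_le_pi_norm (adaptedMap A P θ N x v) ⟨(j : ℕ) + 1, hj⟩
    rwa [adaptedMap_apply, norm_smul, Real.norm_of_nonneg (by positivity)] at this
  · have hjN : (j : ℕ) + 1 = N := le_antisymm j.2 hj
    rw [hjN, inv_pow, inv_mul_le_iff₀ (by positivity)]
    refine hb.trans ?_
    gcongr
    exact norm_le_norm_adaptedMap hN x v h0

lemma continuous_adaptedMap [TopologicalSpace M] [FiniteDimensional ℝ V]
    (hA : ∀ n, Continuous (A n)) (hP : Continuous P) : Continuous (adaptedMap A P θ N) := by
  rw [continuous_clm_apply]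
  refine fun v => continuous_pi fun j => ?_
  simp only [adaptedMap_apply]
  have := hA j
  fun_prop

end Adapted

/-- The action of a partially hyperbolic diffeomorphism on the sum of the stable and the unstable
bundles is a hyperbolic cocycle. -/
theorem IsDominatedPair.exists_isHyperbolicCocycle {k q : ℕ} {f f' : M → M}
    {Es Ec Eu : M → Submodule ℝ (EuclideanSpace ℝ (Fin m))} {l l' μ' μ C : ℝ} {e : M → V}
    (h : IsDominatedPair f f' Es Ec Eu l l' μ' μ C)
    (he : IsC1Immersion (m := m) e) {W : C1Foliation m k q M} (hW : W.IsTangentTo Ec) :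
    ∃ (Ps Pu : M → V →L[ℝ] V) (N : ℕ) (Di : M → V →L[ℝ] V) (Js Ju : M → V →L[ℝ] (Fin N → V))
      (θ : ℝ),
      IsHyperbolicCocycle f Ps Pu (fun x => vderiv m e (e ∘ f) x ∘L (Ps x + Pu x)) Di Js Ju θ ∧
      (∀ x v, embInv e x (v - (Ps x v + Pu x v)) ∈ Ec x) ∧
      (∀ x v, ∃ t ∈ Es x ⊔ Eu x, Ps x v + Pu x v = tderiv e x t) ∧
      ∀ x, ∀ t ∈ Es x ⊔ Eu x, Ps x (tderiv e x t) + Pu x (tderiv e x t) = tderiv e x t := by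
  obtain ⟨Ps, Pu, hPs, hPu, hS, hU, hF, hproj⟩ := h.exists_projections he hW
  obtain ⟨B, hB, hb⟩ := h.exists_norm_vderiv_le he
  obtain ⟨B', hB', hb'⟩ := h.symm.exists_norm_vderiv_le he
  have hl := h.l_pos
  have hμ : 0 < μ⁻¹ := h.symm.l_pos
  obtain ⟨θ, hθ, hθ1⟩ := exists_between (max_lt h.l_lt_one h.symm.l_lt_one)
  have hθl : l < θ := (le_max_left _ _).trans_lt hθ
  have hθμ : μ⁻¹ < θ := (le_max_right _ _).trans_lt hθ
  have hθ0 : 0 < θ := hl.trans hθl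
  -- `N` iterates absorb the constants `B` and `B'`, at the cost of the larger rate `θ`.
  have hN : ∃ N : ℕ, 0 < N ∧ B * l ^ N ≤ θ ^ N ∧ B' * μ⁻¹ ^ N ≤ θ ^ N := by
    have key : ∀ b a : ℝ, 0 < a → a < θ → ∀ᶠ N : ℕ in atTop, b * a ^ N ≤ θ ^ N :=
      fun b a ha haθ => by
        have h1 : Tendsto (fun n : ℕ => b * (a / θ) ^ n) atTop (𝓝 (b * 0)) :=
          (tendsto_pow_atTop_nhds_zero_of_lt_one (by positivity)
            ((div_lt_one hθ0).2 haθ)).const_mul b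
        rw [mul_zero] at h1
        filter_upwards [h1.eventually (gt_mem_nhds one_pos)] with n hn
        rw [div_pow, mul_div_assoc', div_lt_one (by positivity)] at hn
        exact hn.le
    obtain ⟨N, h1, h2, h3⟩ := ((eventually_gt_atTop 0).and ((key B l hl hθl).and
      (key B' μ⁻¹ hμ hθμ))).exists
    exact ⟨N, h1, h2, h3⟩
  obtain ⟨N, hN0, hN1, hN2⟩ := hN
  have z1 : ∀ x, ∀ s ∈ embSub e Es x, Ps x s = s ∧ Pu x s = 0 := fun x s hs => by
    have := hproj x s hs 0 (Submodule.zero_mem _) 0 (by rw [map_zero]; exact (Ec x).zero_mem)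
    simpa using this
  have z2 : ∀ x, ∀ u ∈ embSub e Eu x, Ps x u = 0 ∧ Pu x u = u := fun x u hu => by
    have := hproj x 0 (Submodule.zero_mem _) u hu 0 (by rw [map_zero]; exact (Ec x).zero_mem)
    simpa using this
  have hef : ContMDiff (𝓡 m) 𝓘(ℝ, V) 1 (e ∘ f) := he.contMDiff.comp h.contMDiff
  have hef' : ContMDiff (𝓡 m) 𝓘(ℝ, V) 1 (e ∘ f') := he.contMDiff.comp h.contMDiff_inv
  have hcont : ∀ F : M → V, ContMDiff (𝓡 m) 𝓘(ℝ, V) 1 F → Continuous (vderiv m e F) := fun F hF =>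
    continuous_iff_continuousAt.2 fun x => he.continuousAt_vderiv (hF x)
  have hmap : ∀ {g g' : M → M} {E : M → Submodule ℝ 𝔼} (hg : ContMDiff (𝓡 m) (𝓡 m) 1 g),
      (∀ x, ∀ t ∈ E x, dmap m g x t ∈ E (g x)) → ∀ x, ∀ v ∈ embSub e E x,
      vderiv m e (e ∘ g) x v ∈ embSub e E (g x) := fun {g g' E} hg hE x v hv => by
    obtain ⟨t, ht, rfl⟩ := mem_embSub.1 hv
    rw [he.vderiv_tderiv, tderiv_comp_dmap ((he.contMDiff _).mdifferentiableAt one_ne_zero)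
      ((hg x).mdifferentiableAt one_ne_zero)]
    exact mem_embSub.2 ⟨_, hE x t ht, rfl⟩
  have hself : ∀ {E : M → Submodule ℝ 𝔼} x, ∀ v ∈ embSub e E x, vderiv m e (e ∘ id) x v = v :=
    fun {E} x v hv => by
      obtain ⟨t, ht, rfl⟩ := mem_embSub.1 hv
      rw [he.vderiv_tderiv]; rfl
  have hDs := fun x v hv => hmap (g' := f') h.contMDiff h.map_s x v hv
  have hDu := fun x v hv => hmap (g' := f') h.contMDiff h.map_u x v hv
  have hDu' := fun x v hv => hmap (g' := f) h.contMDiff_inv h.inv_u x v hv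
  have hcomp : ∀ {g : M → M} (hg : ContMDiff (𝓡 m) (𝓡 m) 1 g) (j : ℕ) (x : M) (v : V),
      vderiv m e (e ∘ g^[j + 1]) x v
        = vderiv m e (e ∘ g^[j]) (g x) (vderiv m e (e ∘ g) x v) := fun {g} hg j x v => by
    rw [Function.iterate_succ, ← Function.comp_assoc,
      he.vderiv_comp ((hg x).mdifferentiableAt one_ne_zero)
        (((he.contMDiff.comp (hg.iterate j)) _).mdifferentiableAt one_ne_zero)]
    rfl
  have hinv : ∀ {g g' : M → M} (hg : ContMDiff (𝓡 m) (𝓡 m) 1 g)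
      (hg' : ContMDiff (𝓡 m) (𝓡 m) 1 g') (hgg : ∀ x, g' (g x) = x) {E : M → Submodule ℝ 𝔼} x,
      ∀ v ∈ embSub e E x, vderiv m e (e ∘ g') (g x) (vderiv m e (e ∘ g) x v) = v :=
    fun {g g'} hg hg' hgg {E} x v hv => by
      have h1 := he.vderiv_comp (F := e ∘ g') (f := g) (x := x)
        ((hg x).mdifferentiableAt one_ne_zero)
        (((he.contMDiff.comp hg') _).mdifferentiableAt one_ne_zero)
      rw [Function.comp_assoc, show g' ∘ g = id from funext hgg] at h1
      rw [← ContinuousLinearMap.comp_apply, ← h1, hself x v hv]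
  have hPD : ∀ x v, Ps (f x) (vderiv m e (e ∘ f) x (Ps x v + Pu x v))
      = vderiv m e (e ∘ f) x (Ps x v) ∧ Pu (f x) (vderiv m e (e ∘ f) x (Ps x v + Pu x v))
      = vderiv m e (e ∘ f) x (Pu x v) := fun x v => by
    have := hproj (f x) _ (hDs x _ (hS x v)) _ (hDu x _ (hU x v)) 0
      (by rw [map_zero]; exact (Ec _).zero_mem)
    rwa [add_zero, ← map_add] at this
  refine ⟨Ps, Pu, N, fun x => vderiv m e (e ∘ f') x ∘L Pu x,
    adaptedMap (fun n => vderiv m e (e ∘ f^[n])) Ps θ N,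
    adaptedMap (fun n => vderiv m e (e ∘ f'^[n])) Pu θ N, θ,
    { continuous_Ps := hPs
      continuous_Pu := hPu
      continuous_D := (hcont _ hef).clm_comp (hPs.add hPu)
      continuous_Di := (hcont _ hef').clm_comp hPu
      continuous_Js := continuous_adaptedMap (fun n =>
        hcont _ (he.contMDiff.comp (h.contMDiff.iterate n))) hPs
      continuous_Ju := continuous_adaptedMap (fun n =>
        hcont _ (he.contMDiff.comp (h.contMDiff_inv.iterate n))) hPu
      θ_nonneg := hθ0.le
      θ_lt_one := hθ1
      Ps_Ps := fun x v => (z1 x _ (hS x v)).1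
      Pu_Pu := fun x v => (z2 x _ (hU x v)).2
      Ps_Pu := fun x v => (z2 x _ (hU x v)).1
      Pu_Ps := fun x v => (z1 x _ (hS x v)).2
      Js_Ps := fun x v => funext fun j => by
        rw [adaptedMap_apply, adaptedMap_apply, (z1 x _ (hS x v)).1]
      Ju_Pu := fun x v => funext fun j => by
        rw [adaptedMap_apply, adaptedMap_apply, (z2 x _ (hU x v)).2]
      norm_Ps_le := fun x v => norm_le_norm_adaptedMap hN0 x v (hself x _ (hS x v))
      norm_Pu_le := fun x v => norm_le_norm_adaptedMap hN0 x v (hself x _ (hU x v))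
      Js_D := fun x v => norm_adaptedMap_le hN0 hθ0 x v _ (hself x _ (hS x v)) (fun j => by
          rw [hcomp h.contMDiff, ← (hPD x v).1]; rfl)
        ((hb N x _ (hS x v)).trans (by gcongr))
      Ju_Di := fun x v => by
        have := norm_adaptedMap_le (A := fun n => vderiv m e (e ∘ f'^[n])) (P := Pu) (f := f')
          hN0 hθ0 (f x) v (vderiv m e (e ∘ f') (f x) (Pu (f x) v)) (hself _ _ (hU _ v)) (fun j => by
            rw [hcomp h.contMDiff_inv, (z2 _ _ (hDu' _ _ (hU (f x) v))).2])
          ((hb' N _ _ (hU _ v)).trans (by gcongr))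
        rw [h.left_inv] at this
        exact this
      Di_Pu := fun x v => by
        simp only [ContinuousLinearMap.comp_apply, (z2 x _ (hU x v)).2]
      Pu_Di := fun x v => by
        have := (z2 _ _ (hDu' _ _ (hU (f x) v))).2
        rw [h.left_inv] at this
        exact this
      Di_D := fun x v => by
        change vderiv m e (e ∘ f') (f x) (Pu (f x) (vderiv m e (e ∘ f) x (Ps x v + Pu x v))) = _
        rw [(hPD x v).2]
        exact hinv h.contMDiff h.contMDiff_inv h.left_inv x _ (hU x v)
      D_Di := fun x v => by
        have h1 := hDu' _ _ (hU (f x) v)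
        have h2 := hinv h.contMDiff_inv h.contMDiff h.right_inv (f x) _ (hU (f x) v)
        rw [h.left_inv] at h1 h2
        change vderiv m e (e ∘ f) x (Ps x (vderiv m e (e ∘ f') (f x) (Pu (f x) v))
          + Pu x (vderiv m e (e ∘ f') (f x) (Pu (f x) v))) = _
        rw [(z2 _ _ h1).1, (z2 _ _ h1).2, zero_add, h2] }, hF, fun x v => ?_, fun x t ht => ?_⟩
  · obtain ⟨s, hs, hs'⟩ := mem_embSub.1 (hS x v)
    obtain ⟨u, hu, hu'⟩ := mem_embSub.1 (hU x v)
    exact ⟨s + u, Submodule.add_mem_sup hs hu, by rw [map_add, hs', hu']⟩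
  · obtain ⟨s, hs, u, hu, rfl⟩ := Submodule.mem_sup.1 ht
    have hs' := z1 x _ (mem_embSub.2 ⟨s, hs, rfl⟩)
    have hu' := z2 x _ (mem_embSub.2 ⟨u, hu, rfl⟩)
    simp only [map_add, hs'.1, hs'.2, hu'.1, hu'.2]
    abel

end Splitting

/-! ### Right inverses, plaques and the injectivity radius -/

section LocalInverse

/-- A `C^1` map which is close to the identity on a ball has a `C^1` right inverse there. -/
lemma exists_contDiffAt_rightInverse {X : Type*} [NormedAddCommGroup X] [NormedSpace ℝ X]
    [FiniteDimensional ℝ X] {G : X → X} {s : ℝ} (hs : 0 < s)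
    (hG : ∀ ξ ∈ Metric.ball (0 : X) s, ContDiffAt ℝ 1 G ξ)
    (hlip : ∀ ξ ∈ Metric.ball (0 : X) s, ∀ ξ' ∈ Metric.ball (0 : X) s,
      ‖G ξ - G ξ' - (ξ - ξ')‖ ≤ 1 / 2 * ‖ξ - ξ'‖) :
    ∃ I : X → X, ∀ y ∈ Metric.ball (G 0) (s / 4),
      ‖I y‖ ≤ 2 * ‖y - G 0‖ ∧ G (I y) = y ∧ ContDiffAt ℝ 1 I y := by
  have := FiniteDimensional.complete ℝ X
  have happ : ApproximatesLinearOn G ((ContinuousLinearEquiv.refl ℝ X : X ≃L[ℝ] X) : X →L[ℝ] X)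
      (Metric.ball 0 s) (1 / 2 : NNReal) := fun ξ hξ ξ' hξ' => by simpa using hlip ξ hξ ξ' hξ'
  have hc : Subsingleton X ∨ (1 / 2 : NNReal)
      < ‖((ContinuousLinearEquiv.refl ℝ X).symm : X →L[ℝ] X)‖₊⁻¹ := by
    rcases subsingleton_or_nontrivial X with h | h
    · exact Or.inl h
    · right
      have h1 : ‖((ContinuousLinearEquiv.refl ℝ X).symm : X →L[ℝ] X)‖₊ = 1 :=
        NNReal.eq (ContinuousLinearMap.norm_id (𝕜 := ℝ) (E := X))
      rw [h1, inv_one]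
      exact NNReal.coe_lt_coe.1 (by push_cast; norm_num)
  set Φ := happ.toOpenPartialHomeomorph G _ hc Metric.isOpen_ball with hΦ
  -- The right inverse with constant `1`, which unlike the norm of the identity does not vanish
  -- when the space is trivial.
  let R : ((ContinuousLinearEquiv.refl ℝ X : X ≃L[ℝ] X) : X →L[ℝ] X).NonlinearRightInverse :=
    ⟨id, 1, fun y => by simp, fun y => rfl⟩
  have htar : ∀ y ∈ Metric.ball (G 0) (s / 4), y ∈ Φ.target := fun y hy => by
    have h1 := happ.surjOn_closedBall_of_nonlinearRightInverse R (ε := s / 2) (b := 0)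
      (by positivity) (Metric.closedBall_subset_ball (by linarith))
    have h2 : y ∈ Metric.closedBall (G 0) (((R.nnnorm : ℝ)⁻¹ - (1 / 2 : NNReal)) * (s / 2)) := by
      rw [Metric.mem_closedBall]
      refine (Metric.mem_ball.1 hy).le.trans (le_of_eq ?_)
      change s / 4 = (((1 : NNReal) : ℝ)⁻¹ - ((1 / 2 : NNReal) : ℝ)) * (s / 2)
      push_cast
      ring
    obtain ⟨ξ, hξ, hξy⟩ := h1 h2
    exact ⟨ξ, Metric.closedBall_subset_ball (by linarith) hξ, hξy⟩
  refine ⟨Φ.symm, fun y hy => ?_⟩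
  have hy1 : Φ.symm y ∈ Metric.ball (0 : X) s := Φ.map_target (htar y hy)
  have hy2 : G (Φ.symm y) = y := Φ.right_inv (htar y hy)
  refine ⟨?_, hy2, ?_⟩
  · have h1 := hlip _ hy1 0 (Metric.mem_ball_self hs)
    rw [hy2, sub_zero] at h1
    have h2 := norm_sub_norm_le (Φ.symm y) (y - G 0)
    rw [norm_sub_rev (Φ.symm y)] at h2
    linarith
  · have hd := (hG _ hy1).differentiableAt one_ne_zero
    set T := fderiv ℝ G (Φ.symm y) with hT
    have hle : ‖T - ContinuousLinearMap.id ℝ X‖ ≤ 1 / 2 := by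
      refine (hd.hasFDerivAt.sub (hasFDerivAt_id _)).le_of_lip' (by norm_num) ?_
      filter_upwards [Metric.isOpen_ball.mem_nhds hy1] with ξ hξ
      have := hlip ξ hξ _ hy1
      simp only [Pi.sub_apply, id]
      convert this using 2
      abel
    have hinj : Function.Injective T := by
      rw [injective_iff_map_eq_zero]
      intro v hv
      have h1 := (T - ContinuousLinearMap.id ℝ X).le_of_opNorm_le hle v
      rw [sub_apply, hv, zero_sub, norm_neg, ContinuousLinearMap.id_apply] at h1
      exact norm_le_zero_iff.1 (by linarith [norm_nonneg v])
    let A : X ≃L[ℝ] X := (LinearEquiv.ofInjectiveEndo T.toLinearMap hinj).toContinuousLinearEquiv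
    refine Φ.contDiffAt_symm (htar y hy) (f₀' := A) ?_ (hG _ hy1)
    have h1 : (A : X →L[ℝ] X) = T := by ext v; rfl
    rw [h1]
    exact hd.hasFDerivAt

end LocalInverse

section Leaf

variable {m k q : ℕ} {M : Type*} [TopologicalSpace M]
  [ChartedSpace (EuclideanSpace ℝ (Fin m)) M]

lemma C1Foliation.leafIn_mono (W : C1Foliation m k q M) {U U' : Set M} (h : U ⊆ U') (y : M) :
    W.leafIn U y ⊆ W.leafIn U' y := by
  rintro z ⟨γ, hγ⟩
  exact ⟨γ, fun t => ⟨h (hγ t).1, (hγ t).2⟩⟩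

lemma C1Foliation.mem_of_mem_leafIn {W : C1Foliation m k q M} {U : Set M} {y z : M}
    (h : z ∈ W.leafIn U y) : y ∈ U ∧ z ∈ U := by
  obtain ⟨γ, hγ⟩ := h
  have h0 := (hγ 0).1
  have h1 := (hγ 1).1
  rw [γ.source] at h0
  rw [γ.target] at h1
  exact ⟨h0, h1⟩

/-- The transverse coordinates in a foliation chart. -/
def transv (φ : OpenPartialHomeomorph M (EuclideanSpace ℝ (Fin k) × EuclideanSpace ℝ (Fin q)))
    (y : M) : EuclideanSpace ℝ (Fin q) := (φ y).2

/-- On a local leaf inside a foliation chart the transverse coordinates are constant. -/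
lemma C1Foliation.transv_eq_of_mem_leafIn {W : C1Foliation m k q M} {U : Set M} {y z : M}
    (h : z ∈ W.leafIn U y) {φ} (hφ : φ ∈ W.charts) (hU : U ⊆ φ.source) :
    transv φ z = transv φ y := by
  obtain ⟨γ, hγ⟩ := h
  have hconst : IsLocallyConstant fun t => transv φ (γ t) := by
    rw [IsLocallyConstant.iff_eventually_eq]
    intro t
    obtain ⟨ht, χ, hχ, htχ, hev⟩ := hγ t
    obtain ⟨h, hh⟩ := W.compatible χ hχ φ hφ (γ t) ⟨htχ, hU ht⟩
    filter_upwards [hev, γ.continuous.continuousAt.eventually hh] with s hs hs'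
    rw [transv, transv, hs', hs, hh.self_of_nhds]
  have := hconst.apply_eq_of_isPreconnected isPreconnected_univ (mem_univ 1) (mem_univ 0)
  simpa using this

/-- Two points whose images in a foliation chart are joined by a straight segment in a leaf. -/
lemma C1Foliation.mem_leafIn_of_segment {W : C1Foliation m k q M} {U : Set M} {y z : M} {φ}
    (hφ : φ ∈ W.charts) (hy : y ∈ φ.source) (hz : z ∈ φ.source) (htr : transv φ z = transv φ y)
    {B : Set (EuclideanSpace ℝ (Fin k) × EuclideanSpace ℝ (Fin q))} (hB : Convex ℝ B)
    (hBt : B ⊆ φ.target) (hBU : ∀ p ∈ B, φ.symm p ∈ U) (hyB : φ y ∈ B) (hzB : φ z ∈ B) :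
    z ∈ W.leafIn U y := by
  set c : unitInterval → EuclideanSpace ℝ (Fin k) × EuclideanSpace ℝ (Fin q) :=
    fun t => AffineMap.lineMap (φ y) (φ z) (t : ℝ) with hc
  have hcB : ∀ t, c t ∈ B := fun t => hB.lineMap_mem hyB hzB t.2
  have hcc : Continuous c := AffineMap.lineMap_continuous.comp continuous_subtype_val
  have hct : ∀ t, (c t).2 = (φ y).2 := fun t => by
    have h1 : (φ z).2 = (φ y).2 := htr
    simp [hc, AffineMap.lineMap_apply, h1]
  refine ⟨⟨⟨fun t => φ.symm (c t), ?_⟩, ?_, ?_⟩, fun t => ⟨hBU _ (hcB t), φ, hφ,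
    φ.map_target (hBt (hcB t)), Eventually.of_forall fun s => ?_⟩⟩
  · exact φ.continuousOn_symm.comp_continuous hcc fun t => hBt (hcB t)
  · simp [hc, φ.left_inv hy]
  · simp [hc, φ.left_inv hz]
  · change (φ (φ.symm (c s))).2 = (φ (φ.symm (c t))).2
    rw [φ.right_inv (hBt (hcB s)), φ.right_inv (hBt (hcB t)), hct, hct]

end Leaf

section ExpEmbedding

variable {m : ℕ} {M : Type*} [EMetricSpace M] [ChartedSpace (EuclideanSpace ℝ (Fin m)) M]
  [IsManifold (𝓡 m) ∞ M] [RiemannianBundle (fun x : M => TangentSpace (𝓡 m) x)]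
  [IsContMDiffRiemannianBundle (𝓡 m) ∞ (EuclideanSpace ℝ (Fin m))
  (fun x : M => TangentSpace (𝓡 m) x)] [IsRiemannianManifold (𝓡 m) M] [CompactSpace M]
  {V : Type*} [NormedAddCommGroup V] [InnerProductSpace ℝ V] [FiniteDimensional ℝ V]
  {G : Type*} [NormedAddCommGroup G] [NormedSpace ℝ G]

local notation "𝔼" => EuclideanSpace ℝ (Fin m)

/-- A `C^1` map is locally Lipschitz for the Riemannian distance. -/
lemma IsC1Immersion.exists_edist_le [CompleteSpace G] {e : M → V} (he : IsC1Immersion (m := m) e)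
    {F : M → G} {x₀ : M} (hF : ContMDiffAt (𝓡 m) 𝓘(ℝ, G) 1 F x₀) :
    ∃ C > 0, ∃ r > 0, ∀ y ∈ rBall x₀ r, ∀ z ∈ rBall x₀ r,
      edist (F y) (F z) ≤ ENNReal.ofReal C * edist y z := by
  obtain ⟨K, hK, hKe⟩ := he.exists_rnorm_equiv
  have h1 := (contMDiffAt_iff_contMDiffAt_nhds (by simp)).1 hF
  have h2 : ∀ᶠ x in 𝓝 x₀, ‖vderiv m e F x‖ < ‖vderiv m e F x₀‖ + 1 :=
    (he.continuousAt_vderiv hF).norm.eventually (gt_mem_nhds (lt_add_one _))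
  obtain ⟨r, hr, hball⟩ := EMetric.mem_nhds_iff.1 (h1.and h2)
  obtain ⟨r', hr', hrr⟩ : ∃ r' : ℝ, 0 < r' ∧ ENNReal.ofReal r' ≤ r := by
    rcases eq_or_ne r ⊤ with rfl | h
    · exact ⟨1, one_pos, le_top⟩
    · exact ⟨r.toReal, ENNReal.toReal_pos hr.ne' h, ENNReal.ofReal_toReal_le⟩
  have hb : ∀ x ∈ rBall x₀ r', ContMDiffAt (𝓡 m) 𝓘(ℝ, G) 1 F x ∧
      ‖vderiv m e F x‖ < ‖vderiv m e F x₀‖ + 1 := fun x hx => hball (lt_of_lt_of_le hx hrr)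
  -- A quarter of the radius: nearly shortest paths between points of the smaller ball stay in the
  -- larger one.
  refine ⟨(‖vderiv m e F x₀‖ + 1) * K, by positivity, r' / 4, by positivity, fun y hy z hz => ?_⟩
  refine exists_edist_le_of_contMDiffOn hr' (fun x hx => (hb x hx).1.contMDiffWithinAt)
    (fun x hx v => ?_) (by positivity) ?_ ?_
  · rw [← he.vderiv_tderiv F x v]
    calc _ ≤ ‖vderiv m e F x‖ * ‖tderiv (m := m) e x v‖ := ContinuousLinearMap.le_opNorm _ _
      _ ≤ (‖vderiv m e F x₀‖ + 1) * (K * rnorm (m := m) x v) := by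
        gcongr
        · exact (hb x hx).2.le
        · exact (hKe x).2 v
      _ = _ := by ring
  · exact lt_of_lt_of_le hy (ENNReal.ofReal_le_ofReal (by linarith))
  · calc edist y z ≤ edist y x₀ + edist z x₀ := edist_triangle_right _ _ _
      _ < ENNReal.ofReal (r' / 4) + ENNReal.ofReal (r' / 4) := ENNReal.add_lt_add hy hz
      _ = ENNReal.ofReal (r' / 2) := by
        rw [← ENNReal.ofReal_add (by positivity) (by positivity)]; congr 1; ring

/-- On small tangent vectors at a point, the inverse of the exponential map is Lipschitz for the
Riemannian distance, with a constant that does not depend on the point. -/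
lemma IsC1Immersion.exists_norm_le_edist {e : M → V} (he : IsC1Immersion (m := m) e) :
    ∃ ρ > 0, ∀ (x : M) (v v' : V), vderiv m e e x v = v → vderiv m e e x v' = v' →
      ‖v‖ < ρ → ‖v'‖ < ρ → ENNReal.ofReal ‖v - v'‖
        ≤ ENNReal.ofReal ρ⁻¹ * edist (expV m e x v) (expV m e x v') := by
  refine exists_pos_forall_of_locally (P := fun ρ x => ∀ (v v' : V), vderiv m e e x v = v →
    vderiv m e e x v' = v' → ‖v‖ < ρ → ‖v'‖ < ρ → ENNReal.ofReal ‖v - v'‖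
        ≤ ENNReal.ofReal ρ⁻¹ * edist (expV m e x v) (expV m e x v'))
    (fun x ρ ρ' h0 h hP v v' hv hv' hvρ hvρ' =>
      (hP v v' hv hv' (hvρ.trans_le h) (hvρ'.trans_le h)).trans (by
        gcongr)) fun x₀ => ?_
  obtain ⟨K, hK, r, hr, hlip⟩ := he.exists_edist_le (he.contMDiff x₀)
  obtain ⟨ρ, hρ, hexp⟩ := he.exists_norm_comp_expV_sub_le (he.contMDiff x₀) (η := 1 / 2)
    (by norm_num)
  obtain ⟨ρ₁, hρ₁, hnear⟩ := exists_edist_expMap_le (m := m) (M := M)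
  obtain ⟨B, hB, hBe⟩ := he.exists_rnorm_equiv
  set ρ₂ := min (min ρ (ρ₁ / B)) (min (2 * K)⁻¹ (r / 2 * ρ₁ / B)) with hρ₂
  have hρ₂0 : 0 < ρ₂ := by positivity
  have hx : ∀ᶠ x in 𝓝 x₀, x ∈ rBall x₀ (r / 2) :=
    (Metric.isOpen_eball (x := x₀) (ε := ENNReal.ofReal (r / 2))).eventually_mem
      (Metric.mem_eball_self (ENNReal.ofReal_pos.2 (by positivity)))
  refine ⟨ρ₂, hρ₂0, ?_⟩
  filter_upwards [hexp, hx] with x hx hxr v v' hv hv' hvρ hvρ'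
  have hball : ∀ v : V, ‖v‖ < ρ₂ → expV m e x v ∈ rBall x₀ r := fun v hvρ => by
    have h1 : rnorm (m := m) x (embInv e x v) ≤ B * ‖v‖ := (hBe x).1 v
    have h2 : ‖v‖ < ρ₁ / B := hvρ.trans_le ((min_le_left _ _).trans (min_le_right _ _))
    have h3 : ‖v‖ < r / 2 * ρ₁ / B := hvρ.trans_le ((min_le_right _ _).trans (min_le_right _ _))
    rw [lt_div_iff₀ hB, mul_comm] at h2 h3
    have h4 := hnear x (embInv e x v) (h1.trans_lt h2)
    calc edist (expV m e x v) x₀ ≤ edist (expV m e x v) x + edist x x₀ := edist_triangle _ _ _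
      _ < ENNReal.ofReal (r / 2) + ENNReal.ofReal (r / 2) := by
        refine ENNReal.add_lt_add (h4.trans_lt ((ENNReal.ofReal_lt_ofReal_iff (by positivity)).2 ?_))
          hxr
        rw [inv_mul_lt_iff₀ hρ₁]
        linarith
      _ = ENNReal.ofReal r := by
        rw [← ENNReal.ofReal_add (by positivity) (by positivity)]; congr 1; ring
  have h1 := hx v v' (hvρ.trans_le ((min_le_left _ _).trans (min_le_left _ _)))
    (hvρ'.trans_le ((min_le_left _ _).trans (min_le_left _ _)))
  rw [map_sub, hv, hv'] at h1
  have h2 : ‖v - v'‖ ≤ 2 * ‖e (expV m e x v) - e (expV m e x v')‖ := by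
    have := norm_sub_norm_le (v - v') (e (expV m e x v) - e (expV m e x v'))
    rw [norm_sub_rev (v - v')] at this
    linarith
  have h3 := hlip _ (hball v hvρ) _ (hball v' hvρ')
  rw [edist_dist, dist_eq_norm] at h3
  calc ENNReal.ofReal ‖v - v'‖ ≤ ENNReal.ofReal (2 * ‖e (expV m e x v) - e (expV m e x v')‖) :=
        ENNReal.ofReal_le_ofReal h2
    _ = 2 * ENNReal.ofReal ‖e (expV m e x v) - e (expV m e x v')‖ := by
        rw [ENNReal.ofReal_mul (by norm_num)]; simp
    _ ≤ 2 * (ENNReal.ofReal K * edist (expV m e x v) (expV m e x v')) := by gcongr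
    _ = ENNReal.ofReal (2 * K) * edist (expV m e x v) (expV m e x v') := by
        rw [ENNReal.ofReal_mul (by norm_num), mul_assoc]; simp
    _ ≤ _ := by
        gcongr
        rw [le_inv_comm₀ (by positivity) hρ₂0]
        exact (min_le_right _ _).trans (min_le_left _ _)

lemma IsC1Immersion.vderiv_self_tderiv {e : M → V} (he : IsC1Immersion (m := m) e) (x : M) (t : 𝔼) :
    vderiv m e e x (tderiv e x t) = tderiv e x t := he.vderiv_tderiv e x t

lemma IsC1Immersion.expV_tderiv {e : M → V} (he : IsC1Immersion (m := m) e) (x : M) (t : 𝔼) :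
    expV m e x (tderiv e x t) = expMap (m := m) x t := by
  rw [expV, he.embInv_tderiv]

/-- There is a positive injectivity radius. -/
lemma IsC1Immersion.exists_isExpRadius {e : M → V} (he : IsC1Immersion (m := m) e) :
    ∃ ρ₀ > 0, ∀ ρ ≤ ρ₀, IsExpRadius m M ρ := by
  obtain ⟨K, hK, hKe⟩ := he.exists_rnorm_equiv
  obtain ⟨ρ₁, hρ₁, h1⟩ := exists_existsUnique_isExp (m := m) (M := M)
  obtain ⟨ρ₂, hρ₂, h2⟩ := he.exists_norm_le_edist
  have key : ∀ (x : M) (v v' : 𝔼), ‖tderiv (m := m) e x v‖ < ρ₂ → ‖tderiv (m := m) e x v'‖ < ρ₂ →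
      expMap (m := m) x v = expMap (m := m) x v' → v = v' := fun x v v' hv hv' hvv' => by
    have h3 := h2 x _ _ (he.vderiv_self_tderiv x v) (he.vderiv_self_tderiv x v') hv hv'
    rw [he.expV_tderiv, he.expV_tderiv, hvv', edist_self, mul_zero, nonpos_iff_eq_zero,
      ENNReal.ofReal_eq_zero] at h3
    exact he.injective x (sub_eq_zero.1 (norm_le_zero_iff.1 h3))
  refine ⟨min ρ₁ (ρ₂ / K), by positivity, fun ρ hρ x =>
    ⟨fun v hv => h1 x v (lt_of_lt_of_le hv (hρ.trans (min_le_left _ _))),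
      fun v hv v' hv' hvv' => ?_⟩⟩
  have hb : ∀ w : 𝔼, rnorm (m := m) x w < ρ → ‖tderiv (m := m) e x w‖ < ρ₂ := fun w hw => by
    refine ((hKe x).2 w).trans_lt ?_
    have := hw.trans_le (hρ.trans (min_le_right _ _))
    rwa [lt_div_iff₀ hK, mul_comm] at this
  exact key x v v' (hb v hv) (hb v' hv') hvv'

end ExpEmbedding

/-! ### Disks transverse to the foliation -/

section Balls

variable {M : Type*} [EMetricSpace M]

lemma isOpen_rBall (x : M) (r : ℝ) : IsOpen (rBall x r) := Metric.isOpen_eball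

lemma mem_rBall_self (x : M) {r : ℝ} (hr : 0 < r) : x ∈ rBall x r :=
  Metric.mem_eball_self (ENNReal.ofReal_pos.2 hr)

lemma rBall_mono (x : M) {r r' : ℝ} (h : r ≤ r') : rBall x r ⊆ rBall x r' := fun _ hy =>
  lt_of_lt_of_le hy (ENNReal.ofReal_le_ofReal h)

lemma edist_lt_ofReal_add {x y z : M} {a b : ℝ} (h1 : edist x y < ENNReal.ofReal a)
    (h2 : edist y z < ENNReal.ofReal b) : edist x z < ENNReal.ofReal (a + b) := by
  have ha : 0 < a := ENNReal.ofReal_pos.1 (pos_of_gt h1)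
  have hb : 0 < b := ENNReal.ofReal_pos.1 (pos_of_gt h2)
  rw [ENNReal.ofReal_add ha.le hb.le]
  exact (edist_triangle _ _ _).trans_lt (ENNReal.add_lt_add h1 h2)

lemma exists_forall_rBall_of_eventually {x₀ : M} {Q : M → Prop} (h : ∀ᶠ x in 𝓝 x₀, Q x) :
    ∃ r > 0, ∀ x ∈ rBall x₀ r, Q x := by
  obtain ⟨r, hr, hball⟩ := EMetric.mem_nhds_iff.1 h
  rcases eq_or_ne r ⊤ with rfl | h'
  · exact ⟨1, one_pos, fun x hx => hball
      (show edist x x₀ < ⊤ from lt_of_lt_of_le hx le_top)⟩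
  · exact ⟨r.toReal, ENNReal.toReal_pos hr.ne' h', fun x hx => hball
      (lt_of_lt_of_le hx ENNReal.ofReal_toReal_le)⟩

end Balls

section Transversal

variable {m k q : ℕ} {M : Type*} [EMetricSpace M] [ChartedSpace (EuclideanSpace ℝ (Fin m)) M]
  {V : Type*} [NormedAddCommGroup V] [InnerProductSpace ℝ V] [FiniteDimensional ℝ V]

local notation "𝔼" => EuclideanSpace ℝ (Fin m)

/-- The tangent subspaces `E` are complementary to the foliation `W`, and `P` is a continuous family
of projections of `V` onto the subspaces `E`, regarded as subspaces of `V` by means of the immersion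
`e`, along the directions in which the transverse coordinates are constant. -/
structure IsTransversal (W : C1Foliation m k q M) (e : M → V)
    (E : M → Submodule ℝ (EuclideanSpace ℝ (Fin m))) (P : M → V →L[ℝ] V) : Prop where
  continuous : Continuous P
  exists_mem : ∀ x v, ∃ t ∈ E x, P x v = tderiv e x t
  apply_tderiv : ∀ x, ∀ t ∈ E x, P x (tderiv e x t) = tderiv e x t
  vderiv_transv : ∀ φ ∈ W.charts, ∀ x ∈ φ.source, ∀ v,
    vderiv m e (transv φ) x (P x v) = vderiv m e (transv φ) x v
  eq_zero : ∀ φ ∈ W.charts, ∀ x ∈ φ.source, ∀ t ∈ E x, tderiv (transv φ) x t = 0 → t = 0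

lemma C1Foliation.contMDiffAt_chart {W : C1Foliation m k q M} {φ} (hφ : φ ∈ W.charts) {x : M}
    (hx : x ∈ φ.source) : ContMDiffAt (𝓡 m)
      𝓘(ℝ, EuclideanSpace ℝ (Fin k) × EuclideanSpace ℝ (Fin q)) 1 φ x :=
  (W.contMDiffOn φ hφ).contMDiffAt (φ.open_source.mem_nhds hx)

lemma C1Foliation.contMDiffAt_transv {W : C1Foliation m k q M} {φ} (hφ : φ ∈ W.charts) {x : M}
    (hx : x ∈ φ.source) :
    ContMDiffAt (𝓡 m) 𝓘(ℝ, EuclideanSpace ℝ (Fin q)) 1 (transv φ) x :=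
  (contDiff_snd.contMDiff.contMDiffAt).comp x (C1Foliation.contMDiffAt_chart hφ hx)

lemma C1Foliation.tderiv_transv {W : C1Foliation m k q M} {φ} (hφ : φ ∈ W.charts) {x : M}
    (hx : x ∈ φ.source) (t : 𝔼) : tderiv (transv φ) x t = (tderiv φ x t).2 := by
  set L := ContinuousLinearMap.snd ℝ (EuclideanSpace ℝ (Fin k)) (EuclideanSpace ℝ (Fin q))
  have h1 := mfderiv_comp x (g := L) (I' := 𝓘(ℝ, _)) (I'' := 𝓘(ℝ, _))
    (L.differentiableAt.mdifferentiableAt)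
    ((C1Foliation.contMDiffAt_chart hφ hx).mdifferentiableAt one_ne_zero)
  have h2 : tderiv (m := m) (transv φ) x = L ∘L tderiv (m := m) φ x := by
    refine Eq.trans h1 ?_
    rw [mfderiv_eq_fderiv, L.fderiv]
    rfl
  rw [h2]
  rfl

/-- The transverse coordinates are submersions. -/
lemma C1Foliation.exists_tderiv_transv_rightInverse {W : C1Foliation m k q M} {φ}
    (hφ : φ ∈ W.charts) {x : M} (hx : x ∈ φ.source) :
    ∃ R : EuclideanSpace ℝ (Fin q) →L[ℝ] 𝔼, ∀ w, tderiv (transv φ) x (R w) = w := by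
  have h1 : MDifferentiableAt 𝓘(ℝ, EuclideanSpace ℝ (Fin k) × EuclideanSpace ℝ (Fin q)) (𝓡 m)
      φ.symm (φ x) := ((W.contMDiffOn_symm φ hφ).contMDiffAt
        (φ.open_target.mem_nhds (φ.map_source hx))).mdifferentiableAt one_ne_zero
  have h2 : MDifferentiableAt (𝓡 m) 𝓘(ℝ, EuclideanSpace ℝ (Fin k) × EuclideanSpace ℝ (Fin q))
      φ (φ.symm (φ x)) := by
    rw [φ.left_inv hx]
    exact (C1Foliation.contMDiffAt_chart hφ hx).mdifferentiableAt one_ne_zero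
  have h3 := mfderiv_comp (φ x) h2 h1
  have h4 : mfderiv 𝓘(ℝ, EuclideanSpace ℝ (Fin k) × EuclideanSpace ℝ (Fin q))
      𝓘(ℝ, EuclideanSpace ℝ (Fin k) × EuclideanSpace ℝ (Fin q)) (φ ∘ φ.symm) (φ x)
      = ContinuousLinearMap.id ℝ _ := by
    rw [mfderiv_eq_fderiv]
    refine HasFDerivAt.fderiv ((hasFDerivAt_id _).congr_of_eventuallyEq ?_)
    filter_upwards [φ.open_target.mem_nhds (φ.map_source hx)] with p hp using φ.right_inv hp
  rw [φ.left_inv hx] at h3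
  set S : EuclideanSpace ℝ (Fin k) × EuclideanSpace ℝ (Fin q) →L[ℝ] 𝔼 :=
    mfderiv 𝓘(ℝ, EuclideanSpace ℝ (Fin k) × EuclideanSpace ℝ (Fin q)) (𝓡 m) φ.symm (φ x) with hS
  have h5 : ∀ p, tderiv φ x (S p) = p := fun p => by
    have := congrArg (fun T : EuclideanSpace ℝ (Fin k) × EuclideanSpace ℝ (Fin q) →L[ℝ]
      EuclideanSpace ℝ (Fin k) × EuclideanSpace ℝ (Fin q) => T p) (h3.symm.trans h4)
    exact this
  refine ⟨S ∘L ContinuousLinearMap.inr ℝ _ _, fun w => ?_⟩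
  rw [C1Foliation.tderiv_transv hφ hx, ContinuousLinearMap.comp_apply, h5]
  rfl

namespace IsTransversal

variable {W : C1Foliation m k q M} {e : M → V}
  {E : M → Submodule ℝ (EuclideanSpace ℝ (Fin m))} {P : M → V →L[ℝ] V}

lemma proj_proj (h : IsTransversal W e E P) (x : M) (v : V) : P x (P x v) = P x v := by
  obtain ⟨t, ht, h1⟩ := h.exists_mem x v
  rw [h1, h.apply_tderiv x t ht]

lemma vderiv_self (h : IsTransversal W e E P) [IsManifold (𝓡 m) ∞ M]
    (he : IsC1Immersion (m := m) e) {x : M} {v : V} (hv : P x v = v) : vderiv m e e x v = v := by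
  obtain ⟨t, -, h1⟩ := h.exists_mem x v
  rw [← hv, h1, he.vderiv_tderiv]

variable [IsManifold (𝓡 m) ∞ M]

/-- The derivative of the transverse coordinates is uniformly injective on the subspaces `E`. -/
lemma exists_norm_le_vderiv (h : IsTransversal W e E P) (he : IsC1Immersion (m := m) e) {φ}
    (hφ : φ ∈ W.charts) {x₀ : M} (hx₀ : x₀ ∈ φ.source) : ∃ C > 0, ∀ᶠ x in 𝓝 x₀, ∀ v, P x v = v →
      ‖v‖ ≤ C * ‖vderiv m e (transv φ) x v‖ := by
  set B : M → V →L[ℝ] EuclideanSpace ℝ (Fin q) × V := fun x =>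
    (vderiv m e (transv φ) x).prod (ContinuousLinearMap.id ℝ V - P x) with hB
  have hBc : ContinuousAt B x₀ := by
    rw [continuousAt_clm_apply]
    intro v
    have h1 := he.continuousAt_vderiv (C1Foliation.contMDiffAt_transv hφ hx₀)
    have h2 := h.continuous.continuousAt (x := x₀)
    exact (h1.clm_apply continuousAt_const).prodMk
      (continuousAt_const.sub (h2.clm_apply continuousAt_const))
  have hinj : (B x₀).toLinearMap.ker = ⊥ := by
    rw [LinearMap.ker_eq_bot']
    intro v hv
    have h1 : vderiv m e (transv φ) x₀ v = 0 := congrArg Prod.fst hv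
    have h2 : v - P x₀ v = 0 := congrArg Prod.snd hv
    obtain ⟨t, ht, h3⟩ := h.exists_mem x₀ v
    have h4 : v = tderiv e x₀ t := by rw [← h3, ← sub_eq_zero, h2]
    rw [h4, he.vderiv_tderiv] at h1
    rw [h4, h.eq_zero φ hφ x₀ hx₀ t ht h1, map_zero]
  obtain ⟨K, hK, hKB⟩ := (B x₀).toLinearMap.exists_antilipschitzWith hinj
  have hK' : (0 : ℝ) < K := hK
  have h1 : ∀ᶠ x in 𝓝 x₀, ‖B x - B x₀‖ < (2 * (K : ℝ))⁻¹ := by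
    exact hBc.eventually (eventually_norm_sub_lt _ (by positivity))
  refine ⟨2 * K, by positivity, h1.mono fun x hx v hv => ?_⟩
  have h2 : ‖v‖ ≤ K * ‖B x₀ v‖ := by
    simpa using hKB.le_mul_dist v 0
  have h3 : ‖B x v‖ = ‖vderiv m e (transv φ) x v‖ := by
    have : B x v = (vderiv m e (transv φ) x v, 0) := by
      simp [hB, hv]
    rw [this, Prod.norm_def, norm_zero, max_eq_left (norm_nonneg _)]
  have h4 : ‖B x₀ v‖ ≤ ‖B x v‖ + (2 * (K : ℝ))⁻¹ * ‖v‖ := by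
    have h5 : ‖(B x - B x₀) v‖ ≤ (2 * (K : ℝ))⁻¹ * ‖v‖ := (B x - B x₀).le_of_opNorm_le hx.le v
    have h6 : B x₀ v = B x v - (B x - B x₀) v := by rw [sub_apply]; abel
    rw [h6]
    exact (norm_sub_le _ _).trans (by gcongr)
  rw [h3] at h4
  have h7 := mul_le_mul_of_nonneg_left h4 hK'.le
  have h8 : (K : ℝ) * ((2 * (K : ℝ))⁻¹ * ‖v‖) = ‖v‖ / 2 := by field_simp
  rw [mul_add, h8] at h7
  linarith

variable [RiemannianBundle (fun x : M => TangentSpace (𝓡 m) x)]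
  [IsContMDiffRiemannianBundle (𝓡 m) ∞ (EuclideanSpace ℝ (Fin m))
  (fun x : M => TangentSpace (𝓡 m) x)] [CompactSpace M]

/-- The transverse coordinates separate the points of the disks tangent to `E`. -/
lemma exists_norm_sub_le (h : IsTransversal W e E P) (he : IsC1Immersion (m := m) e) {φ}
    (hφ : φ ∈ W.charts) {x₀ : M} (hx₀ : x₀ ∈ φ.source) : ∃ C > 0, ∃ κ > 0, ∀ᶠ x in 𝓝 x₀,
      ∀ w w', P x w = w → P x w' = w' → ‖w‖ < κ → ‖w'‖ < κ →
      ‖w - w'‖ ≤ C * ‖transv φ (expV m e x w) - transv φ (expV m e x w')‖ := by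
  obtain ⟨C, hC, h1⟩ := h.exists_norm_le_vderiv he hφ hx₀
  obtain ⟨κ, hκ, h2⟩ := he.exists_norm_comp_expV_sub_le (C1Foliation.contMDiffAt_transv hφ hx₀)
    (η := 1 / (2 * C)) (by positivity)
  refine ⟨2 * C, by positivity, κ, hκ, ?_⟩
  filter_upwards [h1, h2] with x hx1 hx2 w w' hw hw' hwκ hwκ'
  have h3 := hx1 (w - w') (by rw [map_sub, hw, hw'])
  have h4 := hx2 w w' hwκ hwκ'
  set a := transv φ (expV m e x w) - transv φ (expV m e x w')
  have h5 := norm_sub_norm_le (vderiv m e (transv φ) x (w - w')) a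
  rw [norm_sub_rev _ a] at h5
  have h6 : C * ‖vderiv m e (transv φ) x (w - w')‖ ≤ C * (‖a‖ + 1 / (2 * C) * ‖w - w'‖) := by
    gcongr
    linarith
  have h7 : C * (1 / (2 * C) * ‖w - w'‖) = ‖w - w'‖ / 2 := by field_simp
  rw [mul_add, h7] at h6
  linarith

/-- The disks `Σ_ρ(x)` in terms of the immersion `e`. -/
lemma mem_suDisk_iff {Es Eu : ∀ x : M, Submodule ℝ (TangentSpace (𝓡 m) x)}
    (h : IsTransversal W e (fun x => (Es x ⊔ Eu x : Submodule ℝ (TangentSpace (𝓡 m) x))) P)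
    (he : IsC1Immersion (m := m) e) {x z : M} {ρ : ℝ} : z ∈ suDisk Es Eu x ρ ↔
      ∃ w, P x w = w ∧ rnorm (m := m) x (embInv e x w) < ρ ∧ expV m e x w = z := by
  constructor
  · rintro ⟨t, ⟨ht, htρ⟩, rfl⟩
    have h1 := he.embInv_tderiv x t
    exact ⟨tderiv e x t, h.apply_tderiv x t ht, lt_of_eq_of_lt (congrArg (rnorm (m := m) x) h1) htρ,
      congrArg (expMap (m := m) x) h1⟩
  · rintro ⟨w, hw, hwρ, rfl⟩
    obtain ⟨t, ht, htw⟩ := h.exists_mem x w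
    rw [hw] at htw
    rw [expV, htw, he.embInv_tderiv]
    rw [htw, he.embInv_tderiv] at hwρ
    exact ⟨t, ⟨ht, hwρ⟩, rfl⟩

/-- A plaque meets a small disk in at most one point. -/
lemma exists_eq_of_mem_leafIn {Es Eu : ∀ x : M, Submodule ℝ (TangentSpace (𝓡 m) x)}
    (h : IsTransversal W e (fun x => (Es x ⊔ Eu x : Submodule ℝ (TangentSpace (𝓡 m) x))) P)
    (he : IsC1Immersion (m := m) e) : ∃ ρ > 0, ∀ x y z z', z ∈ suDisk Es Eu x ρ →
      z' ∈ suDisk Es Eu x ρ → z ∈ W.leafIn (rBall x ρ) y → z' ∈ W.leafIn (rBall x ρ) y →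
      z = z' := by
  obtain ⟨B, hB, hBe⟩ := he.exists_rnorm_equiv
  refine exists_pos_forall_of_locally (P := fun ρ x => ∀ y z z', z ∈ suDisk Es Eu x ρ →
      z' ∈ suDisk Es Eu x ρ → z ∈ W.leafIn (rBall x ρ) y → z' ∈ W.leafIn (rBall x ρ) y →
      z = z') (fun x ρ ρ' _ hρ hP y z z' hz hz' hzl hzl' => ?_) fun x₀ => ?_
  · have hmono : suDisk Es Eu x ρ' ⊆ suDisk Es Eu x ρ :=
      image_mono fun v hv => ⟨hv.1, hv.2.trans_le hρ⟩
    exact hP y z z' (hmono hz) (hmono hz') (W.leafIn_mono (rBall_mono x hρ) y hzl)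
      (W.leafIn_mono (rBall_mono x hρ) y hzl')
  obtain ⟨φ, hφ, hx₀⟩ := W.covers x₀
  obtain ⟨C, hC, κ, hκ, h1⟩ := h.exists_norm_sub_le he hφ hx₀
  obtain ⟨σ, hσ, h2⟩ := exists_forall_rBall_of_eventually (φ.open_source.eventually_mem hx₀)
  refine ⟨min (σ / 2) (κ / B), by positivity, ?_⟩
  filter_upwards [h1, (isOpen_rBall x₀ (σ / 2)).eventually_mem (mem_rBall_self x₀ (by positivity))]
    with x hx hxσ y z z' hz hz' hzl hzl'
  have hsub : rBall x (min (σ / 2) (κ / B)) ⊆ φ.source := fun a ha => h2 a (by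
    have := edist_lt_ofReal_add (rBall_mono x (min_le_left _ _) ha) hxσ
    rwa [add_halves] at this)
  obtain ⟨w, hw, hwρ, rfl⟩ := (h.mem_suDisk_iff he).1 hz
  obtain ⟨w', hw', hwρ', rfl⟩ := (h.mem_suDisk_iff he).1 hz'
  have hn : ∀ w, P x w = w → rnorm (m := m) x (embInv e x w) < min (σ / 2) (κ / B) → ‖w‖ < κ :=
    fun w hw hwρ => by
      have h3 := h.vderiv_self he hw
      rw [vderiv_apply] at h3
      have h4 := (hBe x).2 (embInv e x w)
      rw [h3] at h4
      have h5 := hwρ.trans_le (min_le_right _ _)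
      rw [lt_div_iff₀ hB, mul_comm] at h5
      exact h4.trans_lt h5
  have h6 := hx w w' hw hw' (hn w hw hwρ) (hn w' hw' hwρ')
  rw [C1Foliation.transv_eq_of_mem_leafIn hzl hφ hsub,
    C1Foliation.transv_eq_of_mem_leafIn hzl' hφ hsub, sub_self, norm_zero, mul_zero] at h6
  rw [sub_eq_zero.1 (norm_le_zero_iff.1 h6)]

/-- The map which sends `v` to the point `w` such that `exp w` is obtained from `f (exp v)` by
sliding along the leaves has, uniformly, the derivative `P ∘ df`, even if the base points
correspond only approximately. -/
lemma exists_norm_sub_sub_le (h : IsTransversal W e E P) (he : IsC1Immersion (m := m) e)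
    {f : M → M} (hf : ContMDiff (𝓡 m) (𝓡 m) 1 f) {ρ : ℝ} (hρ : 0 < ρ)
    (hchart : ∀ y₀, ∃ φ ∈ W.charts, ∀ᶠ y in 𝓝 y₀, rBall y ρ ⊆ φ.source) {η : ℝ} (hη : 0 < η) :
    ∃ κ > 0, ∀ x x', edist (f x) x' < ENNReal.ofReal κ → ∀ v v' w w', P x v = v → P x v' = v' →
      P x' w = w → P x' w' = w' → ‖v‖ < κ → ‖v'‖ < κ → ‖w‖ < κ → ‖w'‖ < κ →
      expV m e x' w ∈ W.leafIn (rBall x' ρ) (f (expV m e x v)) →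
      expV m e x' w' ∈ W.leafIn (rBall x' ρ) (f (expV m e x v')) →
      ‖w - w' - P x' (vderiv m e (e ∘ f) x (v - v'))‖ ≤ η * ‖v - v'‖ := by
  refine exists_pos_forall_of_locally (P := fun κ x => ∀ x', edist (f x) x' < ENNReal.ofReal κ →
    ∀ v v' w w', P x v = v → P x v' = v' →
      P x' w = w → P x' w' = w' → ‖v‖ < κ → ‖v'‖ < κ → ‖w‖ < κ → ‖w'‖ < κ →
      expV m e x' w ∈ W.leafIn (rBall x' ρ) (f (expV m e x v)) →
      expV m e x' w' ∈ W.leafIn (rBall x' ρ) (f (expV m e x v')) →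
      ‖w - w' - P x' (vderiv m e (e ∘ f) x (v - v'))‖ ≤ η * ‖v - v'‖)
    (fun x κ κ' _ hκ hP x' hx' v v' w w' hv hv' hw hw' hv1 hv1' hw1 hw1' =>
      hP x' (hx'.trans_le (ENNReal.ofReal_le_ofReal hκ)) v v' w w' hv hv' hw hw'
        (hv1.trans_le hκ) (hv1'.trans_le hκ) (hw1.trans_le hκ) (hw1'.trans_le hκ)) fun x₀ => ?_
  obtain ⟨φ, hφ, hsrc⟩ := hchart (f x₀)
  have hy₀ : f x₀ ∈ φ.source := hsrc.self_of_nhds (mem_rBall_self _ hρ)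
  have hψ := C1Foliation.contMDiffAt_transv hφ hy₀
  obtain ⟨C, hC, hinj⟩ := h.exists_norm_le_vderiv he hφ hy₀
  have hef : ContMDiff (𝓡 m) 𝓘(ℝ, V) 1 (e ∘ f) := he.contMDiff.comp hf
  set B := ‖vderiv m e (e ∘ f) x₀‖ + 1 with hB
  set A := ‖P (f x₀)‖ + 1 with hA
  have hB0 : 0 < B := by positivity
  have hA0 : 0 < A := by positivity
  have hBx : ∀ᶠ x in 𝓝 x₀, ‖vderiv m e (e ∘ f) x‖ < B :=
    (he.continuousAt_vderiv (hef x₀)).norm.eventually (gt_mem_nhds (lt_add_one _))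
  have hAy : ∀ᶠ y in 𝓝 (f x₀), ‖P y‖ < A :=
    h.continuous.continuousAt.norm.eventually (gt_mem_nhds (lt_add_one _))
  set η' := min (1 / (2 * C)) (η / (2 * C * (A * B + 1 + B))) with hη'
  have hη'0 : 0 < η' := by positivity
  obtain ⟨κ₁, hκ₁, h1⟩ := he.exists_norm_comp_expV_sub_le hψ hη'0
  have hψf : ContMDiffAt (𝓡 m) 𝓘(ℝ, EuclideanSpace ℝ (Fin q)) 1 (transv φ ∘ f) x₀ :=
    hψ.comp x₀ (hf x₀)
  obtain ⟨κ₂, hκ₂, h2⟩ := he.exists_norm_comp_expV_sub_le hψf hη'0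
  have hT : ∀ᶠ y in 𝓝 (f x₀), ‖vderiv m e (transv φ) y - vderiv m e (transv φ) (f x₀)‖ < η' / 2 := by
    exact (he.continuousAt_vderiv hψ).eventually
      (eventually_norm_sub_lt _ (by positivity))
  obtain ⟨σ, hσ, hy⟩ := exists_forall_rBall_of_eventually (hsrc.and (hinj.and (hAy.and (h1.and hT))))
  have hfx : ∀ᶠ x in 𝓝 x₀, f x ∈ rBall (f x₀) (σ / 2) :=
    hf.continuous.continuousAt.eventually ((isOpen_rBall _ _).mem_nhds
      (mem_rBall_self _ (by positivity)))
  refine ⟨min (σ / 2) (min κ₁ κ₂), by positivity, ?_⟩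
  filter_upwards [hBx, h2, hfx] with x hxB hx2 hxσ x' hx' v v' w w' hv hv' hw hw' hv1 hv1' hw1 hw1'
    hwl hwl'
  have hx'σ : x' ∈ rBall (f x₀) σ := by
    rw [edist_comm] at hx'
    have := edist_lt_ofReal_add (hx'.trans_le (ENNReal.ofReal_le_ofReal (min_le_left _ _))) hxσ
    rwa [add_halves] at this
  obtain ⟨hsub, hx'inj, hx'A, hx'1, hx'T⟩ := hy x' hx'σ
  obtain ⟨hsub', -, -, -, hfxT⟩ := hy (f x) (rBall_mono _ (by linarith) hxσ)
  have hx's : x' ∈ φ.source := hsub (mem_rBall_self _ hρ)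
  have hfxs : f x ∈ φ.source := hsub' (mem_rBall_self _ hρ)
  have hκ1 : min (σ / 2) (min κ₁ κ₂) ≤ κ₁ := (min_le_right _ _).trans (min_le_left _ _)
  have hκ2 : min (σ / 2) (min κ₁ κ₂) ≤ κ₂ := (min_le_right _ _).trans (min_le_right _ _)
  have e1 := hx'1 w w' (hw1.trans_le hκ1) (hw1'.trans_le hκ1)
  have e2 := hx2 v v' (hv1.trans_le hκ2) (hv1'.trans_le hκ2)
  rw [C1Foliation.transv_eq_of_mem_leafIn hwl hφ hsub,
    C1Foliation.transv_eq_of_mem_leafIn hwl' hφ hsub] at e1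
  rw [he.vderiv_comp ((hf x).mdifferentiableAt one_ne_zero)
    ((C1Foliation.contMDiffAt_transv hφ hfxs).mdifferentiableAt one_ne_zero)] at e2
  simp only [Function.comp_apply, ContinuousLinearMap.comp_apply] at e2
  set d := w - w' with hd
  set u := v - v' with hu
  set a := vderiv m e (e ∘ f) x u with ha
  set T := vderiv m e (transv φ) x' with hT'
  set T' := vderiv m e (transv φ) (f x) with hT''
  set c := transv φ (f (expV m e x v)) - transv φ (f (expV m e x v')) with hc
  have haB : ‖a‖ ≤ B * ‖u‖ := (vderiv m e (e ∘ f) x).le_of_opNorm_le hxB.le u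
  have e3 : ‖(T' - T) a‖ ≤ η' * (B * ‖u‖) := by
    have : ‖T' - T‖ ≤ η' := by
      have h5 := norm_sub_le (T' - vderiv m e (transv φ) (f x₀)) (T - vderiv m e (transv φ) (f x₀))
      rw [sub_sub_sub_cancel_right] at h5
      linarith
    exact ((T' - T).le_of_opNorm_le this a).trans (by gcongr)
  have e4 : ‖T (d - P x' a)‖ ≤ η' * ‖d‖ + η' * ‖u‖ + η' * (B * ‖u‖) := by
    have h6 : T (d - P x' a) = -(c - T d) + (c - T' a) + (T' - T) a := by
      rw [map_sub, hT', h.vderiv_transv φ hφ x' hx's, ← hT', sub_apply]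
      abel
    rw [h6]
    refine (norm_add_le _ _).trans (add_le_add ((norm_add_le _ _).trans (add_le_add ?_ e2)) e3)
    rw [norm_neg]
    exact e1
  have e5 := hx'inj (d - P x' a) (by rw [map_sub, hd, map_sub, hw, hw', h.proj_proj])
  have e6 : ‖d‖ ≤ ‖d - P x' a‖ + A * (B * ‖u‖) := by
    have h7 : ‖P x' a‖ ≤ A * (B * ‖u‖) := ((P x').le_of_opNorm_le hx'A.le a).trans (by gcongr)
    have h8 := norm_sub_norm_le d (P x' a)
    linarith
  have e7 : C * ‖T (d - P x' a)‖ ≤ C * (η' * (‖d - P x' a‖ + (A * B + 1 + B) * ‖u‖)) := by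
    gcongr
    refine e4.trans ?_
    have := mul_le_mul_of_nonneg_left e6 hη'0.le
    linarith
  have e8 : C * η' ≤ 1 / 2 := by
    have : C * η' ≤ C * (1 / (2 * C)) := by gcongr; exact min_le_left _ _
    refine this.trans (le_of_eq ?_)
    field_simp
  have e9 : 2 * (C * η') * (A * B + 1 + B) ≤ η := by
    have : 2 * (C * η') * (A * B + 1 + B)
        ≤ 2 * (C * (η / (2 * C * (A * B + 1 + B)))) * (A * B + 1 + B) := by
      gcongr; exact min_le_right _ _
    refine this.trans (le_of_eq ?_)
    field_simp
  have e10 := mul_le_mul_of_nonneg_right e8 (norm_nonneg (d - P x' a))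
  have e11 := mul_le_mul_of_nonneg_right e9 (norm_nonneg u)
  calc ‖d - P x' a‖ ≤ 2 * (C * η') * (A * B + 1 + B) * ‖u‖ := by linarith [e5.trans e7]
    _ ≤ _ := e11

/-- Sliding along leaves onto the disks is continuous also in the base points. -/
lemma exists_continuous_of_mem_leafIn (h : IsTransversal W e E P) (he : IsC1Immersion (m := m) e)
    {f : M → M} (hf : Continuous f) {ρ : ℝ} (hρ : 0 < ρ)
    (hchart : ∀ y₀, ∃ φ ∈ W.charts, ∀ᶠ y in 𝓝 y₀, rBall y ρ ⊆ φ.source) :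
    ∃ κ > 0, ∀ (g : M → M) (v w : M → V), Continuous g → Continuous v → (∀ x, ‖v x‖ < κ) →
      (∀ x, P (g x) (w x) = w x) → (∀ x, ‖w x‖ < κ) →
      (∀ x, expV m e (g x) (w x) ∈ W.leafIn (rBall (g x) ρ) (f (expV m e x (v x)))) →
      Continuous w := by
  obtain ⟨κ₁, hκ₁, hexp⟩ := he.exists_continuousAt_expV
  obtain ⟨κ₂, hκ₂, hloc⟩ := exists_pos_forall_of_locally (M := M) (P := fun κ y =>
    ∃ φ ∈ W.charts, ∃ C : ℝ, ∀ᶠ x in 𝓝 y, rBall x ρ ⊆ φ.source ∧ ∀ w w', P x w = w → P x w' = w' →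
      ‖w‖ < κ → ‖w'‖ < κ →
      ‖w - w'‖ ≤ C * ‖transv φ (expV m e x w) - transv φ (expV m e x w')‖)
    (fun y κ κ' _ hκ ⟨φ, hφ, C, hC⟩ => ⟨φ, hφ, C, hC.mono fun x hx => ⟨hx.1,
      fun w w' hw hw' hw1 hw1' => hx.2 w w' hw hw' (hw1.trans_le hκ) (hw1'.trans_le hκ)⟩⟩)
    fun y₀ => by
      obtain ⟨φ, hφ, hsrc⟩ := hchart y₀
      obtain ⟨C, -, κ, hκ, h1⟩ := h.exists_norm_sub_le he hφ
        (hsrc.self_of_nhds (mem_rBall_self _ hρ))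
      exact ⟨κ, hκ, (eventually_eventually_nhds.2 (hsrc.and h1)).mono fun y hy => ⟨φ, hφ, C, hy⟩⟩
  refine ⟨min κ₁ κ₂, by positivity, fun g v w hg hv hvκ hw hwκ hl => ?_⟩
  rw [continuous_iff_continuousAt]
  intro x₁
  obtain ⟨φ, hφ, C, hC⟩ := hloc (g x₁)
  have hsub := hC.self_of_nhds.1
  -- A continuous section through `w x₁`, with which `w` is compared in the transverse coordinates.
  set u : M → V := fun x => P (g x) (w x₁) with hu
  have huc : Continuous u := (h.continuous.comp hg).clm_apply continuous_const
  have hu1 : u x₁ = w x₁ := hw x₁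
  have huκ : ∀ᶠ x in 𝓝 x₁, ‖u x‖ < κ₂ := huc.continuousAt.norm.eventually
    (gt_mem_nhds (by
      change ‖u x₁‖ < κ₂
      rw [hu1]; exact (hwκ x₁).trans_le (min_le_right _ _)))
  have hle : ∀ᶠ x in 𝓝 x₁, ‖w x - u x‖
      ≤ C * ‖transv φ (f (expV m e x (v x))) - transv φ (expV m e (g x) (u x))‖ := by
    filter_upwards [hg.continuousAt.eventually hC, huκ] with x hx hux
    have := hx.2 (w x) (u x) (hw x) (h.proj_proj _ _) ((hwκ x).trans_le (min_le_right _ _)) hux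
    rwa [C1Foliation.transv_eq_of_mem_leafIn (hl x) hφ hx.1] at this
  have hmem := C1Foliation.mem_of_mem_leafIn (hl x₁)
  have c1 : ContinuousAt (fun x => transv φ (f (expV m e x (v x)))) x₁ := by
    have h1 : ContinuousAt (fun x => expV m e x (v x)) x₁ :=
      ContinuousAt.comp (g := fun z : M × V => expV m e z.1 z.2) (f := fun x => (x, v x))
        (hexp x₁ (v x₁) ((hvκ x₁).trans_le (min_le_left _ _)))
        (continuousAt_id.prodMk hv.continuousAt)
    exact ContinuousAt.comp (g := transv φ) (C1Foliation.contMDiffAt_transv hφ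
      (hsub hmem.1)).continuousAt (hf.continuousAt.comp h1)
  have c2 : ContinuousAt (fun x => transv φ (expV m e (g x) (u x))) x₁ := by
    have h1 : ContinuousAt (fun x => expV m e (g x) (u x)) x₁ :=
      ContinuousAt.comp (g := fun z : M × V => expV m e z.1 z.2) (f := fun x => (g x, u x))
        (hexp (g x₁) (u x₁) (by rw [hu1]; exact (hwκ x₁).trans_le (min_le_left _ _)))
        (hg.continuousAt.prodMk huc.continuousAt)
    refine ContinuousAt.comp (g := transv φ) (C1Foliation.contMDiffAt_transv hφ
      (hsub ?_)).continuousAt h1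
    rw [hu1]
    exact hmem.2
  have hlim : Tendsto (fun x => w x - u x) (𝓝 x₁) (𝓝 0) := by
    refine squeeze_zero_norm' hle ?_
    have c3 : ContinuousAt (fun x => C *
      ‖transv φ (f (expV m e x (v x))) - transv φ (expV m e (g x) (u x))‖) x₁ :=
      continuousAt_const.mul (c1.sub c2).norm
    have := c3.tendsto
    rwa [hu1, C1Foliation.transv_eq_of_mem_leafIn (hl x₁) hφ hsub, sub_self, norm_zero,
      mul_zero] at this
  have := hlim.add (huc.tendsto x₁)
  rw [zero_add, hu1] at this
  simp only [sub_add_cancel] at this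
  exact this

end IsTransversal

end Transversal

/-! ### Existence of slides along the leaves -/

section Slides

variable {m k q : ℕ} {M : Type*} [EMetricSpace M] [ChartedSpace (EuclideanSpace ℝ (Fin m)) M]
  {V : Type*} [NormedAddCommGroup V] [InnerProductSpace ℝ V] [FiniteDimensional ℝ V]

local notation "𝔼" => EuclideanSpace ℝ (Fin m)

/-- A Lebesgue number for the cover by foliation charts. -/
lemma C1Foliation.exists_rBall_subset_source [CompactSpace M] (W : C1Foliation m k q M) :
    ∃ ρ > 0, ∀ x, ∃ φ ∈ W.charts, rBall x ρ ⊆ φ.source := by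
  refine exists_pos_forall_of_locally (P := fun ρ x => ∃ φ ∈ W.charts, rBall x ρ ⊆ φ.source)
    (fun x ρ ρ' _ h ⟨φ, hφ, hx⟩ => ⟨φ, hφ, (rBall_mono x h).trans hx⟩) fun x₀ => ?_
  obtain ⟨φ, hφ, hx₀⟩ := W.covers x₀
  obtain ⟨σ, hσ, h⟩ := exists_forall_rBall_of_eventually (φ.open_source.eventually_mem hx₀)
  refine ⟨σ / 2, by positivity, ?_⟩
  filter_upwards [(isOpen_rBall x₀ (σ / 2)).eventually_mem (mem_rBall_self x₀ (by positivity))]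
    with x hx
  refine ⟨φ, hφ, fun y hy => h y ?_⟩
  have := edist_lt_ofReal_add hy hx
  rwa [add_halves] at this

namespace IsTransversal

variable {W : C1Foliation m k q M} {e : M → V} {P : M → V →L[ℝ] V}
  [IsManifold (𝓡 m) ∞ M] [RiemannianBundle (fun x : M => TangentSpace (𝓡 m) x)]
  [IsContMDiffRiemannianBundle (𝓡 m) ∞ (EuclideanSpace ℝ (Fin m))
  (fun x : M => TangentSpace (𝓡 m) x)] [IsRiemannianManifold (𝓡 m) M] [CompactSpace M]

/-- The slides along the leaves exist, uniformly: near `x₀` they are obtained by solving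
`ψ (exp_x (ζ ξ)) = ψ y` for `ξ`, where `ψ` denotes the transverse coordinates in a foliation chart
and `ζ` is a right inverse of the derivative of `ψ` at `x₀`, followed by the projection to the
subspace at `x`.  For `x` near `x₀` the left-hand side is close to the identity in `ξ`, up to a
translation. -/
lemma exists_slide {Es Eu : ∀ x : M, Submodule ℝ (TangentSpace (𝓡 m) x)}
    (h : IsTransversal W e (fun x => (Es x ⊔ Eu x : Submodule ℝ (TangentSpace (𝓡 m) x))) P)
    (he : IsC1Immersion (m := m) e) {ρ : ℝ} (hρ : 0 < ρ) :
    ∃ r > 0, ∀ x, ∃ τ : M → M, ContMDiffOn (𝓡 m) (𝓡 m) 1 τ (rBall x r) ∧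
      ∀ y ∈ rBall x r, τ y ∈ suDisk Es Eu x ρ ∧ τ y ∈ W.leafIn (rBall x ρ) y ∧
        edist (τ y) x ≤ ENNReal.ofReal r⁻¹ * edist y x := by
  refine exists_pos_forall_of_locally (P := fun r x => ∃ τ : M → M,
    ContMDiffOn (𝓡 m) (𝓡 m) 1 τ (rBall x r) ∧
      ∀ y ∈ rBall x r, τ y ∈ suDisk Es Eu x ρ ∧ τ y ∈ W.leafIn (rBall x ρ) y ∧
        edist (τ y) x ≤ ENNReal.ofReal r⁻¹ * edist y x)
    (fun x r r' h0 hr ⟨τ, hτ, hP⟩ => ⟨τ, hτ.mono (rBall_mono x hr), fun y hy => ?_⟩) fun x₀ => ?_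
  · obtain ⟨h1, h2, h3⟩ := hP y (rBall_mono x hr hy)
    exact ⟨h1, h2, h3.trans (by gcongr)⟩
  obtain ⟨φ, hφ, hx₀⟩ := W.covers x₀
  have hψ := C1Foliation.contMDiffAt_transv hφ hx₀
  obtain ⟨R₀, hR₀⟩ := C1Foliation.exists_tderiv_transv_rightInverse hφ hx₀
  set R : EuclideanSpace ℝ (Fin q) →L[ℝ] V := tderiv e x₀ ∘L R₀ with hR
  have hTR : ∀ w, vderiv m e (transv φ) x₀ (R w) = w := fun w => by
    rw [hR, ContinuousLinearMap.comp_apply, he.vderiv_tderiv, hR₀]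
  set A := ‖P x₀‖ + 1 with hA
  set L := ‖R‖ + 1 with hL
  have hA0 : 0 < A := by positivity
  have hL0 : 0 < L := by positivity
  have hPx : ∀ᶠ x in 𝓝 x₀, ‖P x‖ < A :=
    h.continuous.continuousAt.norm.eventually (gt_mem_nhds (lt_add_one _))
  have hTx : ∀ᶠ x in 𝓝 x₀,
      ‖vderiv m e (transv φ) x - vderiv m e (transv φ) x₀‖ < 1 / (4 * L) :=
    (he.continuousAt_vderiv hψ).eventually (eventually_norm_sub_lt _ (by positivity))
  obtain ⟨κ, hκ, hexp⟩ := he.exists_norm_comp_expV_sub_le hψ (η := 1 / (4 * (A * L)))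
    (by positivity)
  obtain ⟨B, hB, hBe⟩ := he.exists_rnorm_equiv
  obtain ⟨ρ₁, hρ₁, hsm⟩ := exists_contMDiffAt_expMap (m := m) (M := M)
  obtain ⟨ρ₂, hρ₂, hnear⟩ := exists_edist_expMap_le (m := m) (M := M)
  obtain ⟨C, hC, r₃, hr₃, hlip⟩ := he.exists_edist_le hψ
  -- A ball `rBall x₀ σ` that the chart maps into a convex set, on which the inverse chart takes
  -- values close to `x₀`.
  obtain ⟨s₀, hs₀, hball⟩ : ∃ s₀ > 0, ∀ p ∈ Metric.ball (φ x₀) s₀,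
      p ∈ φ.target ∧ φ.symm p ∈ rBall x₀ (ρ / 2) := by
    have h1 : ∀ᶠ p in 𝓝 (φ x₀), p ∈ φ.target ∧ φ.symm p ∈ rBall x₀ (ρ / 2) := by
      refine (φ.open_target.eventually_mem (φ.map_source hx₀)).and
        ((φ.continuousAt_symm (φ.map_source hx₀)).eventually ((isOpen_rBall x₀ (ρ / 2)).mem_nhds ?_))
      rw [φ.left_inv hx₀]
      exact mem_rBall_self x₀ (by positivity)
    exact Metric.eventually_nhds_iff_ball.1 h1
  obtain ⟨σ, hσ, hσφ⟩ : ∃ σ > 0, ∀ y ∈ rBall x₀ σ,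
      y ∈ φ.source ∧ φ y ∈ Metric.ball (φ x₀) s₀ :=
    exists_forall_rBall_of_eventually ((φ.open_source.eventually_mem hx₀).and
      ((φ.continuousAt hx₀).eventually (Metric.ball_mem_nhds _ hs₀)))
  set D := B * (A * L) with hD
  have hD0 : 0 < D := by positivity
  set s := min (min (κ / (A * L)) (ρ₁ / D)) (min (ρ₂ / D) (min (ρ / D) (σ / 2 * ρ₂ / D))) with hs
  have hs0 : 0 < s := by positivity
  set r := min (min (σ / 2) (r₃ / 2)) (min (s / (4 * C)) (ρ₂⁻¹ * D * (2 * C))⁻¹) with hr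
  have hr0 : 0 < r := by positivity
  have hx₀mem : ∀ a > 0, ∀ᶠ x in 𝓝 x₀, x ∈ rBall x₀ a := fun a ha =>
    (isOpen_rBall x₀ a).eventually_mem (mem_rBall_self x₀ ha)
  refine ⟨r, hr0, ?_⟩
  filter_upwards [hPx, hTx, hexp, hx₀mem (σ / 2) (by positivity), hx₀mem (r₃ / 2) (by positivity),
    hx₀mem (ρ / 2) (by positivity)] with x hxP hxT hxe hxσ hxr₃ hxρ
  set ζ : EuclideanSpace ℝ (Fin q) →L[ℝ] 𝔼 := embInv e x ∘L P x ∘L R with hζ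
  have hPR : ∀ ξ, ‖P x (R ξ)‖ ≤ A * L * ‖ξ‖ := fun ξ => by
    have h1 : ‖R ξ‖ ≤ L * ‖ξ‖ := R.le_of_opNorm_le (by linarith) ξ
    calc _ ≤ A * ‖R ξ‖ := (P x).le_of_opNorm_le hxP.le _
      _ ≤ A * (L * ‖ξ‖) := by gcongr
      _ = _ := by ring
  have hζn : ∀ ξ, rnorm (m := m) x (ζ ξ) ≤ D * ‖ξ‖ := fun ξ => by
    calc _ ≤ B * ‖P x (R ξ)‖ := (hBe x).1 _
      _ ≤ B * (A * L * ‖ξ‖) := by gcongr; exact hPR ξ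
      _ = _ := by ring
  have hlt : ∀ (ξ : EuclideanSpace ℝ (Fin q)) (a b : ℝ), 0 < b → ‖ξ‖ < s → s ≤ a / b →
      b * ‖ξ‖ < a := fun ξ a b hb hξ hab => by
    have := hξ.trans_le hab
    rwa [lt_div_iff₀ hb, mul_comm] at this
  have hz : ∀ ξ, ‖ξ‖ < s → edist (expMap (m := m) x (ζ ξ)) x ≤ ENNReal.ofReal (ρ₂⁻¹ * (D * ‖ξ‖)) :=
    fun ξ hξ => by
      refine (hnear x (ζ ξ) ((hζn ξ).trans_lt (hlt ξ ρ₂ D hD0 hξ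
        ((min_le_right _ _).trans (min_le_left _ _))))).trans (ENNReal.ofReal_le_ofReal ?_)
      gcongr
      exact hζn ξ
  have hzσ : ∀ ξ, ‖ξ‖ < s → expMap (m := m) x (ζ ξ) ∈ rBall x₀ σ := fun ξ hξ => by
    have h1 : edist (expMap (m := m) x (ζ ξ)) x < ENNReal.ofReal (σ / 2) :=
      (hz ξ hξ).trans_lt ((ENNReal.ofReal_lt_ofReal_iff (by positivity)).2 (by
        rw [inv_mul_lt_iff₀ hρ₂, mul_comm ρ₂]
        exact hlt ξ _ D hD0 hξ
          ((min_le_right _ _).trans ((min_le_right _ _).trans (min_le_right _ _)))))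
    have := edist_lt_ofReal_add h1 hxσ
    rwa [add_halves] at this
  have hexpsm : ∀ ξ, ‖ξ‖ < s →
      ContMDiffAt 𝓘(ℝ, 𝔼) (𝓡 m) 1 (fun v : 𝔼 => expMap (m := m) x v) (ζ ξ) := fun ξ hξ =>
    hsm x (ζ ξ) ((hζn ξ).trans_lt (hlt ξ ρ₁ D hD0 hξ
      ((min_le_left _ _).trans (min_le_right _ _))))
  set G : EuclideanSpace ℝ (Fin q) → EuclideanSpace ℝ (Fin q) := fun ξ =>
    transv φ (expMap (m := m) x (ζ ξ)) with hG
  have hG0 : G 0 = transv φ x := by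
    have h1 : expMap (m := m) x (0 : 𝔼) = x := expMap_zero (m := m) x
    simp only [hG, map_zero, h1]
  obtain ⟨I, hI⟩ := exists_contDiffAt_rightInverse (G := G) hs0 (fun ξ hξ => by
    have hξ' : ‖ξ‖ < s := by simpa using hξ
    have h1 : ContMDiffAt 𝓘(ℝ, EuclideanSpace ℝ (Fin q)) (𝓡 m) 1
        (fun ξ => expMap (m := m) x (ζ ξ)) ξ :=
      ContMDiffAt.comp ξ (hexpsm ξ hξ') ζ.contDiff.contMDiff.contMDiffAt
    have h2 : ContMDiffAt 𝓘(ℝ, EuclideanSpace ℝ (Fin q)) 𝓘(ℝ, EuclideanSpace ℝ (Fin q)) 1 G ξ :=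
      ContMDiffAt.comp (g := transv φ) ξ
        (C1Foliation.contMDiffAt_transv hφ (hσφ _ (hzσ ξ hξ')).1) h1
    exact contMDiffAt_iff_contDiffAt.1 h2) (fun ξ hξ ξ' hξ' => by
    have hκξ : ∀ ξ ∈ Metric.ball (0 : EuclideanSpace ℝ (Fin q)) s, ‖P x (R ξ)‖ < κ := fun ξ hξ =>
      (hPR ξ).trans_lt (hlt ξ κ (A * L) (by positivity) (by simpa using hξ)
        ((min_le_left _ _).trans (min_le_left _ _)))
    have h1 := hxe _ _ (hκξ ξ hξ) (hκξ ξ' hξ')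
    have hxs : x ∈ φ.source := (hσφ x (rBall_mono x₀ (by linarith) hxσ)).1
    rw [← map_sub, ← map_sub, h.vderiv_transv φ hφ x hxs] at h1
    have h2 : ‖(vderiv m e (transv φ) x - vderiv m e (transv φ) x₀) (R (ξ - ξ'))‖
        ≤ 1 / 4 * ‖ξ - ξ'‖ := by
      calc _ ≤ 1 / (4 * L) * ‖R (ξ - ξ')‖ := ContinuousLinearMap.le_of_opNorm_le _ hxT.le _
        _ ≤ 1 / (4 * L) * (L * ‖ξ - ξ'‖) := by
          gcongr; exact R.le_of_opNorm_le (by linarith) _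
        _ = _ := by field_simp
    have h3 : 1 / (4 * (A * L)) * ‖P x (R (ξ - ξ'))‖ ≤ 1 / 4 * ‖ξ - ξ'‖ := by
      calc _ ≤ 1 / (4 * (A * L)) * (A * L * ‖ξ - ξ'‖) := by gcongr; exact hPR _
        _ = _ := by field_simp
    rw [sub_apply, hTR] at h2
    have h4 : G ξ - G ξ' - (ξ - ξ')
        = (G ξ - G ξ' - vderiv m e (transv φ) x (R (ξ - ξ')))
          + (vderiv m e (transv φ) x (R (ξ - ξ')) - (ξ - ξ')) := by abel
    rw [h4]
    refine (norm_add_le _ _).trans ((add_le_add (h1.trans h3) h2).trans (le_of_eq ?_))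
    ring)
  rw [hG0] at hI
  have hy : ∀ y ∈ rBall x r, y ∈ rBall x₀ σ ∧
      ENNReal.ofReal ‖transv φ y - transv φ x‖ ≤ ENNReal.ofReal C * edist y x ∧
      transv φ y ∈ Metric.ball (transv φ x) (s / 4) := fun y hy => by
    have h1 := edist_lt_ofReal_add (rBall_mono x ((min_le_left _ _).trans (min_le_left _ _)) hy) hxσ
    have h2 := edist_lt_ofReal_add (rBall_mono x ((min_le_left _ _).trans (min_le_right _ _)) hy)
      hxr₃
    rw [add_halves] at h1 h2
    have h3 := hlip y h2 x (rBall_mono x₀ (by linarith) hxr₃)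
    rw [edist_dist, dist_eq_norm] at h3
    refine ⟨h1, h3, ?_⟩
    have h4 : edist y x < ENNReal.ofReal (s / (4 * C)) :=
      rBall_mono x ((min_le_right _ _).trans (min_le_left _ _)) hy
    have h5 : ENNReal.ofReal ‖transv φ y - transv φ x‖ < ENNReal.ofReal (s / 4) := by
      refine h3.trans_lt ?_
      have h6 : ENNReal.ofReal C * edist y x < ENNReal.ofReal C * ENNReal.ofReal (s / (4 * C)) :=
        ENNReal.mul_lt_mul_right (ENNReal.ofReal_pos.2 hC).ne' ENNReal.ofReal_ne_top h4
      rw [← ENNReal.ofReal_mul hC.le] at h6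
      convert h6 using 2
      field_simp
    rw [Metric.mem_ball, dist_eq_norm]
    exact (ENNReal.ofReal_lt_ofReal_iff (by positivity)).1 h5
  have hIs : ∀ y ∈ rBall x r, ‖I (transv φ y)‖ < s := fun y hyr => by
    have h1 := (hy y hyr).2.2
    have h2 := (hI _ h1).1
    rw [Metric.mem_ball, dist_eq_norm] at h1
    linarith
  refine ⟨fun y => expMap (m := m) x (ζ (I (transv φ y))), fun y hyr => ?_, fun y hyr => ?_⟩
  · have h1 : ContMDiffAt (𝓡 m) 𝓘(ℝ, EuclideanSpace ℝ (Fin q)) 1 (fun y => I (transv φ y)) y :=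
      ContMDiffAt.comp y (hI _ (hy y hyr).2.2).2.2.contMDiffAt
        (C1Foliation.contMDiffAt_transv hφ (hσφ y (hy y hyr).1).1)
    have h2 : ContMDiffAt (𝓡 m) 𝓘(ℝ, 𝔼) 1 (fun y => ζ (I (transv φ y))) y :=
      ContMDiffAt.comp y ζ.contDiff.contMDiff.contMDiffAt h1
    have h3 : ContMDiffAt (𝓡 m) (𝓡 m) 1
        (fun y => expMap (m := m) x (ζ (I (transv φ y)))) y :=
      ContMDiffAt.comp y (hexpsm _ (hIs y hyr)) h2
    exact h3.contMDiffWithinAt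
  · obtain ⟨h1, h2, h3⟩ := hy y hyr
    obtain ⟨h4, h5, -⟩ := hI _ h3
    have h6 := hIs y hyr
    have h7 := hzσ _ h6
    refine ⟨(h.mem_suDisk_iff he).2 ⟨P x (R (I (transv φ y))), h.proj_proj _ _,
      (hζn _).trans_lt (hlt _ ρ D hD0 h6
        ((min_le_right _ _).trans ((min_le_right _ _).trans (min_le_left _ _)))), rfl⟩, ?_, ?_⟩
    · refine C1Foliation.mem_leafIn_of_segment hφ (hσφ _ h1).1 (hσφ _ h7).1 h5
        (convex_ball (φ x₀) s₀) (fun p hp => (hball p hp).1) (fun p hp => ?_) (hσφ _ h1).2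
        (hσφ _ h7).2
      have h8 := (hball p hp).2
      rw [rBall, mem_ofPred_eq, edist_comm] at hxρ
      have := edist_lt_ofReal_add h8 hxρ
      rwa [add_halves] at this
    · refine (hz _ h6).trans ?_
      calc ENNReal.ofReal (ρ₂⁻¹ * (D * ‖I (transv φ y)‖))
          ≤ ENNReal.ofReal (ρ₂⁻¹ * D * 2 * ‖transv φ y - transv φ x‖) := by
            refine ENNReal.ofReal_le_ofReal ?_
            calc _ ≤ ρ₂⁻¹ * (D * (2 * ‖transv φ y - transv φ x‖)) := by gcongr
              _ = _ := by ring
        _ = ENNReal.ofReal (ρ₂⁻¹ * D * 2) * ENNReal.ofReal ‖transv φ y - transv φ x‖ :=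
            ENNReal.ofReal_mul (by positivity)
        _ ≤ ENNReal.ofReal (ρ₂⁻¹ * D * 2) * (ENNReal.ofReal C * edist y x) := by gcongr
        _ = ENNReal.ofReal (ρ₂⁻¹ * D * (2 * C)) * edist y x := by
            rw [← mul_assoc, ← ENNReal.ofReal_mul (by positivity)]
            congr 2; ring
        _ ≤ _ := by
            gcongr
            rw [le_inv_comm₀ (by positivity) hr0]
            exact (min_le_right _ _).trans (min_le_right _ _)

end IsTransversal

end Slides

/-! ### Shadowing along the center foliation -/

section QuasiConjugacy

variable {m k q : ℕ} {M : Type*} [EMetricSpace M] [ChartedSpace (EuclideanSpace ℝ (Fin m)) M]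
  {V : Type*} [NormedAddCommGroup V] [InnerProductSpace ℝ V] [FiniteDimensional ℝ V]

local notation "𝔼" => EuclideanSpace ℝ (Fin m)

lemma exists_pos_forall_norm_sub_le {M G : Type*} [PseudoEMetricSpace M] [CompactSpace M]
    [SeminormedAddCommGroup G] {A : M → G} (hA : Continuous A) {η : ℝ} (hη : 0 < η) :
    ∃ δ > 0, ∀ x y, edist y x < ENNReal.ofReal δ → ‖A x - A y‖ ≤ η := by
  obtain ⟨δ, hδ, h⟩ := exists_pos_forall_edist_lt isCompact_univ isOpen_univ (subset_univ _)
    hA.continuousOn hη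
  refine ⟨δ, hδ, fun x y hxy => ?_⟩
  have := (h x (mem_univ x) y hxy).2
  rw [dist_comm, dist_eq_norm] at this
  exact this.le

lemma exists_pos_forall_edist_map_lt {M : Type*} [EMetricSpace M] [CompactSpace M] {f : M → M}
    (hf : Continuous f) {η : ℝ} (hη : 0 < η) :
    ∃ δ > 0, ∀ x y, edist x y < ENNReal.ofReal δ → edist (f x) (f y) < ENNReal.ofReal η := by
  obtain ⟨δ, hδ, h⟩ := EMetric.uniformContinuous_iff.1
    (CompactSpace.uniformContinuous_of_continuous hf) _ (ENNReal.ofReal_pos.2 hη)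
  rcases eq_or_ne δ ⊤ with rfl | h'
  · exact ⟨1, one_pos, fun x y hxy => h (lt_of_lt_of_le hxy le_top)⟩
  · exact ⟨δ.toReal, ENNReal.toReal_pos hδ.ne' h', fun x y hxy =>
      h (lt_of_lt_of_le hxy ENNReal.ofReal_toReal_le)⟩

/-- If the leaves are tangent to `Ec`, and `P` projects along `Ec`, enlarged by the normal spaces,
onto complements of `Ec`, then these complements are transverse to the leaves. -/
lemma isTransversal_of_isTangentTo {W : C1Foliation m k q M}
    {Ec E : M → Submodule ℝ (EuclideanSpace ℝ (Fin m))} (hW : W.IsTangentTo Ec)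
    {e : M → V} {P : M → V →L[ℝ] V} (hP : Continuous P)
    (h1 : ∀ x v, embInv e x (v - P x v) ∈ Ec x) (h2 : ∀ x v, ∃ t ∈ E x, P x v = tderiv e x t)
    (h3 : ∀ x, ∀ t ∈ E x, P x (tderiv e x t) = tderiv e x t)
    (hdisj : ∀ x, ∀ t ∈ E x, t ∈ Ec x → t = 0) : IsTransversal W e E P where
  continuous := hP
  exists_mem := h2
  apply_tderiv := h3
  vderiv_transv φ hφ x hx v := by
    rw [← sub_eq_zero, ← neg_eq_zero, neg_sub, ← map_sub, vderiv_apply,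
      C1Foliation.tderiv_transv hφ hx]
    exact (hW φ hφ x hx _).1 (h1 x v)
  eq_zero φ hφ x hx t ht h0 := by
    rw [C1Foliation.tderiv_transv hφ hx] at h0
    exact hdisj x t ht ((hW φ hφ x hx t).2 h0)

namespace IsTransversal

variable {W : C1Foliation m k q M} {e : M → V} {P : M → V →L[ℝ] V}
  [IsManifold (𝓡 m) ∞ M] [RiemannianBundle (fun x : M => TangentSpace (𝓡 m) x)]
  [IsContMDiffRiemannianBundle (𝓡 m) ∞ (EuclideanSpace ℝ (Fin m))
  (fun x : M => TangentSpace (𝓡 m) x)] [IsRiemannianManifold (𝓡 m) M] [CompactSpace M]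
  {Es Eu : ∀ x : M, Submodule ℝ (TangentSpace (𝓡 m) x)}

/-- The points of the small disks `Σ_ρ(x)` have unique coordinates in `V`, of a norm that is
controlled by the distance to `x`. -/
lemma exists_coordinates
    (h : IsTransversal W e (fun x => (Es x ⊔ Eu x : Submodule ℝ (TangentSpace (𝓡 m) x))) P)
    (he : IsC1Immersion (m := m) e) : ∃ ρ₀ > 0, ∃ c > 0, ∀ ρ ≤ ρ₀,
      (∀ x, ∀ z ∈ suDisk Es Eu x ρ, ∃ w, P x w = w ∧ rnorm (m := m) x (embInv e x w) < ρ ∧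
        expV m e x w = z ∧ ENNReal.ofReal ‖w‖ ≤ ENNReal.ofReal c * edist z x) ∧
      ∀ x w w', P x w = w → P x w' = w' → rnorm (m := m) x (embInv e x w) < ρ →
        rnorm (m := m) x (embInv e x w') < ρ → expV m e x w = expV m e x w' → w = w' := by
  obtain ⟨ρ₁, hρ₁, h1⟩ := he.exists_norm_le_edist
  obtain ⟨B, hB, hBe⟩ := he.exists_rnorm_equiv
  have hn : ∀ ρ ≤ ρ₁ / B, ∀ x w, P x w = w → rnorm (m := m) x (embInv e x w) < ρ → ‖w‖ < ρ₁ :=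
    fun ρ hρ x w hw hwρ => by
      have h3 := h.vderiv_self he hw
      rw [vderiv_apply] at h3
      have h4 := (hBe x).2 (embInv e x w)
      rw [h3] at h4
      have h5 := hwρ.trans_le hρ
      rw [lt_div_iff₀ hB, mul_comm] at h5
      exact h4.trans_lt h5
  refine ⟨ρ₁ / B, by positivity, ρ₁⁻¹, by positivity, fun ρ hρ =>
    ⟨fun x z hz => ?_, fun x w w' hw hw' hwρ hwρ' hww' => ?_⟩⟩
  · obtain ⟨w, hw, hwρ, hwz⟩ := (h.mem_suDisk_iff he).1 hz
    have h2 := h1 x w 0 (h.vderiv_self he hw) (map_zero _) (hn ρ hρ x w hw hwρ) (by simpa using hρ₁)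
    have h3 : expV m e x 0 = x := by
      rw [expV, map_zero]; exact expMap_zero (m := m) x
    rw [sub_zero, h3, hwz] at h2
    exact ⟨w, hw, hwρ, hwz, h2⟩
  · have h2 := h1 x w w' (h.vderiv_self he hw) (h.vderiv_self he hw') (hn ρ hρ x w hw hwρ)
      (hn ρ hρ x w' hw' hwρ')
    rw [hww', edist_self, mul_zero, nonpos_iff_eq_zero, ENNReal.ofReal_eq_zero] at h2
    exact sub_eq_zero.1 (norm_le_zero_iff.1 h2)

/-- The slides `exists_slide` onto the disks are center slides: on small disks the intersection
points are unique. -/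
lemma exists_isCenterSlide
    (h : IsTransversal W e (fun x => (Es x ⊔ Eu x : Submodule ℝ (TangentSpace (𝓡 m) x))) P)
    (he : IsC1Immersion (m := m) e) : ∃ ρ₀ > 0, ∀ ρ, 0 < ρ → ρ < ρ₀ →
      (∀ y₀, ∃ φ ∈ W.charts, ∀ᶠ y in 𝓝 y₀, rBall y ρ ⊆ φ.source) ∧
      ∃ (r K : ℝ) (τ : M → M → M), 0 < r ∧ r < ρ ∧ 1 < K ∧ IsCenterSlide W Es Eu ρ r K τ := by
  obtain ⟨ρ₁, hρ₁, huniq⟩ := h.exists_eq_of_mem_leafIn he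
  obtain ⟨ρ₂, hρ₂, hcover⟩ := W.exists_rBall_subset_source
  refine ⟨min ρ₁ ρ₂, by positivity, fun ρ hρ hρ₀ => ⟨fun y₀ => ?_, ?_⟩⟩
  · obtain ⟨φ, hφ, hsub⟩ := hcover y₀
    have hlt : 0 < ρ₂ - ρ := sub_pos.2 (hρ₀.trans_le (min_le_right _ _))
    refine ⟨φ, hφ, ?_⟩
    filter_upwards [(isOpen_rBall y₀ (ρ₂ - ρ)).eventually_mem (mem_rBall_self y₀ hlt)]
      with y hy z hz
    have := edist_lt_ofReal_add hz hy
    rw [add_sub_cancel] at this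
    exact hsub this
  · obtain ⟨r, hr, hslide⟩ := h.exists_slide he hρ
    choose τ hτ1 hτ2 using hslide
    have hmono : ∀ x, suDisk Es Eu x ρ ⊆ suDisk Es Eu x ρ₁ := fun x =>
      image_mono fun v hv => ⟨hv.1, hv.2.trans_le (hρ₀.le.trans (min_le_left _ _))⟩
    have hrmono : ∀ x : M, rBall x (min r (ρ / 2)) ⊆ rBall x r := fun x =>
      rBall_mono x (min_le_left _ _)
    have hρmono : ∀ x : M, rBall x ρ ⊆ rBall x ρ₁ := fun x =>
      rBall_mono x (hρ₀.le.trans (min_le_left _ _))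
    refine ⟨min r (ρ / 2), r⁻¹ + 1, τ, by positivity, (min_le_right _ _).trans_lt (by linarith),
      by have := inv_pos.2 hr; linarith, ⟨fun x y hy => ?_, fun x y hy => ?_,
      fun x => (hτ1 x).mono (hrmono x), fun x y hy => ?_⟩⟩
    · obtain ⟨h1, h2, -⟩ := hτ2 x y (hrmono x hy)
      refine Subset.antisymm (fun z hz => mem_singleton_iff.2 ?_) (singleton_subset_iff.2 ⟨h1, h2⟩)
      exact huniq x y z (τ x y) (hmono x hz.1) (hmono x h1) (W.leafIn_mono (hρmono x) y hz.2)
        (W.leafIn_mono (hρmono x) y h2)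
    · exact W.leafIn_mono (subset_univ _) y (hτ2 x y (hrmono x hy)).2.1
    · refine (hτ2 x y (hrmono x hy)).2.2.trans ?_
      gcongr
      linarith

end IsTransversal

/-- Shadowing along the center foliation: given the slides, a homeomorphism close to `f` is
quasi-conjugate to `f`.  In the coordinates `expV`, the map `τ_{g x} ∘ f` from the disk at `x` to
the disk at `g x` is a fibre map `H x` close to the linear cocycle, and a quasi-conjugacy is the
same as a small continuous orbit of these fibre maps.  The hypotheses `hcoord` and `huniq` say that
the disks have coordinates, of a size controlled by the distance to the center. -/
theorem IsHyperbolicCocycle.exists_isQuasiConj {U : Type*} [NormedAddCommGroup U] [NormedSpace ℝ U]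
    [IsManifold (𝓡 m) ∞ M] [RiemannianBundle (fun x : M => TangentSpace (𝓡 m) x)]
    [IsContMDiffRiemannianBundle (𝓡 m) ∞ (EuclideanSpace ℝ (Fin m))
    (fun x : M => TangentSpace (𝓡 m) x)] [IsRiemannianManifold (𝓡 m) M] [CompactSpace M]
    {Es Eu : ∀ x : M, Submodule ℝ (TangentSpace (𝓡 m) x)} {W : C1Foliation m k q M} {e : M → V}
    {f : M → M} {Ps Pu Di : M → V →L[ℝ] V} {Js Ju : M → V →L[ℝ] U} {θ : ℝ}
    (hf : ContMDiff (𝓡 m) (𝓡 m) 1 f) (he : IsC1Immersion (m := m) e)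
    (hc : IsHyperbolicCocycle f Ps Pu (fun x => vderiv m e (e ∘ f) x ∘L (Ps x + Pu x)) Di Js Ju θ)
    (h : IsTransversal W e (fun x => (Es x ⊔ Eu x : Submodule ℝ (TangentSpace (𝓡 m) x)))
      (fun x => Ps x + Pu x)) {ρ c : ℝ} (hρ : 0 < ρ) (hc0 : 0 < c)
    (hcoord : ∀ x, ∀ z ∈ suDisk Es Eu x ρ, ∃ w, (Ps x + Pu x) w = w ∧
      rnorm (m := m) x (embInv e x w) < ρ ∧
      expV m e x w = z ∧ ENNReal.ofReal ‖w‖ ≤ ENNReal.ofReal c * edist z x)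
    (huniq : ∀ x w w', (Ps x + Pu x) w = w → (Ps x + Pu x) w' = w' →
      rnorm (m := m) x (embInv e x w) < ρ →
      rnorm (m := m) x (embInv e x w') < ρ → expV m e x w = expV m e x w' → w = w')
    (hchart : ∀ y₀, ∃ φ ∈ W.charts, ∀ᶠ y in 𝓝 y₀, rBall y ρ ⊆ φ.source) {r K : ℝ}
    {τ : M → M → M} (hr : 0 < r) (hK : 1 < K) (hτ : IsCenterSlide W Es Eu ρ r K τ) :
    ∃ ε₀ : ℝ, 0 < ε₀ ∧ ε₀ < ρ ∧ ∀ ε : ℝ, 0 < ε → ε < ε₀ → ∃ δ : ℝ, 0 < δ ∧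
      ∀ g : M ≃ₜ M, unifDist f g < ENNReal.ofReal δ →
        ∃ p : C(M, M), Function.Surjective p ∧ IsQuasiConj Es Eu ρ r τ f g ε p ∧
          ∀ p' : C(M, M), IsQuasiConj Es Eu ρ r τ f g ε p' → p' = p := by
  have hK0 : 0 < K := one_pos.trans hK
  obtain ⟨B, hB, hBe⟩ := he.exists_rnorm_equiv
  obtain ⟨η, hη, Co, hCo, horb⟩ := hc.exists_orbit
  obtain ⟨κ₁, hκ₁, hest⟩ := h.exists_norm_sub_sub_le he hf hρ hchart hη
  obtain ⟨κ₂, hκ₂, hcont⟩ := h.exists_continuous_of_mem_leafIn he hf.continuous hρ hchart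
  obtain ⟨ρ₃, hρ₃, hexpc⟩ := he.exists_continuousAt_expV
  obtain ⟨ρ₄, hρ₄, hnear⟩ := exists_edist_expMap_le (m := m) (M := M)
  obtain ⟨εs, hεs, hsurj⟩ := exists_pos_forall_surjective_of_near_id m M
  set κ := min κ₁ κ₂ with hκ
  have hκ0 : 0 < κ := by positivity
  -- If `f (exp v)` is within `r'` of `g x`, then the coordinates of its slide are less than `κ`.
  set r' := min r (κ / (c * K)) with hr'
  have hr'0 : 0 < r' := by positivity
  obtain ⟨ε₂, hε₂, hfu⟩ := exists_pos_forall_edist_map_lt hf.continuous (η := r' / 2)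
    (by positivity)
  -- The size of the sections that are considered.
  obtain ⟨εH, hεH, hεH'⟩ : ∃ εH > 0, ρ₄⁻¹ * (B * εH) < ε₂ ∧ B * εH < ρ₄ ∧ B * εH < ρ ∧ εH < κ ∧
      εH < ρ₃ := by
    have h1 : ∀ a b : ℝ, 0 < b → ∀ᶠ ε in 𝓝[>] (0 : ℝ), a * ε < b := fun a b hb => by
      have : Tendsto (fun ε : ℝ => a * ε) (𝓝[>] 0) (𝓝 (a * 0)) :=
        (tendsto_id.mono_left nhdsWithin_le_nhds).const_mul a
      rw [mul_zero] at this
      exact this.eventually (gt_mem_nhds hb)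
    obtain ⟨ε, h2, h3, h4, h5, h6, h7⟩ := ((eventually_mem_nhdsWithin
      (a := (0 : ℝ)) (s := Ioi 0)).and ((h1 (ρ₄⁻¹ * B) ε₂ hε₂).and
      ((h1 B ρ₄ hρ₄).and ((h1 B ρ hρ).and ((h1 1 κ hκ0).and (h1 1 ρ₃ hρ₃)))))).exists
    exact ⟨ε, h2, by rw [← mul_assoc]; exact h3, h4, h5, by linarith, by linarith⟩
  obtain ⟨hεHε₂, hεHρ₄, hεHρ, hεHκ, hεHρ₃⟩ := hεH'
  have hrn : ∀ x v, ‖v‖ ≤ εH → rnorm (m := m) x (embInv e x v) ≤ B * εH := fun x v hv =>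
    ((hBe x).1 v).trans (by gcongr)
  have hexpn : ∀ x v, ∀ R ≤ εH, ‖v‖ ≤ R →
      edist (expV m e x v) x ≤ ENNReal.ofReal (ρ₄⁻¹ * (B * R)) := fun x v R hR hv =>
    (hnear x (embInv e x v) ((hrn x v (hv.trans hR)).trans_lt hεHρ₄)).trans
      (ENNReal.ofReal_le_ofReal (by
        have := (hBe x).1 v
        gcongr
        exact this.trans (by gcongr)))
  have hexp0 : ∀ x, expV m e x 0 = x := fun x => by
    rw [expV, map_zero]; exact expMap_zero (m := m) x
  refine ⟨min (min (ρ / 2) (εH / c)) εs, by positivity,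
    ((min_le_left _ _).trans (min_le_left _ _)).trans_lt (by linarith), fun ε hε hεε₀ => ?_⟩
  set R := min εH (ε / (2 * (ρ₄⁻¹ * B))) with hR
  have hR0 : 0 < R := by positivity
  have hRε : ρ₄⁻¹ * (B * R) ≤ ε / 2 := by
    calc ρ₄⁻¹ * (B * R) ≤ ρ₄⁻¹ * (B * (ε / (2 * (ρ₄⁻¹ * B)))) := by
          gcongr; exact min_le_right _ _
      _ = ε / 2 := by field_simp
  obtain ⟨δ₁, hδ₁, hPu⟩ := exists_pos_forall_norm_sub_le hc.continuous_Pu hη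
  obtain ⟨δ₂, hδ₂, hDi⟩ := exists_pos_forall_norm_sub_le hc.continuous_Di hη
  obtain ⟨δ₃, hδ₃, hJs⟩ := exists_pos_forall_norm_sub_le hc.continuous_Js hη
  obtain ⟨δ₄, hδ₄, hJu⟩ := exists_pos_forall_norm_sub_le hc.continuous_Ju hη
  set δ := min (min (min δ₁ δ₂) (min δ₃ δ₄)) (min (min (r' / 2) κ₁) (R / Co / (c * K))) with hδ
  have hδ0 : 0 < δ := by positivity
  refine ⟨δ, hδ0, fun g hg => ?_⟩
  have hfg : ∀ x, ∀ a, δ ≤ a → edist (f x) (g x) < ENNReal.ofReal a := fun x a ha =>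
    ((le_iSup (fun x => edist (f x) (g x)) x).trans_lt hg).trans_le (ENNReal.ofReal_le_ofReal ha)
  have hδ1 : δ ≤ δ₁ := (min_le_left _ _).trans ((min_le_left _ _).trans (min_le_left _ _))
  have hδ2 : δ ≤ δ₂ := (min_le_left _ _).trans ((min_le_left _ _).trans (min_le_right _ _))
  have hδ3 : δ ≤ δ₃ := (min_le_left _ _).trans ((min_le_right _ _).trans (min_le_left _ _))
  have hδ4 : δ ≤ δ₄ := (min_le_left _ _).trans ((min_le_right _ _).trans (min_le_right _ _))
  have hδ5 : δ ≤ r' / 2 := (min_le_right _ _).trans ((min_le_left _ _).trans (min_le_left _ _))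
  have hδ6 : δ ≤ κ₁ := (min_le_right _ _).trans ((min_le_left _ _).trans (min_le_right _ _))
  have hδ7 : δ ≤ R / Co / (c * K) := (min_le_right _ _).trans (min_le_right _ _)
  -- The points `f (exp v)` are in the domain of the slides.
  have hdom' : ∀ x v, ‖v‖ ≤ εH → f (expV m e x v) ∈ rBall (g x) r' := fun x v hv => by
    have h1 := hfu _ _ ((hexpn x v εH le_rfl hv).trans_lt
      ((ENNReal.ofReal_lt_ofReal_iff hε₂).2 hεHε₂))
    have := edist_lt_ofReal_add h1 (hfg x _ hδ5)
    rwa [add_halves] at this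
  have hdom : ∀ x v, ‖v‖ ≤ εH → f (expV m e x v) ∈ rBall (g x) r := fun x v hv =>
    rBall_mono _ (min_le_left _ _) (hdom' x v hv)
  have hslide : ∀ x y, y ∈ rBall x r → τ x y ∈ suDisk Es Eu x ρ ∧ τ x y ∈ W.leafIn (rBall x ρ) y :=
    fun x y hy => by
      have h1 : τ x y ∈ suDisk Es Eu x ρ ∩ W.leafIn (rBall x ρ) y := by
        rw [hτ.inter_eq x y hy]; exact mem_singleton _
      exact h1
  have hH : ∀ x v, ∃ w, ‖v‖ ≤ εH → (Ps (g x) + Pu (g x)) w = w ∧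
      rnorm (m := m) (g x) (embInv e (g x) w) < ρ ∧
      expV m e (g x) w = τ (g x) (f (expV m e x v)) ∧
      ENNReal.ofReal ‖w‖ ≤ ENNReal.ofReal (c * K) * edist (f (expV m e x v)) (g x) := fun x v => by
    by_cases hv : ‖v‖ ≤ εH
    · obtain ⟨w, h1, h2, h3, h4⟩ := hcoord (g x) _ (hslide _ _ (hdom x v hv)).1
      refine ⟨w, fun _ => ⟨h1, h2, h3, h4.trans ?_⟩⟩
      rw [ENNReal.ofReal_mul hc0.le, mul_assoc]
      gcongr
      exact hτ.edist_le _ _ (hdom x v hv)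
    · exact ⟨0, fun h' => absurd h' hv⟩
  choose H hH using hH
  have hHκ : ∀ x v, ‖v‖ ≤ εH → ‖H x v‖ < κ := fun x v hv => by
    have h1 := (hH x v hv).2.2.2
    have h2 : ENNReal.ofReal (c * K) * edist (f (expV m e x v)) (g x)
        < ENNReal.ofReal (c * K) * ENNReal.ofReal (κ / (c * K)) :=
      ENNReal.mul_lt_mul_right (ENNReal.ofReal_pos.2 (by positivity)).ne' ENNReal.ofReal_ne_top
        (rBall_mono _ (min_le_right _ _) (hdom' x v hv))
    rw [← ENNReal.ofReal_mul (by positivity), mul_div_cancel₀ _ (by positivity)] at h2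
    exact (ENNReal.ofReal_lt_ofReal_iff hκ0).1 (h1.trans_lt h2)
  have hHleaf : ∀ x v, ‖v‖ ≤ εH →
      expV m e (g x) (H x v) ∈ W.leafIn (rBall (g x) ρ) (f (expV m e x v)) := fun x v hv => by
    rw [(hH x v hv).2.2.1]
    exact (hslide _ _ (hdom x v hv)).2
  obtain ⟨horbu, horbe⟩ := horb g (fun x => hPu _ _ (hfg x _ hδ1)) (fun x => hDi _ _ (hfg x _ hδ2))
    (fun x => hJs _ _ (hfg x _ hδ3)) (fun x => hJu _ _ (hfg x _ hδ4)) εH H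
    (fun x v _ hvε => (hH x v hvε).1)
    (fun x v w hv hw hvε hwε => by
      have hvw : (Ps x + Pu x) (v - w) = v - w := by
        rw [map_sub, add_apply, add_apply, hv, hw]
      have := hest x (g x) (hfg x _ hδ6) v w (H x v) (H x w) hv hw (hH x v hvε).1 (hH x w hwε).1
        (hvε.trans_lt (hεHκ.trans_le (min_le_left _ _)))
        (hwε.trans_lt (hεHκ.trans_le (min_le_left _ _)))
        ((hHκ x v hvε).trans_le (min_le_left _ _)) ((hHκ x w hwε).trans_le (min_le_left _ _))
        (hHleaf x v hvε) (hHleaf x w hwε)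
      rw [ContinuousLinearMap.comp_apply, hvw]
      exact this)
    (fun v hv _ hvε => hcont g v (fun x => H x (v x)) g.continuous hv
      (fun x => (hvε x).trans_lt (hεHκ.trans_le (min_le_right _ _)))
      (fun x => (hH x (v x) (hvε x)).1)
      (fun x => (hHκ x (v x) (hvε x)).trans_le (min_le_right _ _))
      (fun x => hHleaf x (v x) (hvε x)))
  obtain ⟨v, hvc, hvP, hvR, hvo⟩ := horbe R hR0 (min_le_left _ _) (fun x => by
    have h1 := (hH x 0 (by simpa using hεH.le)).2.2.2
    rw [hexp0] at h1
    have h2 : ENNReal.ofReal (c * K) * edist (f x) (g x)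
        ≤ ENNReal.ofReal (c * K) * ENNReal.ofReal (R / Co / (c * K)) := by
      gcongr
      exact (hfg x _ hδ7).le
    rw [← ENNReal.ofReal_mul (by positivity), mul_div_cancel₀ _ (by positivity)] at h2
    exact (ENNReal.ofReal_le_ofReal_iff (by positivity)).1 (h1.trans h2))
  have hvε : ∀ x, ‖v x‖ ≤ εH := fun x => (hvR x).trans (min_le_left _ _)
  have hpc : Continuous fun x => expV m e x (v x) := continuous_iff_continuousAt.2 fun x =>
    ContinuousAt.comp (g := fun z : M × V => expV m e z.1 z.2) (f := fun x => (x, v x))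
      (hexpc x (v x) ((hvε x).trans_lt hεHρ₃)) (continuousAt_id.prodMk hvc.continuousAt)
  have hpε : ∀ x, edist (expV m e x (v x)) x ≤ ENNReal.ofReal (ε / 2) := fun x =>
    (hexpn x (v x) R (min_le_left _ _) (hvR x)).trans (ENNReal.ofReal_le_ofReal hRε)
  have hεε : ENNReal.ofReal (ε / 2) < ENNReal.ofReal ε :=
    (ENNReal.ofReal_lt_ofReal_iff hε).2 (by linarith)
  refine ⟨⟨fun x => expV m e x (v x), hpc⟩, hsurj _ hpc fun x => ?_, ⟨?_, fun x => ?_, fun x =>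
    hdom x _ (hvε x), fun x => ?_⟩, fun p' hp' => ?_⟩
  · exact ((hpε x).trans_lt hεε).trans_le
      (ENNReal.ofReal_le_ofReal (hεε₀.le.trans (min_le_right _ _)))
  · exact (iSup_le hpε).trans_lt hεε
  · exact (h.mem_suDisk_iff he).2 ⟨v x, hvP x, (hrn x _ (hvε x)).trans_lt hεHρ, rfl⟩
  · change expV m e (g x) (v (g x)) = _
    rw [hvo x]
    exact (hH x (v x) (hvε x)).2.2.1
  · have hco := fun x => hcoord x (p' x) (hp'.mem_disk x)
    choose w hwP hwρ hwp hwc using hco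
    have hwε : ∀ x, ‖w x‖ ≤ εH := fun x => by
      have h1 : edist (p' x) x < ENNReal.ofReal ε :=
        (le_iSup (fun x => edist (p' x) (id x)) x).trans_lt hp'.close
      have h2 : edist (p' x) x ≤ ENNReal.ofReal (εH / c) := h1.le.trans
        (ENNReal.ofReal_le_ofReal (hεε₀.le.trans ((min_le_left _ _).trans (min_le_right _ _))))
      have h3 : ENNReal.ofReal c * edist (p' x) x
          ≤ ENNReal.ofReal c * ENNReal.ofReal (εH / c) := by gcongr
      rw [← ENNReal.ofReal_mul hc0.le, mul_div_cancel₀ _ hc0.ne'] at h3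
      exact (ENNReal.ofReal_le_ofReal_iff hεH.le).1 ((hwc x).trans h3)
    have hwo : ∀ x, w (g x) = H x (w x) := fun x => by
      obtain ⟨h1, h2, h3, -⟩ := hH x (w x) (hwε x)
      refine huniq (g x) _ _ (hwP _) h1 (hwρ _) h2 ?_
      rw [h3, hwp, hwp]
      exact hp'.conj x
    have hwv : w = v := horbu w v hwP hvP hwε hvε hwo hvo
    ext x
    rw [← hwp x, hwv]
    rfl

end QuasiConjugacy

end

theorem theoremB {m k q : ℕ} {M : Type*} [EMetricSpace M] [CompactSpace M]
    [ChartedSpace (EuclideanSpace ℝ (Fin m)) M] [IsManifold (𝓡 m) ∞ M]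
    [RiemannianBundle (fun x : M => TangentSpace (𝓡 m) x)]
    [IsContMDiffRiemannianBundle (𝓡 m) ∞ (EuclideanSpace ℝ (Fin m))
      (fun x : M => TangentSpace (𝓡 m) x)]
    [IsRiemannianManifold (𝓡 m) M]
    (n : ℕ∞) (hn : 1 ≤ n) (f : M ≃ₘ^n⟮𝓡 m, 𝓡 m⟯ M)
    (Es Ec Eu : ∀ x : M, Submodule ℝ (TangentSpace (𝓡 m) x))
    (hf : IsPartiallyHyperbolic f Es Ec Eu)
    (W : C1Foliation m k q M) (hW : W.IsTangentTo Ec) :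
    ∃ ρ₀ > 0, ∀ ρ : ℝ, 0 < ρ → ρ < ρ₀ →
      IsExpRadius m M ρ ∧
      ∃ (r K : ℝ) (τ : M → M → M), 0 < r ∧ r < ρ ∧ 1 < K ∧ IsCenterSlide W Es Eu ρ r K τ ∧
        ∃ ε₀ : ℝ, 0 < ε₀ ∧ ε₀ < ρ ∧
          ∀ ε : ℝ, 0 < ε → ε < ε₀ → ∃ δ : ℝ, 0 < δ ∧
            ∀ g : M ≃ₜ M, unifDist f g < ENNReal.ofReal δ →
              ∃ p : C(M, M), Function.Surjective p ∧ IsQuasiConj Es Eu ρ r τ f g ε p ∧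
                ∀ p' : C(M, M), IsQuasiConj Es Eu ρ r τ f g ε p' → p' = p := by
  obtain ⟨N, e, he, -, hinj⟩ := exists_embedding_euclidean_of_compact (I := 𝓡 m) (M := M)
  have hie : IsC1Immersion (m := m) e := ⟨he.of_le (by norm_cast), hinj⟩
  have hn1 : (1 : ℕ∞ω) ≤ (n : ℕ∞ω) := by exact_mod_cast hn
  have hf1 : ContMDiff (𝓡 m) (𝓡 m) 1 f := f.contMDiff.of_le hn1
  have hf2 : ContMDiff (𝓡 m) (𝓡 m) 1 f.symm := f.symm.contMDiff.of_le hn1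
  obtain ⟨l, l', μ', μ, C, hpair⟩ := hf.exists_isDominatedPair hf1 hf2 f.symm_apply_apply
    f.apply_symm_apply
  obtain ⟨Ps, Pu, N', Di, Js, Ju, θ, hc, h1, h2, h3⟩ := hpair.exists_isHyperbolicCocycle hie hW
  have hT : IsTransversal W e (fun x => (Es x ⊔ Eu x : Submodule ℝ (TangentSpace (𝓡 m) x)))
      (fun x => Ps x + Pu x) :=
    isTransversal_of_isTangentTo hW (hc.continuous_Ps.add hc.continuous_Pu) h1 h2 h3
      fun x t ht ht' => Submodule.disjoint_def.1 (hf.isCompl x).disjoint t ht' ht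
  obtain ⟨ρ₁, hρ₁, hexp⟩ := hie.exists_isExpRadius
  obtain ⟨ρ₂, hρ₂, c, hc0, hcoord⟩ := hT.exists_coordinates hie
  obtain ⟨ρ₃, hρ₃, hslide⟩ := hT.exists_isCenterSlide hie
  refine ⟨min ρ₁ (min ρ₂ ρ₃), by positivity, fun ρ hρ hρ₀ =>
    ⟨hexp ρ (hρ₀.le.trans (min_le_left _ _)), ?_⟩⟩
  obtain ⟨hchart, r, K, τ, hr, hrρ, hK, hτ⟩ :=
    hslide ρ hρ (hρ₀.trans_le ((min_le_right _ _).trans (min_le_right _ _)))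
  obtain ⟨hco, hun⟩ := hcoord ρ (hρ₀.le.trans ((min_le_right _ _).trans (min_le_left _ _)))
  exact ⟨r, K, τ, hr, hrρ, hK, hτ,
    hc.exists_isQuasiConj hf1 hie hT hρ hc0 hco hun hchart hr hK hτ⟩
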